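/- **Weak-strong uniqueness for weighted mean curvature flow.** Let $N\ge 2$, $T\in(0,\infty)$, and let $\sigma\in C^{1,1}(\mathbb R^N;(0,\infty))$ satisfy $0<\delta\le\sigma\le C_\delta$. A set $A\subset\mathbb R^N$ has finite perimeter if $\chi_A\in BV(\mathbb R^N)$; then $n_A=\frac{d\nabla\chi_A}{d|\nabla\chi_A|}$ is its inner normal and $E[A]=\int_{\mathbb R^N}\sigma\,d|\nabla\chi_A|$. *Calibrated flow.* Let $\mathcal A(t)\subset\mathbb R^N$, $t\in[0,T]$, be open sets with smooth boundary, interior unit normal $n_{\mathcal A(t)}$ and normal velocity $\mathcal V(\cdot,t)$ in the direction $n_{\mathcal A(t)}$. Write $d(x,t)=\operatorname{dist}(x,\partial\mathcal A(t))$ (with $d=\infty$ if $\partial\mathcal A(t)=\emptyset$) and $\bar d=\min\{d,1\}$; all $O(\cdot)$ are uniform on $\mathbb R^N\times[0,T]$. A calibration of $\mathcal A$ is a triple $(\xi,B,\vartheta)$, $\xi,B:\mathbb R^N\times[0,T]\to\mathbb R^N$, $\vartheta:\mathbb R^N\times[0,T]\to\mathbb R$, with 1. $\xi\in C^2([0,T];C_c(\mathbb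 R^N))\cap C([0,T];C^1_c(\mathbb R^N))$, $B\in C([0,T];C_c^1(\mathbb R^N))$, $\vartheta\in C^1(\mathbb R^N\times[0,T])\cap L^\infty$; 2. $\xi(\cdot,t)=n_{\mathcal A(t)}$ on $\partial\mathcal A(t)$, and $|\xi|\le\max\{0,1-c\,d^2\}$ for some constant $c>0$; 3. $B(\cdot,t)=\mathcal V n_{\mathcal A(t)}$ on $\partial\mathcal A(t)$; 4. $\vartheta(\cdot,t)>0$ in $\mathcal A(t)$, $\vartheta(\cdot,t)<0$ in $\mathbb R^N\setminus\overline{\mathcal A(t)}$, $\vartheta(\cdot,t)=0$ on $\partial\mathcal A(t)$, and $\bar d\le C|\vartheta|$ for some constant $C>0$; 5. $\partial_t\xi+(B\cdot\nabla)\xi+(\nabla B)^{\mathsf T}\xi=O(\bar d)$, $\ \partial_t|\xi|^2+(B\cdot\nabla)|\xi|^2=O(\bar d^2)$, $\ \partial_t\vartheta+(B\cdot\nabla)\vartheta=O(\bar d)$; 6. $-\nabla\cdot\xi-\nabla\log\sigma\cdot\xi=B\cdot\xi+O(\bar d)$. *BV solution.* Let $T^*\ge T$. A family $A(t)$, $t\in[0,T^*]$,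 of sets of finite perimeter, such that $t\mapsto\chi_{A(t)}\,dx$ and $t\mapsto|\nabla\chi_{A(t)}|$ are measurable in $t$, is a BV solution of weighted mean curvature flow with initial set $A(0)$ if there is a measurable $V$ with $\int_0^{T^*}\!\int\sigma V^2\,d|\nabla\chi_{A(t)}|\,dt<\infty$ such that * for a.e. $T'\in(0,T^*)$ and all $\zeta\in C_c^\infty(\mathbb R^N\times[0,T^*))$, $$\int_{A(T')}\zeta(\cdot,T')\,dx-\int_{A(0)}\zeta(\cdot,0)\,dx=\int_0^{T'}\!\!\int_{A(t)}\partial_t\zeta\,dx\,dt-\int_0^{T'}\!\!\int V\zeta\,d|\nabla\chi_{A(t)}|\,dt;$$ * for a.e. $t\in(0,T^*)$ and all $\Psi\in C^1_c(\mathbb R^N;\mathbb R^N)$, $$\int\sigma V\,\Psi\cdot n_{A(t)}\,d|\nabla\chi_{A(t)}|=-\int\sigma(\mathrm{Id}-n_{A(t)}\otimes n_{A(t)}):\nabla\Psi\,d|\nabla\chi_{A(t)}|-\int\nabla\sigma\cdot\Psi\,d|\nabla\chi_{A(t)}|;$$ * for a.e. $T'\in(0,T^*)$, $\ E[A(T')]+\int_0^{T'}\!\int\sigma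 V^2\,d|\nabla\chi_{A(t)}|\,dt\le E[A(0)]$. *Theorem.* Let $\mathcal A(t)$, $t\in[0,T]$, be calibrated by $(\xi,B,\vartheta)$, and let $A(t)$, $t\in[0,T^*]$, $T^*\ge T$, be a BV solution. For $t\in[0,T]$ define in $[0,\infty]$ (both integrands are nonnegative) $$E_{\rm rel}(t)=\int_{\mathbb R^N}\sigma\,(1-n_{A(t)}\cdot\xi(\cdot,t))\,d|\nabla\chi_{A(t)}|,\qquad E_{\rm bulk}(t)=\int_{\mathbb R^N}\sigma\,(\chi_{\mathcal A(t)}-\chi_{A(t)})\,\vartheta(\cdot,t)\,dx.$$ Then there is a constant $C>0$, depending only on the fixed data $N,T,\sigma$ and on $(\xi,B,\vartheta)$ (in particular not on $A$ or $T^*$), such that for a.e. $T'\in(0,T)$ $$E_{\rm rel}(T')\le E_{\rm rel}(0)+C\int_0^{T'}E_{\rm rel}(t)\,dt,$$ $$E_{\rm bulk}(T')\le E_{\rm rel}(0)+E_{\rm bulk}(0)+C\int_0^{T'}\big(E_{\rm rel}(t)+E_{\rm bulk}(t)\big)\,dt.$$ In particular, if $A(0)=\mathcal A(0)$ up to a Lebesgue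 null set, then $A(t)=\mathcal A(t)$ up to a Lebesgue null set for a.e. $t\in(0,T)$. -/

import Mathlib

open MeasureTheory Set Filter Topology
open scoped ENNReal ContDiff BoundedContinuousFunction InnerProductSpace

noncomputable section

namespace WeightedMCF

/-- The ambient space `ℝ^N` with its Euclidean norm. -/
abbrev E (N : ℕ) : Type := EuclideanSpace ℝ (Fin N)

variable {N : ℕ}

/-- The divergence `∑ᵢ ∂ᵢ fᵢ` of a vector field. -/
def vdiv (f : E N → E N) (x : E N) : ℝ :=
  ∑ i : Fin N, (fderiv ℝ f x (EuclideanSpace.single i 1)) i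

/-! ### Sets of finite perimeter -/

/-- `∇χ_A = n μ` as distributions on `ℝ^N`, where `μ` is a finite Borel measure and `|n| = 1`
holds `μ`-almost everywhere. By uniqueness of the polar decomposition these conditions
determine `μ = |∇χ_A|`, and they determine `n = d∇χ_A / d|∇χ_A|` up to a `μ`-null set. -/
structure IsIndicatorGradient (A : Set (E N)) (μ : Measure (E N)) (n : E N → E N) : Prop where
  finite : IsFiniteMeasure μ
  measurable_normal : Measurable n
  norm_normal : ∀ᵐ x ∂μ, ‖n x‖ = 1
  integral_div : ∀ φ : E N → E N, ContDiff ℝ 1 φ → HasCompactSupport φ →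
    ∫ x in A, vdiv φ x = - ∫ x, ⟪φ x, n x⟫_ℝ ∂μ

/-- `χ_A ∈ BV(ℝ^N)`: the set `A` is Lebesgue measurable with finite volume, and the distributional
gradient of `χ_A` is a finite vector-valued Borel measure. -/
structure HasFinitePerimeter (A : Set (E N)) : Prop where
  nullMeasurable : NullMeasurableSet A volume
  volume_lt_top : volume A < ⊤
  exists_gradient : ∃ p : Measure (E N) × (E N → E N), IsIndicatorGradient A p.1 p.2

open Classical in
/-- The perimeter measure `|∇χ_A|` (set to `0` if `A` does not have finite perimeter). -/
def perimeterMeasure (A : Set (E N)) : Measure (E N) :=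
  if h : ∃ p : Measure (E N) × (E N → E N), IsIndicatorGradient A p.1 p.2 then h.choose.1 else 0

open Classical in
/-- The measure-theoretic inner unit normal `n_A = d∇χ_A / d|∇χ_A|`; it is meaningful
`|∇χ_A|`-almost everywhere. -/
def measureNormal (A : Set (E N)) : E N → E N :=
  if h : ∃ p : Measure (E N) × (E N → E N), IsIndicatorGradient A p.1 p.2 then h.choose.2 else 0

theorem HasFinitePerimeter.isIndicatorGradient {A : Set (E N)} (h : HasFinitePerimeter A) :
    IsIndicatorGradient A (perimeterMeasure A) (measureNormal A) := by
  have h' := h.exists_gradient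
  simp only [perimeterMeasure, measureNormal, dif_pos h']
  exact h'.choose_spec

/-- The weighted perimeter `∫ σ d|∇χ_A|`. -/
def weightedPerimeter (σ : E N → ℝ) (A : Set (E N)) : ℝ≥0∞ :=
  ∫⁻ x, ENNReal.ofReal (σ x) ∂(perimeterMeasure A)

/-! ### Surface tension and BV solutions -/

/-- `σ ∈ C^{1,1}(ℝ^N; (0,∞))` with `0 < δ ≤ σ ≤ C_δ`. -/
structure IsSurfaceTension (σ : E N → ℝ) : Prop where
  contDiff : ContDiff ℝ 1 σ
  lipschitz : ∃ L, LipschitzWith L (fderiv ℝ σ)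
  bounds : ∃ δ Cδ : ℝ, 0 < δ ∧ ∀ x, δ ≤ σ x ∧ σ x ≤ Cδ

/-- `V t` is a Borel representative of a square integrable normal velocity of `A t` in the direction
of the inner normal, in the distributional sense on `ℝ^N × [0,T)`, with initial set `A 0`. -/
structure IsBVNormalVelocity (σ : E N → ℝ) (T : ℝ) (A : ℝ → Set (E N)) (V : ℝ → E N → ℝ) :
    Prop where
  measurable : Measurable (Function.uncurry V)
  square_integrable : ∫⁻ t in Ioo 0 T,
    ∫⁻ x, ENNReal.ofReal (σ x * V t x ^ 2) ∂(perimeterMeasure (A t)) < ⊤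
  /-- The restrictions to `ℝ^N × [0,T)` of the functions `ζ` below are exactly the elements of
  `C_c^∞(ℝ^N × [0,T))`. -/
  transport : ∀ᵐ T' ∂(volume.restrict (Ioo 0 T)), ∀ ζ : ℝ → E N → ℝ,
    ContDiff ℝ ∞ (Function.uncurry ζ) → HasCompactSupport (Function.uncurry ζ) →
    tsupport (Function.uncurry ζ) ⊆ Iio T ×ˢ univ →
    (∫ x in A T', ζ T' x) - ∫ x in A 0, ζ 0 x =
      (∫ t in Ioo 0 T', ∫ x in A t, deriv (fun s => ζ s x) t) -
        ∫ t in Ioo 0 T', ∫ x, V t x * ζ t x ∂(perimeterMeasure (A t))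

/-- `V t` satisfies, for almost every time, the weak form of `σ V = σ H - ∇σ · n` on `∂* A(t)`.
Here `(Id - n ⊗ n) : ∇Ψ = div Ψ - n · (DΨ n)`. -/
def MotionLaw (σ : E N → ℝ) (T : ℝ) (A : ℝ → Set (E N)) (V : ℝ → E N → ℝ) : Prop :=
  ∀ᵐ t ∂(volume.restrict (Ioo 0 T)), ∀ Ψ : E N → E N, ContDiff ℝ 1 Ψ → HasCompactSupport Ψ →
    ∫ x, σ x * V t x * ⟪Ψ x, measureNormal (A t) x⟫_ℝ ∂(perimeterMeasure (A t)) =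
      - (∫ x, σ x * (vdiv Ψ x -
            ⟪measureNormal (A t) x, fderiv ℝ Ψ x (measureNormal (A t) x)⟫_ℝ)
          ∂(perimeterMeasure (A t)))
        - ∫ x, fderiv ℝ σ x (Ψ x) ∂(perimeterMeasure (A t))

/-- `E[A(T')] + ∫₀^{T'} ∫ σ V² d|∇χ_{A(t)}| dt ≤ E[A(0)]` for almost every `T'`, where `E` is the
weighted perimeter. -/
def OptimalDissipation (σ : E N → ℝ) (T : ℝ) (A : ℝ → Set (E N)) (V : ℝ → E N → ℝ) : Prop :=
  ∀ᵐ T' ∂(volume.restrict (Ioo 0 T)),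
    weightedPerimeter σ (A T') + ∫⁻ t in Ioo 0 T',
        ∫⁻ x, ENNReal.ofReal (σ x * V t x ^ 2) ∂(perimeterMeasure (A t))
      ≤ weightedPerimeter σ (A 0)

/-- The family `A t`, `t ∈ [0,T]`, of sets of finite perimeter in `ℝ^N` is a BV solution of
weighted mean curvature flow with initial set `A 0`. The two measurability conditions express
that the space-time measures `χ_{A(t)} dx ⊗ dt` and `|∇χ_{A(t)}| ⊗ dt` are defined. -/
structure IsBVSolution (σ : E N → ℝ) (T : ℝ) (A : ℝ → Set (E N)) : Prop where
  finitePerimeter : ∀ t ∈ Icc 0 T, HasFinitePerimeter (A t)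
  aemeasurable_volume :
    AEMeasurable (fun t => (volume : Measure (E N)).restrict (A t)) (volume.restrict (Ioo 0 T))
  aemeasurable_perimeter :
    AEMeasurable (fun t => perimeterMeasure (A t)) (volume.restrict (Ioo 0 T))
  exists_velocity : ∃ V : ℝ → E N → ℝ, IsBVNormalVelocity σ T A V ∧ MotionLaw σ T A V ∧
    OptimalDissipation σ T A V

/-! ### Smoothly bounded evolving sets -/

/-- Near `x` the open set `A` is the superlevel set `{f > 0}` of a smooth function with
`f x = 0` and `∇f x ≠ 0`, and `ν = ∇f x / |∇f x|`: the boundary of `A` is smooth near `x` and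
`ν` is its interior unit normal at `x`. -/
def IsInnerUnitNormal (A : Set (E N)) (x ν : E N) : Prop :=
  ∃ f : E N → ℝ, ContDiff ℝ ∞ f ∧ f x = 0 ∧ gradient f x ≠ 0 ∧
    (∀ᶠ y in 𝓝 x, y ∈ A ↔ 0 < f y) ∧ ν = ‖gradient f x‖⁻¹ • gradient f x

/-- The boundary of `A` is a smooth hypersurface, with `A` locally on one side of it. -/
def HasSmoothBoundary (A : Set (E N)) : Prop :=
  ∀ x ∈ frontier A, ∃ ν, IsInnerUnitNormal A x ν

/-- `v` is the normal velocity, in the direction of the interior normal, of the boundary of `𝒜 t`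
at its point `x`: near `(t, x)` in `[0,T] × ℝ^N` the evolution is `{F > 0}` for a `C¹` function `F`
with nonvanishing spatial gradient, and `v = - ∂ₜF / |∇F|`. -/
def IsNormalVelocity (T : ℝ) (𝒜 : ℝ → Set (E N)) (t : ℝ) (x : E N) (v : ℝ) : Prop :=
  ∃ F : ℝ → E N → ℝ, ContDiff ℝ 1 (Function.uncurry F) ∧ F t x = 0 ∧ gradient (F t) x ≠ 0 ∧
    (∀ᶠ p : ℝ × E N in 𝓝 (t, x), p.1 ∈ Icc 0 T → (p.2 ∈ 𝒜 p.1 ↔ 0 < F p.1 p.2)) ∧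
    v = - deriv (fun s => F s x) t / ‖gradient (F t) x‖

/-! ### Calibrations -/

/-- `f ∈ C^k([0,T]; C_b(ℝ^N; F))`, where `C_b` carries the supremum norm. -/
def IsCkInTime {F : Type*} [NormedAddCommGroup F] [NormedSpace ℝ F] (k : ℕ) (T : ℝ)
    (f : ℝ → E N → F) : Prop :=
  ∃ g : ℝ → (E N →ᵇ F), ContDiffOn ℝ k g (Icc 0 T) ∧ ∀ t ∈ Icc 0 T, ∀ x, g t x = f t x

/-- `f ∈ C([0,T]; C_c¹(ℝ^N; ℝ^N))`, where `C_c¹` carries the `C¹` norm. -/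
structure IsContinuousC1c (T : ℝ) (f : ℝ → E N → E N) : Prop where
  compactSupport : ∀ t ∈ Icc 0 T, HasCompactSupport (f t)
  contDiff : ∀ t ∈ Icc 0 T, ContDiff ℝ 1 (f t)
  continuous : IsCkInTime 0 T f
  continuous_fderiv : IsCkInTime 0 T (fun t x => fderiv ℝ (f t) x)

/-- `min {dist(x, S), 1}`, equal to `1` if `S` is empty. -/
def cutDist (S : Set (E N)) (x : E N) : ℝ := (min (Metric.infEDist x S) 1).toReal

/-- `f = O(min {dist(·, ∂𝒜(t)), 1}^k)` uniformly on `ℝ^N × [0,T]`. For a bounded `f`, such as one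
with values in `C([0,T]; C_c)`, this is the same as `f = O(dist(·, ∂𝒜(t))^k)`. -/
def IsBigOBoundary {F : Type*} [NormedAddCommGroup F] (k : ℕ) (T : ℝ) (𝒜 : ℝ → Set (E N))
    (f : ℝ → E N → F) : Prop :=
  ∃ C : ℝ, ∀ t ∈ Icc 0 T, ∀ x, ‖f t x‖ ≤ C * cutDist (frontier (𝒜 t)) x ^ k

/-- The time derivative on the closed interval `[0,T]` (one-sided at the end points). -/
def timeDeriv {F : Type*} [NormedAddCommGroup F] [NormedSpace ℝ F] (T : ℝ)
    (f : ℝ → E N → F) (t : ℝ) (x : E N) : F :=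
  derivWithin (fun s => f s x) (Icc 0 T) t

/-- `(ξ, B, ϑ)` is a gradient flow calibration, on `[0,T]`, of the evolving open set `𝒜 t` for
weighted mean curvature flow with surface tension `σ`. -/
structure IsCalibration (σ : E N → ℝ) (T : ℝ) (𝒜 : ℝ → Set (E N))
    (ξ B : ℝ → E N → E N) (ϑ : ℝ → E N → ℝ) : Prop where
  isOpen : ∀ t ∈ Icc 0 T, IsOpen (𝒜 t)
  smoothBoundary : ∀ t ∈ Icc 0 T, HasSmoothBoundary (𝒜 t)
  -- regularity
  regular_ξ_time : IsCkInTime 2 T ξ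
  regular_ξ : IsContinuousC1c T ξ
  regular_B : IsContinuousC1c T B
  regular_ϑ : ContDiffOn ℝ 1 (Function.uncurry ϑ) (Icc 0 T ×ˢ univ)
  bounded_ϑ : ∃ M : ℝ, ∀ t ∈ Icc 0 T, ∀ x, |ϑ t x| ≤ M
  -- extension of the normal, with quadratic length control; the subtraction in `[0,∞]` is
  -- truncated, so that the bound is `max {0, 1 - c dist²}`
  ξ_eq_normal : ∀ t ∈ Icc 0 T, ∀ x ∈ frontier (𝒜 t), IsInnerUnitNormal (𝒜 t) x (ξ t x)
  ξ_length : ∃ c : ℝ, 0 < c ∧ ∀ t ∈ Icc 0 T, ∀ x,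
    ‖ξ t x‖ₑ ≤ 1 - ENNReal.ofReal c * Metric.infEDist x (frontier (𝒜 t)) ^ 2
  -- extension of the normal velocity
  B_eq_velocity : ∀ t ∈ Icc 0 T, ∀ x ∈ frontier (𝒜 t), ∀ ν, IsInnerUnitNormal (𝒜 t) x ν →
    ∃ v, IsNormalVelocity T 𝒜 t x v ∧ B t x = v • ν
  -- signs and coercivity of the transported mass
  ϑ_pos : ∀ t ∈ Icc 0 T, ∀ x ∈ 𝒜 t, 0 < ϑ t x
  ϑ_neg : ∀ t ∈ Icc 0 T, ∀ x ∉ closure (𝒜 t), ϑ t x < 0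
  ϑ_zero : ∀ t ∈ Icc 0 T, ∀ x ∈ frontier (𝒜 t), ϑ t x = 0
  ϑ_coercive : ∃ C : ℝ, 0 < C ∧ ∀ t ∈ Icc 0 T, ∀ x,
    cutDist (frontier (𝒜 t)) x ≤ C * |ϑ t x|
  -- approximate evolution equations
  evolution_ξ : IsBigOBoundary 1 T 𝒜 (fun t x =>
    timeDeriv T ξ t x + fderiv ℝ (ξ t) x (B t x) +
      ContinuousLinearMap.adjoint (fderiv ℝ (B t) x) (ξ t x))
  evolution_ξ_sq : IsBigOBoundary 2 T 𝒜 (fun t x =>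
    timeDeriv T (fun s y => ‖ξ s y‖ ^ 2) t x + fderiv ℝ (fun y => ‖ξ t y‖ ^ 2) x (B t x))
  evolution_ϑ : IsBigOBoundary 1 T 𝒜 (fun t x =>
    timeDeriv T ϑ t x + fderiv ℝ (ϑ t) x (B t x))
  -- geometric equation
  geometric : IsBigOBoundary 1 T 𝒜 (fun t x =>
    - vdiv (ξ t) x - fderiv ℝ (fun y => Real.log (σ y)) x (ξ t x) - ⟪B t x, ξ t x⟫_ℝ)

/-! ### The error functionals

Both integrands are nonnegative whenever `(ξ, B, ϑ)` is a calibration, so the integrals are taken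
in `[0,∞]`. -/

/-- The relative energy `∫ σ (1 - n_A · ξ) d|∇χ_A|`. -/
def relativeEnergy (σ : E N → ℝ) (ξ : E N → E N) (A : Set (E N)) : ℝ≥0∞ :=
  ∫⁻ x, ENNReal.ofReal (σ x * (1 - ⟪measureNormal A x, ξ x⟫_ℝ)) ∂(perimeterMeasure A)

/-- The bulk error `∫ σ (χ_𝒜 - χ_A) ϑ dx`. -/
def bulkError (σ : E N → ℝ) (ϑ : E N → ℝ) (𝒜 A : Set (E N)) : ℝ≥0∞ :=
  ∫⁻ x, ENNReal.ofReal
    (σ x * (indicator 𝒜 (fun _ => (1 : ℝ)) x - indicator A (fun _ => (1 : ℝ)) x) * ϑ x)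

end WeightedMCF

end

open MeasureTheory Set Filter Topology
open scoped ENNReal ContDiff BoundedContinuousFunction InnerProductSpace

noncomputable section

namespace WeightedMCF

variable {N : ℕ}

/-! ### Divergence of vector fields -/

/-! Relative energy. Since `n` is the inner normal, Gauss–Green applied to `σ ξ` gives `E_rel = E[A]
+ ∫_A div(σξ)` (`CalibrationBounds.relativeEnergy_eq`). Optimal dissipation controls the first term
and the transport equation the second, so the rate of `E_rel` is at most `-∫σV² - ∫σ ∂ₜξ·n - ∫V
div(σξ)` (`IsBVFlow.ae_energy_le`). The function `div(σξ)` need not be differentiable in time,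
because `∂ₜξ` is merely continuous in `x`; `TransportsTo.vector_field` therefore applies Gauss–Green
to difference quotients before passing to the limit.

Two quantities with zero integral are added to this rate: the motion law tested with `B`, and the
flux of `div(Q ⊗ P - P ⊗ Q)` with `P = σξ`, `Q = B` (`IsIndicatorGradient.integral_antisymm`). The
integrand then becomes a sum of the product `-σ(V - B·n)(V + H)`, where `σH = div(σξ)`, and of
errors quadratic in `n - ξ` and in the distance to the calibrated interface. Both `|n - ξ|²` and the
squared truncated distance are bounded by a multiple of `1 - n·ξ`. Hence the rate is at most `-½∫σ(V
- B·n)² + C E_rel` (`dissipation_pointwise`, `CalibrationBounds.dissipation_le`).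

Bulk error. The calibrated set is `{ϑ > 0}`, so its contribution is an integral of the positive part
of `σϑ`, and no boundary term arises when it is differentiated in time. The divergence of `σϑB`
integrates to zero over this set and to `-∫σϑ B·n` over `A`. Adding it leaves a volume term bounded
by `|ϑ|` and the surface term `∫σϑ(V - B·n)`. Young's inequality and `ϑ² ≤ C(1 - n·ξ)` bound the
latter by `½∫σ(V - B·n)² + C E_rel` (`CalibrationBounds.bulkRate_le`). The velocity error is
absorbed by the gain in the relative energy estimate, which is why `E_rel(0)` enters the bulk
inequality. A spatial cutoff, removed by Fatou's lemma, makes all integrals finite.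

Uniqueness. If the initial sets agree, then `n = ξ` almost everywhere on the initial interface
(`IsIndicatorGradient.ae_eq_normal`) and both errors vanish initially. Gronwall's inequality,
applied first to `E_rel` and then to `E_bulk`, makes both vanish almost everywhere in time. A
vanishing bulk error identifies the sets off `{ϑ = 0}`, which lies in the boundary of the calibrated
set and is Lebesgue null. -/

theorem continuous_vdiv {φ : E N → E N} (hφ : ContDiff ℝ 1 φ) : Continuous (vdiv φ) := by
  have h := hφ.continuous_fderiv one_ne_zero
  unfold vdiv
  fun_prop

theorem hasCompactSupport_vdiv {φ : E N → E N} (hc : HasCompactSupport φ) :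
    HasCompactSupport (vdiv φ) := by
  refine (hc.fderiv ℝ).mono' ?_
  intro x hx
  by_contra h
  apply hx
  have : fderiv ℝ φ x = 0 := image_eq_zero_of_notMem_tsupport h
  simp [vdiv, this]

theorem vdiv_smul {u : E N → ℝ} {φ : E N → E N} {x : E N} (hu : DifferentiableAt ℝ u x)
    (hφ : DifferentiableAt ℝ φ x) :
    vdiv (fun y => u y • φ y) x = u x * vdiv φ x + fderiv ℝ u x (φ x) := by
  have h : fderiv ℝ u x (φ x) = ∑ i : Fin N, fderiv ℝ u x (EuclideanSpace.single i 1) * φ x i := by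
    conv_lhs => rw [← (EuclideanSpace.basisFun (Fin N) ℝ).sum_repr (φ x)]
    simp [map_sum, mul_comm]
  rw [h, vdiv, vdiv, Finset.mul_sum, ← Finset.sum_add_distrib]
  refine Finset.sum_congr rfl fun i _ => ?_
  rw [fderiv_fun_smul hu hφ]
  simp

theorem abs_vdiv_le (φ : E N → E N) (x : E N) : |vdiv φ x| ≤ N * ‖fderiv ℝ φ x‖ := by
  unfold vdiv
  refine (Finset.abs_sum_le_sum_abs _ _).trans ?_
  have : ∀ i ∈ (Finset.univ : Finset (Fin N)),
      |(fderiv ℝ φ x (EuclideanSpace.single i 1)) i| ≤ ‖fderiv ℝ φ x‖ := by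
    intro i _
    refine (PiLp.norm_apply_le (p := 2) (fderiv ℝ φ x (EuclideanSpace.single i 1)) i).trans ?_
    refine ((fderiv ℝ φ x).le_opNorm _).trans ?_
    simp
  simpa using Finset.sum_le_sum this

theorem fderiv_apply_coord {φ : E N → E N} {x : E N} (hφ : DifferentiableAt ℝ φ x) (i : Fin N)
    (v : E N) : fderiv ℝ (fun y => φ y i) x v = (fderiv ℝ φ x v) i := by
  have h : HasFDerivAt (fun y => φ y i)
      ((EuclideanSpace.proj (𝕜 := ℝ) i).comp (fderiv ℝ φ x)) x :=
    (EuclideanSpace.proj (𝕜 := ℝ) i).hasFDerivAt.comp x hφ.hasFDerivAt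
  rw [h.fderiv]
  rfl

theorem integral_fderiv_eq_zero {u : E N → ℝ} (hu : ContDiff ℝ 1 u) (hc : HasCompactSupport u)
    (v : E N) : ∫ x, fderiv ℝ u x v = 0 := by
  have h1 : Integrable (fun x => fderiv ℝ u x v) :=
    ((hu.continuous_fderiv one_ne_zero).clm_apply continuous_const).integrable_of_hasCompactSupport
      ((hc.fderiv ℝ).comp_left (g := fun L : E N →L[ℝ] ℝ => L v) (by simp))
  have h2 : Integrable u := hu.continuous.integrable_of_hasCompactSupport hc
  have := integral_mul_fderiv_eq_neg_fderiv_mul_of_integrable (μ := (volume : Measure (E N)))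
    (f := fun _ => (1 : ℝ)) (g := u) (v := v) (by simp) (by simpa using h1) (by simpa using h2)
    (fun x _ => differentiableAt_const _) (fun x _ => hu.differentiable one_ne_zero x)
  simpa using this

theorem integral_vdiv_eq_zero {φ : E N → E N} (hφ : ContDiff ℝ 1 φ) (hc : HasCompactSupport φ) :
    ∫ x, vdiv φ x = 0 := by
  have hd := hφ.differentiable one_ne_zero
  have hi : ∀ i, ContDiff ℝ 1 (fun y => φ y i) := fun i => by fun_prop
  have hci : ∀ i, HasCompactSupport (fun y => φ y i) := fun i =>
    hc.comp_left (g := fun y : E N => y i) (by simp)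
  have : ∀ x, vdiv φ x = ∑ i : Fin N, fderiv ℝ (fun y => φ y i) x (EuclideanSpace.single i 1) := by
    intro x
    exact Finset.sum_congr rfl fun i _ => (fderiv_apply_coord (hd x) i _).symm
  simp_rw [this]
  rw [integral_finsetSum]
  · exact Finset.sum_eq_zero fun i _ => integral_fderiv_eq_zero (hi i) (hci i) _
  · intro i _
    exact (((hi i).continuous_fderiv one_ne_zero).clm_apply
      continuous_const).integrable_of_hasCompactSupport
      (((hci i).fderiv ℝ).comp_left (g := fun L : E N →L[ℝ] ℝ => L _) (by simp))

/-! ### Smooth test functions determine measures -/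

/-- A single smooth function with values in `[0,1]`, equal to `1` exactly on `K` and supported in a
compact subset of `U`, suffices: its powers decrease to the indicator of `K`. -/
theorem exists_smooth_approx_indicator {K U : Set (E N)} (hK : IsCompact K) (hU : IsOpen U)
    (hKU : K ⊆ U) : ∃ g : ℕ → E N → ℝ, (∀ n, ContDiff ℝ ∞ (g n)) ∧
      (∀ n, HasCompactSupport (g n)) ∧ (∀ n, tsupport (g n) ⊆ U) ∧
      (∀ n x, 0 ≤ g n x ∧ g n x ≤ 1) ∧
      ∀ x, Tendsto (fun n => g n x) atTop (𝓝 (K.indicator (fun _ => (1 : ℝ)) x)) := by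
  obtain ⟨W, hW, hKW, hWU, hWc⟩ := exists_open_between_and_isCompact_closure hK hU hKU
  obtain ⟨f, hf, hrange, hsupp, hone⟩ := exists_contMDiff_support_eq_eq_one_iff
    (modelWithCornersSelf ℝ (E N)) hW hK.isClosed hKW
  have hts : tsupport f ⊆ closure W := by rw [tsupport, hsupp]
  refine ⟨fun n x => f x ^ (n + 1), fun n => hf.contDiff.pow _, fun n => ?_, fun n => ?_,
    fun n x => ?_, fun x => ?_⟩
  · exact (show HasCompactSupport f from hWc.of_isClosed_subset (isClosed_tsupport f) hts).comp_left
      (g := fun y : ℝ => y ^ (n + 1)) (by simp)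
  · refine (closure_mono ?_).trans (hts.trans hWU)
    intro x hx h
    exact hx (by simp [h])
  · have := hrange ⟨x, rfl⟩
    exact ⟨pow_nonneg this.1 _, pow_le_one₀ this.1 this.2⟩
  · by_cases hx : x ∈ K
    · simp [hx, (hone x).1 hx]
    · have h1 := hrange ⟨x, rfl⟩
      have h2 : f x ≠ 1 := fun h => hx ((hone x).2 h)
      simp only [hx, not_false_eq_true, indicator_of_notMem]
      exact (tendsto_pow_atTop_nhds_zero_of_lt_one h1.1 (lt_of_le_of_ne h1.2 h2)).comp
        (tendsto_add_atTop_nat 1)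

theorem tendsto_integral_smooth_approx {μ : Measure (E N)} {K : Set (E N)} (hK : MeasurableSet K)
    {w : E N → ℝ} (hw : Integrable w μ) {g : ℕ → E N → ℝ} (hg : ∀ n, ContDiff ℝ ∞ (g n))
    (h01 : ∀ n x, 0 ≤ g n x ∧ g n x ≤ 1)
    (hlim : ∀ x, Tendsto (fun n => g n x) atTop (𝓝 (K.indicator (fun _ => (1 : ℝ)) x))) :
    Tendsto (fun n => ∫ x, g n x * w x ∂μ) atTop (𝓝 (∫ x in K, w x ∂μ)) := by
  rw [← integral_indicator hK]
  refine tendsto_integral_of_dominated_convergence (fun x => ‖w x‖) (fun n =>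
    (hg n).continuous.aestronglyMeasurable.mul hw.aestronglyMeasurable) hw.norm
    (fun n => ae_of_all _ fun x => ?_) (ae_of_all _ fun x => ?_)
  · rw [norm_mul, Real.norm_of_nonneg (h01 n x).1]
    exact mul_le_of_le_one_left (norm_nonneg _) (h01 n x).2
  · have := (hlim x).mul_const (w x)
    refine this.trans_eq ?_
    congr 1
    by_cases hx : x ∈ K <;> simp [hx]

/-- If `w < 0` on a part of `U` of positive measure, inner regularity gives a compact `K` of
positive measure inside that part. The smooth approximations of its indicator are admissible, so
`∫_K w` would be both nonnegative and negative. -/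
theorem ae_nonneg_of_integral_smooth_nonneg {μ : Measure (E N)} [IsFiniteMeasure μ]
    {U : Set (E N)} (hU : IsOpen U) {w : E N → ℝ} (hw : Integrable w μ) (hwm : Measurable w)
    (h : ∀ g : E N → ℝ, ContDiff ℝ ∞ g → HasCompactSupport g → tsupport g ⊆ U → (∀ x, 0 ≤ g x) →
      0 ≤ ∫ x, g x * w x ∂μ) : ∀ᵐ x ∂μ, x ∈ U → 0 ≤ w x := by
  rw [ae_iff]
  by_contra hne
  set S := {x | ¬(x ∈ U → 0 ≤ w x)} with hS
  have hSm : MeasurableSet S := by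
    have : S = U ∩ {x | w x < 0} := by ext x; simp [hS]
    rw [this]
    exact hU.measurableSet.inter (measurableSet_lt hwm measurable_const)
  obtain ⟨K, hKS, hK, hpos⟩ := hSm.exists_lt_isCompact (μ := μ) (r := 0) (pos_iff_ne_zero.2 hne)
  have hKU : K ⊆ U := fun x hx => by
    have := hKS hx
    simp only [hS, mem_ofPred_eq, Classical.not_imp] at this
    exact this.1
  obtain ⟨g, hg, hgc, hgU, h01, hlim⟩ := exists_smooth_approx_indicator hK hU hKU
  have hge : 0 ≤ ∫ x in K, w x ∂μ :=
    ge_of_tendsto' (tendsto_integral_smooth_approx hK.measurableSet hw hg h01 hlim)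
      fun n => h _ (hg n) (hgc n) (hgU n) fun x => (h01 n x).1
  have hneg : ∀ x ∈ K, w x < 0 := fun x hx => by
    have := hKS hx
    simp only [hS, mem_ofPred_eq, Classical.not_imp, not_le] at this
    exact this.2
  have hlt : 0 < ∫ x in K, -w x ∂μ := by
    rw [setIntegral_pos_iff_support_of_nonneg_ae]
    · refine hpos.trans_le (measure_mono fun x hx => ⟨?_, hx⟩)
      simpa using (hneg x hx).ne
    · rw [EventuallyLE, ae_restrict_iff' hK.measurableSet]
      exact ae_of_all _ fun x hx => by simpa using (hneg x hx).le
    · exact hw.neg.integrableOn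
  rw [integral_neg] at hlt
  linarith

theorem measure_eq_of_integral_smooth_eq {μ ν : Measure (E N)} [IsFiniteMeasure μ]
    [IsFiniteMeasure ν] (h : ∀ g : E N → ℝ, ContDiff ℝ ∞ g → HasCompactSupport g →
      ∫ x, g x ∂μ = ∫ x, g x ∂ν) : μ = ν := by
  have key : ∀ K : Set (E N), IsCompact K → μ K = ν K := by
    intro K hK
    obtain ⟨g, hg, hgc, -, h01, hlim⟩ :=
      exists_smooth_approx_indicator hK isOpen_univ (subset_univ K)
    have h1 := tendsto_integral_smooth_approx (μ := μ) (w := fun _ => 1) hK.measurableSet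
      (integrable_const _) hg h01 hlim
    have h2 := tendsto_integral_smooth_approx (μ := ν) (w := fun _ => 1) hK.measurableSet
      (integrable_const _) hg h01 hlim
    simp only [mul_one] at h1 h2
    have h3 := tendsto_nhds_unique h1 (h2.congr fun n => (h _ (hg n) (hgc n)).symm)
    simpa [Measure.real, ENNReal.toReal_eq_toReal_iff', measure_ne_top] using h3
  refine Measure.ext fun s hs => ?_
  rw [hs.measure_eq_iSup_isCompact, hs.measure_eq_iSup_isCompact]
  refine iSup_congr fun K => iSup_congr fun _ => iSup_congr fun hK => key K hK

/-! ### Fields of the form `∂ⱼu eᵢ - ∂ᵢu eⱼ` have zero flux through a reduced boundary -/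

theorem IsIndicatorGradient.integrable_inner {A : Set (E N)} {μ : Measure (E N)} {n : E N → E N}
    (h : IsIndicatorGradient A μ n) {φ : E N → E N} (hφ : Measurable φ) {C : ℝ}
    (hb : ∀ x, ‖φ x‖ ≤ C) : Integrable (fun x => ⟪φ x, n x⟫_ℝ) μ := by
  have := h.finite
  refine Integrable.mono' (integrable_const C) (hφ.inner h.measurable_normal).aestronglyMeasurable ?_
  filter_upwards [h.norm_normal] with x hx
  refine (norm_inner_le_norm _ _).trans ?_
  rw [hx, mul_one]
  exact hb x

theorem IsIndicatorGradient.abs_coord_le {A : Set (E N)} {μ : Measure (E N)} {n : E N → E N}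
    (h : IsIndicatorGradient A μ n) : ∀ᵐ x ∂μ, ∀ i, |n x i| ≤ 1 := by
  filter_upwards [h.norm_normal] with x hx i
  exact (PiLp.norm_apply_le (p := 2) (n x) i).trans hx.le

/-- Flux of `∂ⱼu eᵢ - ∂ᵢu eⱼ` for smooth `u`. -/
theorem IsIndicatorGradient.integral_curl_smooth {A : Set (E N)} {μ : Measure (E N)}
    {n : E N → E N} (h : IsIndicatorGradient A μ n) {u : E N → ℝ} (hu : ContDiff ℝ 2 u)
    (hc : HasCompactSupport u) (i j : Fin N) :
    ∫ x, (fderiv ℝ u x (EuclideanSpace.single j 1) * n x i -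
      fderiv ℝ u x (EuclideanSpace.single i 1) * n x j) ∂μ = 0 := by
  set ei : E N := EuclideanSpace.single i 1 with hei
  set ej : E N := EuclideanSpace.single j 1 with hej
  set φ : E N → E N := fun x => fderiv ℝ u x ej • ei - fderiv ℝ u x ei • ej with hφ
  have hdu : ContDiff ℝ 1 (fderiv ℝ u) := hu.fderiv_right (by norm_num)
  have hd1 : ∀ v, ContDiff ℝ 1 (fun x => fderiv ℝ u x v) := fun v => hdu.clm_apply contDiff_const
  have hφ1 : ContDiff ℝ 1 φ := ((hd1 ej).smul contDiff_const).sub ((hd1 ei).smul contDiff_const)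
  have hφc : HasCompactSupport φ :=
    (hc.fderiv ℝ).comp_left (g := fun L : E N →L[ℝ] ℝ => L ej • ei - L ei • ej) (by simp)
  have hdiv : ∀ x, vdiv φ x = 0 := by
    intro x
    have hdd : ∀ v, DifferentiableAt ℝ (fun x => fderiv ℝ u x v) x := fun v =>
      (hd1 v).differentiable one_ne_zero x
    have hsec : ∀ v w, fderiv ℝ (fun y => fderiv ℝ u y v) x w = fderiv ℝ (fderiv ℝ u) x w v := by
      intro v w
      rw [fderiv_clm_apply (hdu.differentiable one_ne_zero x) (differentiableAt_const _)]
      simp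
    have hsymm := (hu.contDiffAt (x := x)).isSymmSndFDerivAt (by simp)
    have h1 : ∀ (v w : E N), vdiv (fun y => fderiv ℝ u y v • w) x =
        fderiv ℝ (fderiv ℝ u) x w v := by
      intro v w
      rw [vdiv_smul (hdd v) (differentiableAt_const _), hsec]
      simp [vdiv]
    have : vdiv φ x = vdiv (fun y => fderiv ℝ u y ej • ei) x - vdiv (fun y => fderiv ℝ u y ei • ej) x := by
      simp only [vdiv, ← Finset.sum_sub_distrib]
      refine Finset.sum_congr rfl fun k _ => ?_
      rw [hφ, fderiv_fun_sub ((hdd _).smul_const _) ((hdd _).smul_const _)]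
      simp
    rw [this, h1, h1, hsymm.eq, sub_self]
  have := h.integral_div φ hφ1 hφc
  simp only [hdiv, integral_zero] at this
  have h2 : ∫ x, ⟪φ x, n x⟫_ℝ ∂μ = 0 := by linarith
  rw [← h2]
  congr 1
  ext x
  simp [hφ, inner_sub_left, inner_smul_left, hei, hej, EuclideanSpace.inner_single_left]

/-- Flux of `∂ⱼu eᵢ - ∂ᵢu eⱼ` for `u` of class `C¹`. -/
theorem IsIndicatorGradient.integral_curl {A : Set (E N)} {μ : Measure (E N)}
    {n : E N → E N} (h : IsIndicatorGradient A μ n) {u : E N → ℝ} (hu : ContDiff ℝ 1 u)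
    (hc : HasCompactSupport u) (i j : Fin N) :
    ∫ x, (fderiv ℝ u x (EuclideanSpace.single j 1) * n x i -
      fderiv ℝ u x (EuclideanSpace.single i 1) * n x j) ∂μ = 0 := by
  have := h.finite
  -- Mollification reduces to the smooth case: the flux involves only first derivatives of `u`, and
  -- those of the mollified functions converge pointwise and stay bounded.
  let b : ℕ → ContDiffBump (0 : E N) := fun k =>
    ⟨1 / (2 * ((k : ℝ) + 1)), 1 / ((k : ℝ) + 1), by positivity, by
      apply one_div_lt_one_div_of_lt (by positivity); nlinarith [(Nat.cast_nonneg k : (0 : ℝ) ≤ k)]⟩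
  have hb : Tendsto (fun k => (b k).rOut) atTop (𝓝 0) := tendsto_one_div_add_atTop_nhds_zero_nat
  let L := ContinuousLinearMap.lsmul ℝ ℝ (E := ℝ)
  let w : ℕ → E N → ℝ := fun k => MeasureTheory.convolution ((b k).normed volume) u L volume
  have hloc : ∀ k, LocallyIntegrable ((b k).normed volume) (volume : Measure (E N)) := fun k =>
    (b k).continuous_normed.locallyIntegrable
  have hw : ∀ k, ContDiff ℝ 2 (w k) := fun k =>
    (b k).hasCompactSupport_normed.contDiff_convolution_left _ (b k).contDiff_normed
      hu.continuous.locallyIntegrable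
  have hwc : ∀ k, HasCompactSupport (w k) := fun k =>
    HasCompactSupport.convolution _ (b k).hasCompactSupport_normed hc
  have hdu := hu.continuous_fderiv one_ne_zero
  have hfd : ∀ k x v, fderiv ℝ (w k) x v = MeasureTheory.convolution ((b k).normed volume)
      (fun y => fderiv ℝ u y v) L volume x := by
    intro k x v
    rw [(hc.hasFDerivAt_convolution_right L (hloc k) hu x).fderiv]
    simp only [MeasureTheory.convolution]
    rw [ContinuousLinearMap.integral_apply]
    · rfl
    · exact (HasCompactSupport.convolutionExists_right (L.precompR (E N)) (hc.fderiv ℝ) (hloc k) hdu x)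
  have hlim : ∀ x v, Tendsto (fun k => fderiv ℝ (w k) x v) atTop (𝓝 (fderiv ℝ u x v)) := by
    intro x v
    simp_rw [hfd]
    exact ContDiffBump.convolution_tendsto_right_of_continuous hb (hdu.clm_apply continuous_const) x
  have hbd : ∀ v, ∃ C, ∀ k x, ‖fderiv ℝ (w k) x v‖ ≤ C := by
    intro v
    obtain ⟨C, hC⟩ := (hdu.clm_apply (continuous_const (y := v))).bounded_above_of_compact_support
      ((hc.fderiv ℝ).comp_left (g := fun L : E N →L[ℝ] ℝ => L v) (by simp))
    -- The mollified derivative differs from the derivative itself by at most the oscillation `2 *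
    -- C`.
    refine ⟨2 * C + C, fun k x => ?_⟩
    rw [hfd]
    have := ContDiffBump.dist_normed_convolution_le (φ := b k) (μ := volume) (x₀ := x) (ε := 2 * C)
      (g := fun y => fderiv ℝ u y v) (hdu.clm_apply continuous_const).aestronglyMeasurable
      (fun y _ => (dist_le_norm_add_norm _ _).trans (by linarith [hC x, hC y]))
    rw [dist_eq_norm] at this
    have h3 := norm_le_norm_add_norm_sub' (MeasureTheory.convolution ((b k).normed volume)
      (fun y => fderiv ℝ u y v) L volume x) (fderiv ℝ u x v)
    have h4 := hC x
    exact h3.trans (by linarith)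
  obtain ⟨Ci, hCi⟩ := hbd (EuclideanSpace.single i 1)
  obtain ⟨Cj, hCj⟩ := hbd (EuclideanSpace.single j 1)
  have hni : ∀ i, Measurable fun x => n x i := fun i => by
    have := h.measurable_normal
    fun_prop
  have hT := tendsto_integral_of_dominated_convergence (μ := μ) (fun _ => Cj + Ci)
    (F := fun k x => fderiv ℝ (w k) x (EuclideanSpace.single j 1) * n x i -
      fderiv ℝ (w k) x (EuclideanSpace.single i 1) * n x j)
    (f := fun x => fderiv ℝ u x (EuclideanSpace.single j 1) * n x i -
      fderiv ℝ u x (EuclideanSpace.single i 1) * n x j)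
    (fun k => by
      have h1 := ((hw k).continuous_fderiv two_ne_zero)
      exact ((((h1.clm_apply continuous_const).measurable).mul (hni i)).sub
        (((h1.clm_apply continuous_const).measurable).mul (hni j))).aestronglyMeasurable)
    (integrable_const _)
    (fun k => by
      filter_upwards [h.abs_coord_le] with x hx
      refine (norm_sub_le _ _).trans (add_le_add ?_ ?_)
      · rw [norm_mul]
        exact (mul_le_of_le_one_right (norm_nonneg _) (hx i)).trans (hCj k x)
      · rw [norm_mul]
        exact (mul_le_of_le_one_right (norm_nonneg _) (hx j)).trans (hCi k x))
    (ae_of_all _ fun x => ((hlim x _).mul_const _).sub ((hlim x _).mul_const _))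
  simp only [h.integral_curl_smooth (hw _) (hwc _)] at hT
  exact tendsto_nhds_unique hT tendsto_const_nhds

/-- The field `Q div P + (P·∇)Q - P div Q - (Q·∇)P = div (Q ⊗ P - P ⊗ Q)` has zero flux. -/
theorem IsIndicatorGradient.integral_antisymm {A : Set (E N)} {μ : Measure (E N)}
    {n : E N → E N} (h : IsIndicatorGradient A μ n) {P Q : E N → E N} (hP : ContDiff ℝ 1 P)
    (hQ : ContDiff ℝ 1 Q) (hc : HasCompactSupport P) :
    ∫ x, (⟪n x, Q x⟫_ℝ * vdiv P x + ⟪n x, fderiv ℝ Q x (P x)⟫_ℝ -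
      (⟪n x, P x⟫_ℝ * vdiv Q x + ⟪n x, fderiv ℝ P x (Q x)⟫_ℝ)) ∂μ = 0 := by
  have := h.finite
  -- The field is the sum over `i, j` of the curl fields `∂ⱼu eᵢ - ∂ᵢu eⱼ` with `u = Qᵢ Pⱼ`. As `P`
  -- and `Q` are only `C¹`, so is `u`, and the `C¹` version of the zero-flux lemma is needed.
  let u : Fin N → Fin N → E N → ℝ := fun i j x => Q x i * P x j
  have hPi : ∀ i, ContDiff ℝ 1 (fun y => P y i) := fun i => by fun_prop
  have hQi : ∀ i, ContDiff ℝ 1 (fun y => Q y i) := fun i => by fun_prop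
  have hu : ∀ i j, ContDiff ℝ 1 (u i j) := fun i j => (hQi i).mul (hPi j)
  have huc : ∀ i j, HasCompactSupport (u i j) := fun i j =>
    (hc.comp_left (g := fun y : E N => y j) (by simp)).mul_left
  have hPd := hP.differentiable one_ne_zero
  have hQd := hQ.differentiable one_ne_zero
  have hdu : ∀ i j x v, fderiv ℝ (u i j) x v =
      Q x i * (fderiv ℝ P x v) j + P x j * (fderiv ℝ Q x v) i := by
    intro i j x v
    have := fderiv_fun_mul ((hQi i).differentiable one_ne_zero x)
      ((hPi j).differentiable one_ne_zero x)
    simp only [u]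
    rw [this]
    simp [fderiv_apply_coord (hPd x), fderiv_apply_coord (hQd x)]
  have hni : ∀ i, Measurable fun x => n x i := fun i => by
    have := h.measurable_normal
    fun_prop
  have hint : ∀ i j k, ∀ v : E N, Integrable (fun x => fderiv ℝ (u i j) x v * n x k) μ := by
    intro i j k v
    have hcont := ((hu i j).continuous_fderiv one_ne_zero).clm_apply (continuous_const (y := v))
    obtain ⟨C, hC⟩ := hcont.bounded_above_of_compact_support
      (((huc i j).fderiv ℝ).comp_left (g := fun L : E N →L[ℝ] ℝ => L v) (by simp))
    refine Integrable.mono' (integrable_const C)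
      (hcont.measurable.mul (hni k)).aestronglyMeasurable ?_
    filter_upwards [h.abs_coord_le] with x hx
    rw [norm_mul]
    exact (mul_le_of_le_one_right (norm_nonneg _) (hx k)).trans (hC x)
  have hsum : ∫ x, (∑ i, ∑ j, (fderiv ℝ (u i j) x (EuclideanSpace.single j 1) * n x i -
      fderiv ℝ (u i j) x (EuclideanSpace.single i 1) * n x j)) ∂μ = 0 := by
    have hsub : ∀ i j, Integrable (fun x => fderiv ℝ (u i j) x (EuclideanSpace.single j 1) * n x i -
        fderiv ℝ (u i j) x (EuclideanSpace.single i 1) * n x j) μ := fun i j =>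
      (hint i j i _).sub (hint i j j _)
    rw [integral_finsetSum _ fun i _ => integrable_finsetSum _ fun j _ => hsub i j]
    refine Finset.sum_eq_zero fun i _ => ?_
    rw [integral_finsetSum _ fun j _ => hsub i j]
    exact Finset.sum_eq_zero fun j _ => h.integral_curl (hu i j) (huc i j) i j
  rw [← hsum]
  congr 1
  ext x
  have hexp : ∀ (D : E N →L[ℝ] E N) (v : E N) (i : Fin N),
      (D v) i = ∑ j, v j * (D (EuclideanSpace.single j 1)) i := by
    intro D v i
    conv_lhs => rw [← (EuclideanSpace.basisFun (Fin N) ℝ).sum_repr v]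
    simp [map_sum]
  have hin : ∀ v : E N, ⟪n x, v⟫_ℝ = ∑ i, n x i * v i := by
    intro v
    simp [PiLp.inner_apply, mul_comm]
  simp only [hdu, Finset.sum_sub_distrib, add_mul, Finset.sum_add_distrib]
  congr 1
  · congr 1
    · rw [hin, vdiv, Finset.sum_mul_sum]
      exact Finset.sum_congr rfl fun i _ => Finset.sum_congr rfl fun j _ => by ring
    · rw [hin]
      refine Finset.sum_congr rfl fun i _ => ?_
      rw [hexp, Finset.mul_sum]
      exact Finset.sum_congr rfl fun j _ => by ring
  · rw [add_comm]
    congr 1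
    · rw [Finset.sum_comm, hin]
      refine Finset.sum_congr rfl fun i _ => ?_
      rw [hexp, Finset.mul_sum]
      exact Finset.sum_congr rfl fun j _ => by ring
    · rw [Finset.sum_comm, hin, vdiv, Finset.sum_mul_sum]
      exact Finset.sum_congr rfl fun i _ => Finset.sum_congr rfl fun j _ => by ring

/-! ### Differentiating the positive part -/

/-- A continuous ramp from `0` to `1`; the ramps converge to the indicator of `(0,∞)`. -/
def ramp (k : ℕ) (r : ℝ) : ℝ := max 0 (min (((k : ℝ) + 1) * r) 1)

/-- The primitive of the ramp; it converges to the positive part. -/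
def rampPrimitive (k : ℕ) (s : ℝ) : ℝ := ∫ r in (0 : ℝ)..s, ramp k r

@[fun_prop]
theorem continuous_ramp (k : ℕ) : Continuous (ramp k) := by
  unfold ramp
  fun_prop

theorem ramp_nonneg (k : ℕ) (r : ℝ) : 0 ≤ ramp k r := le_max_left _ _

theorem ramp_le_one (k : ℕ) (r : ℝ) : ramp k r ≤ 1 := max_le zero_le_one (min_le_right _ _)

theorem abs_ramp_le_one (k : ℕ) (r : ℝ) : ‖ramp k r‖ ≤ 1 := by
  rw [Real.norm_of_nonneg (ramp_nonneg k r)]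
  exact ramp_le_one k r

theorem ramp_of_nonpos (k : ℕ) {r : ℝ} (hr : r ≤ 0) : ramp k r = 0 := by
  refine max_eq_left ((min_le_left _ _).trans ?_)
  exact mul_nonpos_of_nonneg_of_nonpos (by positivity) hr

theorem tendsto_ramp (r : ℝ) :
    Tendsto (fun k => ramp k r) atTop (𝓝 ((Ioi (0 : ℝ)).indicator (fun _ => 1) r)) := by
  by_cases hr : 0 < r
  · rw [indicator_of_mem (mem_Ioi.2 hr)]
    refine tendsto_const_nhds.congr' ?_
    obtain ⟨m, hm⟩ := exists_nat_ge (1 / r)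
    filter_upwards [eventually_ge_atTop m] with k hk
    have h1 : 1 ≤ ((k : ℝ) + 1) * r := by
      have : (m : ℝ) ≤ k := by exact_mod_cast hk
      rw [div_le_iff₀ hr] at hm
      nlinarith
    simp [ramp, min_eq_right h1]
  · rw [indicator_of_notMem (by simpa using hr)]
    simp [ramp_of_nonpos _ (not_lt.1 hr)]

theorem hasDerivAt_rampPrimitive (k : ℕ) (s : ℝ) : HasDerivAt (rampPrimitive k) (ramp k s) s :=
  intervalIntegral.integral_hasDerivAt_right ((continuous_ramp k).intervalIntegrable _ _)
    ((continuous_ramp k).stronglyMeasurableAtFilter _ _) (continuous_ramp k).continuousAt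

theorem contDiff_rampPrimitive (k : ℕ) : ContDiff ℝ 1 (rampPrimitive k) := by
  rw [contDiff_one_iff_deriv]
  refine ⟨fun s => (hasDerivAt_rampPrimitive k s).differentiableAt, ?_⟩
  have : deriv (rampPrimitive k) = ramp k := funext fun s => (hasDerivAt_rampPrimitive k s).deriv
  rw [this]
  exact continuous_ramp k

theorem abs_rampPrimitive_le (k : ℕ) (s : ℝ) : ‖rampPrimitive k s‖ ≤ ‖s‖ := by
  have := intervalIntegral.norm_integral_le_of_norm_le_const (a := 0) (b := s) (f := ramp k)
    (C := 1) fun r _ => abs_ramp_le_one k r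
  simpa [rampPrimitive] using this

theorem tendsto_rampPrimitive (s : ℝ) :
    Tendsto (fun k => rampPrimitive k s) atTop (𝓝 (max s 0)) := by
  have h := intervalIntegral.tendsto_integral_filter_of_dominated_convergence (μ := volume)
    (a := 0) (b := s) (l := atTop) (F := ramp) (f := (Ioi (0 : ℝ)).indicator (fun _ => 1))
    (fun _ => 1) (Eventually.of_forall fun k => (continuous_ramp k).aestronglyMeasurable)
    (Eventually.of_forall fun k => ae_of_all _ fun r _ => abs_ramp_le_one k r)
    intervalIntegrable_const (ae_of_all _ fun r _ => tendsto_ramp r)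
  refine h.trans_eq ?_
  congr 1
  rcases le_total 0 s with hs | hs
  · rw [max_eq_left hs, intervalIntegral.integral_of_le hs,
      setIntegral_congr_fun (g := fun _ => (1 : ℝ)) measurableSet_Ioc
        fun r hr => indicator_of_mem (mem_Ioi.2 hr.1) _]
    simp [hs]
  · rw [max_eq_right hs, intervalIntegral.integral_of_ge hs,
      setIntegral_congr_fun (g := fun _ => (0 : ℝ)) measurableSet_Ioc
        fun r hr => indicator_of_notMem (by simpa using hr.2) _]
    simp

/-- The fundamental theorem of calculus holds for each primitive of a ramp composed with `f`;
dominated convergence gives the positive part. Every ramp vanishes at `0`, so the zero set of `f`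
needs no separate treatment. -/
theorem integral_indicator_pos_mul_deriv {f f' : ℝ → ℝ} {a b : ℝ} (hab : a ≤ b) (hf : Continuous f)
    (hf' : Continuous f') (hd : ∀ t ∈ Ioo a b, HasDerivAt f (f' t) t) :
    ∫ t in a..b, (Ioi (0 : ℝ)).indicator (fun _ => 1) (f t) * f' t = max (f b) 0 - max (f a) 0 := by
  have h1 : ∀ k, ∫ t in a..b, ramp k (f t) * f' t = rampPrimitive k (f b) - rampPrimitive k (f a) := by
    intro k
    refine intervalIntegral.integral_eq_sub_of_hasDerivAt_of_le hab
      ((contDiff_rampPrimitive k).continuous.comp hf).continuousOn (fun t ht => ?_)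
      (Continuous.intervalIntegrable (by fun_prop) _ _)
    exact (hasDerivAt_rampPrimitive k (f t)).comp t (hd t ht)
  have h2 := intervalIntegral.tendsto_integral_filter_of_dominated_convergence (μ := volume)
    (a := a) (b := b) (l := atTop) (F := fun k t => ramp k (f t) * f' t)
    (f := fun t => (Ioi (0 : ℝ)).indicator (fun _ => 1) (f t) * f' t)
    (fun t => ‖f' t‖)
    (Eventually.of_forall fun k => Continuous.aestronglyMeasurable (by fun_prop))
    (Eventually.of_forall fun k => ae_of_all _ fun r _ => by
      rw [norm_mul]; exact mul_le_of_le_one_left (norm_nonneg _) (abs_ramp_le_one k _))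
    (Continuous.intervalIntegrable (by fun_prop) _ _)
    (ae_of_all _ fun t _ => (tendsto_ramp _).mul_const _)
  simp_rw [h1] at h2
  exact tendsto_nhds_unique h2 ((tendsto_rampPrimitive _).sub (tendsto_rampPrimitive _))

/-- The integrand is `div(u P)`, and `u` vanishes on the boundary of `{u > 0}`. Using the compactly
supported fields `rampPrimitive k (u) • P` on the whole space avoids any regularity of that
boundary. -/
theorem setIntegral_pos_div_eq_zero {u : E N → ℝ} {P : E N → E N} (hu : ContDiff ℝ 1 u)
    (hP : ContDiff ℝ 1 P) (hc : HasCompactSupport P) :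
    ∫ x in {x | 0 < u x}, (fderiv ℝ u x (P x) + u x * vdiv P x) = 0 := by
  have hdu := hu.continuous_fderiv one_ne_zero
  have hPc := hP.continuous
  have hv := continuous_vdiv hP
  have hr := contDiff_rampPrimitive
  have huc := hu.continuous
  have hmeas : MeasurableSet {x | 0 < u x} := measurableSet_lt measurable_const huc.measurable
  have h1 : ∀ k, ∫ x, (rampPrimitive k (u x) * vdiv P x + ramp k (u x) * fderiv ℝ u x (P x)) = 0 := by
    intro k
    have hpu : ContDiff ℝ 1 (fun x => rampPrimitive k (u x)) := (hr k).comp hu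
    have hz := integral_vdiv_eq_zero (φ := fun x => rampPrimitive k (u x) • P x) (hpu.smul hP)
      (hc.mono fun x hx h => hx (by simp [h]))
    rw [← hz]
    congr 1
    ext x
    rw [vdiv_smul (hpu.differentiable one_ne_zero x) (hP.differentiable one_ne_zero x)]
    congr 1
    have := (hasDerivAt_rampPrimitive k (u x)).comp_hasFDerivAt x
      (hu.differentiable one_ne_zero x).hasFDerivAt
    have h2 : fderiv ℝ (fun x => rampPrimitive k (u x)) x = ramp k (u x) • fderiv ℝ u x := this.fderiv
    rw [h2]
    simp
  have hi1 : Integrable (fun x => fderiv ℝ u x (P x)) :=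
    (hdu.clm_apply hPc).integrable_of_hasCompactSupport
      (hc.mono fun x hx h => hx (by simp [h]))
  have hi2 : Integrable (fun x => u x * vdiv P x) :=
    (huc.mul hv).integrable_of_hasCompactSupport (hasCompactSupport_vdiv hc).mul_left
  have h2 := tendsto_integral_of_dominated_convergence (μ := (volume : Measure (E N)))
    (F := fun k x => rampPrimitive k (u x) * vdiv P x + ramp k (u x) * fderiv ℝ u x (P x))
    (f := {x | 0 < u x}.indicator fun x => fderiv ℝ u x (P x) + u x * vdiv P x)
    (fun x => ‖u x * vdiv P x‖ + ‖fderiv ℝ u x (P x)‖)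
    (fun k => by
      have := (hr k).continuous
      exact Continuous.aestronglyMeasurable (by fun_prop))
    (hi2.norm.add hi1.norm)
    (fun k => ae_of_all _ fun x => by
      refine (norm_add_le _ _).trans (add_le_add ?_ ?_)
      · rw [norm_mul, norm_mul]
        gcongr
        exact abs_rampPrimitive_le k _
      · rw [norm_mul]
        exact mul_le_of_le_one_left (norm_nonneg _) (abs_ramp_le_one k _))
    (ae_of_all _ fun x => by
      refine (((tendsto_rampPrimitive (u x)).mul_const (vdiv P x)).add
        ((tendsto_ramp (u x)).mul_const (fderiv ℝ u x (P x)))).trans_eq ?_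
      congr 1
      by_cases hx : 0 < u x
      · rw [indicator_of_mem (mem_Ioi.2 hx), indicator_of_mem (by exact hx), max_eq_left hx.le]
        ring
      · rw [indicator_of_notMem (by simpa using hx), indicator_of_notMem (by exact hx),
          max_eq_right (not_lt.1 hx)]
        ring)
  simp_rw [h1] at h2
  rw [← integral_indicator hmeas]
  exact tendsto_nhds_unique h2 tendsto_const_nhds

/-! ### Surface tensions and functions of time with values in `C_b` -/

/-- A bounded function with Lipschitz gradient has bounded gradient: along a unit segment some
directional derivative equals a difference of two values, and the derivative at the starting point
differs from it by at most the Lipschitz constant. -/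
theorem IsSurfaceTension.exists_fderiv_bound {σ : E N → ℝ} (hσ : IsSurfaceTension σ) :
    ∃ G : ℝ, ∀ x, ‖fderiv ℝ σ x‖ ≤ G := by
  obtain ⟨L, hL⟩ := hσ.lipschitz
  obtain ⟨δ, Cδ, hδ, hb⟩ := hσ.bounds
  have hd := hσ.contDiff.differentiable one_ne_zero
  refine ⟨2 * Cδ + L, fun x => ?_⟩
  have hC : 0 ≤ 2 * Cδ + L := by
    have := hb x
    have := L.coe_nonneg
    linarith
  refine ContinuousLinearMap.opNorm_le_of_unit_norm hC fun v hv => ?_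
  obtain ⟨s, hs, hsv⟩ := exists_hasDerivAt_eq_slope (fun s : ℝ => σ (x + s • v))
    (fun s => fderiv ℝ σ (x + s • v) v) zero_lt_one
    (hσ.contDiff.continuous.comp (by fun_prop)).continuousOn
    (fun s _ => by
      have h1 : HasDerivAt (fun s : ℝ => x + s • v) v s := by
        simpa using ((hasDerivAt_id s).smul_const v).const_add x
      exact (hd _).hasFDerivAt.comp_hasDerivAt s h1)
  have h1 : ‖fderiv ℝ σ (x + s • v) v‖ ≤ 2 * Cδ := by
    rw [hsv]
    have h2 := hb (x + v)
    have h3 := hb x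
    simp only [one_smul, zero_smul, add_zero, sub_zero, div_one, Real.norm_eq_abs]
    rw [abs_le]
    constructor <;> linarith
  have h2 : ‖(fderiv ℝ σ (x + s • v) - fderiv ℝ σ x) v‖ ≤ L := by
    refine (ContinuousLinearMap.le_opNorm _ _).trans ?_
    rw [hv, mul_one, ← dist_eq_norm]
    refine (hL.dist_le_mul _ _).trans ?_
    rw [dist_eq_norm, add_sub_cancel_left, norm_smul, hv, mul_one, Real.norm_of_nonneg hs.1.le]
    exact mul_le_of_le_one_right L.coe_nonneg hs.2.le
  have h3 : fderiv ℝ σ x v = fderiv ℝ σ (x + s • v) v - (fderiv ℝ σ (x + s • v) - fderiv ℝ σ x) v := by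
    simp
  rw [h3]
  exact (norm_sub_le _ _).trans (add_le_add h1 h2)

theorem ContinuousOn.exists_bounded_extension {X : Type*} [NormedAddCommGroup X] {T : ℝ}
    (hT : 0 ≤ T) {g : ℝ → X} (hg : ContinuousOn g (Icc 0 T)) :
    ∃ g' : ℝ → X, Continuous g' ∧ (∃ C, ∀ t, ‖g' t‖ ≤ C) ∧ ∀ t ∈ Icc 0 T, g' t = g t := by
  obtain ⟨C, hC⟩ := isCompact_Icc.exists_bound_of_continuousOn hg
  refine ⟨IccExtend hT ((Icc 0 T).domRestrict g), ?_, ⟨C, fun t => ?_⟩, fun t ht => ?_⟩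
  · exact (continuousOn_iff_continuous_domRestrict.1 hg).Icc_extend'
  · exact hC _ (projIcc 0 T hT t).2
  · rw [IccExtend_of_mem _ _ ht]
    rfl

theorem IsCkInTime.exists_extension {F : Type*} [NormedAddCommGroup F] [NormedSpace ℝ F] {k : ℕ}
    {T : ℝ} (hT : 0 ≤ T) {f : ℝ → E N → F} (hf : IsCkInTime k T f) :
    ∃ g : ℝ → (E N →ᵇ F), Continuous g ∧ (∃ C, ∀ t, ‖g t‖ ≤ C) ∧
      ∀ t ∈ Icc 0 T, ∀ x, g t x = f t x := by
  obtain ⟨g, hg, hgf⟩ := hf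
  obtain ⟨g', h1, h2, h3⟩ := ContinuousOn.exists_bounded_extension hT hg.continuousOn
  exact ⟨g', h1, h2, fun t ht x => by rw [h3 t ht, hgf t ht]⟩

theorem IsCkInTime.exists_bound {F : Type*} [NormedAddCommGroup F] [NormedSpace ℝ F] {k : ℕ}
    {T : ℝ} (hT : 0 ≤ T) {f : ℝ → E N → F} (hf : IsCkInTime k T f) :
    ∃ C, ∀ t ∈ Icc 0 T, ∀ x, ‖f t x‖ ≤ C := by
  obtain ⟨g, -, ⟨C, hC⟩, hgf⟩ := hf.exists_extension hT
  refine ⟨C, fun t ht x => ?_⟩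
  rw [← hgf t ht]
  exact ((g t).norm_coe_le_norm x).trans (hC t)

/-- Evaluation at a point is a continuous linear map on `C_b`, so the derivative of the `C_b`-valued
curve yields all pointwise time derivatives at once, continuous in `x` and uniformly bounded. -/
theorem IsCkInTime.exists_timeDeriv {F : Type*} [NormedAddCommGroup F] [NormedSpace ℝ F] {k : ℕ}
    (hk : k ≠ 0) {T : ℝ} (hT : 0 < T) {f : ℝ → E N → F} (hf : IsCkInTime k T f) :
    ∃ g' : ℝ → (E N →ᵇ F), Continuous g' ∧ (∃ C, ∀ t, ‖g' t‖ ≤ C) ∧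
      ∀ t ∈ Icc 0 T, ∀ x, HasDerivWithinAt (fun s => f s x) (g' t x) (Icc 0 T) t ∧
        timeDeriv T f t x = g' t x := by
  obtain ⟨g, hg, hgf⟩ := hf
  have hu := uniqueDiffOn_Icc hT
  obtain ⟨g', h1, h2, h3⟩ := ContinuousOn.exists_bounded_extension hT.le
    (hg.continuousOn_derivWithin hu (by exact_mod_cast Nat.one_le_iff_ne_zero.2 hk))
  refine ⟨g', h1, h2, fun t ht x => ?_⟩
  have hd : HasDerivWithinAt g (g' t) (Icc 0 T) t := by
    rw [h3 t ht]
    exact (hg.differentiableOn (by exact_mod_cast hk) t ht).hasDerivWithinAt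
  have hx : HasDerivWithinAt (fun s => g s x) (g' t x) (Icc 0 T) t :=
    ((BoundedContinuousFunction.evalCLM ℝ x : (E N →ᵇ F) →L[ℝ] F).hasFDerivAt
      (x := g t)).comp_hasDerivWithinAt t hd
  have hx' : HasDerivWithinAt (fun s => f s x) (g' t x) (Icc 0 T) t :=
    hx.congr (fun s hs => (hgf s hs x).symm) (hgf t ht x).symm
  exact ⟨hx', hx'.derivWithin (hu t ht)⟩

/-! ### Consequences of the calibration properties -/

theorem cutDist_nonneg (S : Set (E N)) (x : E N) : 0 ≤ cutDist S x := ENNReal.toReal_nonneg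

theorem cutDist_le_one (S : Set (E N)) (x : E N) : cutDist S x ≤ 1 :=
  ENNReal.toReal_le_of_le_ofReal zero_le_one (by simp)

theorem mem_closure_of_cutDist_eq_zero {S : Set (E N)} {x : E N} (h : cutDist S x = 0) :
    x ∈ closure S := by
  rw [Metric.mem_closure_iff_infEDist_zero]
  rw [cutDist, ENNReal.toReal_eq_zero_iff] at h
  rcases h with h | h
  · have := min_eq_iff.1 h
    simpa using this.imp And.left And.left
  · simp at h

theorem IsInnerUnitNormal.norm_eq_one {A : Set (E N)} {x ν : E N} (h : IsInnerUnitNormal A x ν) :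
    ‖ν‖ = 1 := by
  obtain ⟨f, -, -, h0, -, rfl⟩ := h
  rw [norm_smul, norm_inv, norm_norm, inv_mul_cancel₀ (norm_ne_zero_iff.2 h0)]

namespace IsCalibration

variable {σ : E N → ℝ} {T : ℝ} {𝒜 : ℝ → Set (E N)} {ξ B : ℝ → E N → E N} {ϑ : ℝ → E N → ℝ}

/-- The sign conditions determine the calibrated set from `ϑ`. This makes integrals over it
integrals of positive parts, and it makes the final constant depend on the calibration alone. -/
theorem eq_setOf_pos (h : IsCalibration σ T 𝒜 ξ B ϑ) {t : ℝ} (ht : t ∈ Icc 0 T) :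
    𝒜 t = {x | 0 < ϑ t x} := by
  ext x
  refine ⟨fun hx => h.ϑ_pos t ht x hx, fun hx => ?_⟩
  by_contra hxA
  rw [mem_ofPred_eq] at hx
  by_cases hc : x ∈ closure (𝒜 t)
  · have hf : x ∈ frontier (𝒜 t) := by rw [(h.isOpen t ht).frontier_eq]; exact ⟨hc, hxA⟩
    exact hx.ne' (h.ϑ_zero t ht x hf)
  · exact (h.ϑ_neg t ht x hc).not_gt hx

theorem mem_frontier_of_eq_zero (h : IsCalibration σ T 𝒜 ξ B ϑ) {t : ℝ} (ht : t ∈ Icc 0 T) {x : E N}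
    (hx : ϑ t x = 0) : x ∈ frontier (𝒜 t) := by
  obtain ⟨C, -, hC⟩ := h.ϑ_coercive
  have := hC t ht x
  rw [hx, abs_zero, mul_zero] at this
  have h0 := mem_closure_of_cutDist_eq_zero (this.antisymm (cutDist_nonneg _ _))
  rwa [isClosed_frontier.closure_eq] at h0

/-- On the boundary `|ξ| = 1`. If `ξ(t)` is uniformly closer than `1` to `ξ(s)`, then `ξ(s)` cannot
vanish on the boundary at time `t`, which therefore lies in the compact support of `ξ(s)`. Finitely
many times `s` suffice by compactness of `[0,T]`. -/
theorem exists_frontier_bound (h : IsCalibration σ T 𝒜 ξ B ϑ) :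
    ∃ R : ℝ, ∀ t ∈ Icc 0 T, frontier (𝒜 t) ⊆ Metric.closedBall 0 R := by
  obtain ⟨g, hg, hgξ⟩ := h.regular_ξ_time
  suffices hS : ∃ K : Set (E N), IsCompact K ∧ ∀ t ∈ Icc 0 T, frontier (𝒜 t) ⊆ K by
    obtain ⟨K, hK, hKf⟩ := hS
    obtain ⟨R, hR⟩ := hK.isBounded.subset_closedBall 0
    exact ⟨R, fun t ht => (hKf t ht).trans hR⟩
  have hloc : ∀ s ∈ Icc 0 T, ∃ U ∈ 𝓝[Icc 0 T] s, ∃ K : Set (E N), IsCompact K ∧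
      ∀ t ∈ U, t ∈ Icc 0 T → frontier (𝒜 t) ⊆ K := by
    intro s hs
    have hc := hg.continuousOn s hs
    refine ⟨{t | dist (g t) (g s) < 1}, hc (Metric.ball_mem_nhds _ one_pos), tsupport (ξ s),
      h.regular_ξ.compactSupport s hs, fun t htU ht x hx => subset_tsupport _ ?_⟩
    have h1 := (h.ξ_eq_normal t ht x hx).norm_eq_one
    intro h0
    have h2 := BoundedContinuousFunction.dist_coe_le_dist (f := g t) (g := g s) x
    rw [hgξ t ht, hgξ s hs, h0, dist_zero_right, h1] at h2
    exact (h2.trans_lt htU).false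
  choose! U hU K hK hUK using hloc
  obtain ⟨F, hF, hcov⟩ := isCompact_Icc.elim_nhdsWithin_subcover U hU
  refine ⟨⋃ s ∈ F, K s, F.isCompact_biUnion fun s hs => hK s (hF s hs), fun t ht x hx => ?_⟩
  obtain ⟨s, hs, hts⟩ := mem_iUnion₂.1 (hcov ht)
  exact mem_iUnion₂.2 ⟨s, hs, hUK s (hF s hs) t hts ht hx⟩

/-- With `d` the truncated distance, the length control gives `d² ≤ (1 - |ξ|) / c` as long as `c d²
≤ 1`; otherwise `ξ = 0` and `d ≤ 1` is enough. The constant `1 + 1 / c` covers both cases. -/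
theorem exists_cutDist_sq_le (h : IsCalibration σ T 𝒜 ξ B ϑ) :
    ∃ K : ℝ, ∀ t ∈ Icc 0 T, ∀ x, ‖ξ t x‖ ≤ 1 ∧
      cutDist (frontier (𝒜 t)) x ^ 2 ≤ K * (1 - ‖ξ t x‖) := by
  obtain ⟨c, hc, hb⟩ := h.ξ_length
  refine ⟨1 + 1 / c, fun t ht x => ?_⟩
  have h1 := hb t ht x
  have hξ : ‖ξ t x‖ ≤ 1 := by
    have : ‖ξ t x‖ₑ ≤ 1 := h1.trans tsub_le_self
    rw [← ofReal_norm] at this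
    simpa using ENNReal.ofReal_le_one.1 this
  refine ⟨hξ, ?_⟩
  have hd0 := cutDist_nonneg (frontier (𝒜 t)) x
  have hd1 := cutDist_le_one (frontier (𝒜 t)) x
  set d := cutDist (frontier (𝒜 t)) x with hd
  have hdle : ENNReal.ofReal d ≤ Metric.infEDist x (frontier (𝒜 t)) := by
    rw [hd, cutDist, ENNReal.ofReal_toReal (by simp)]
    exact min_le_left _ _
  have h2 : ENNReal.ofReal ‖ξ t x‖ ≤ ENNReal.ofReal (1 - c * d ^ 2) := by
    rw [ofReal_norm, ENNReal.ofReal_sub _ (by positivity), ENNReal.ofReal_mul hc.le,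
      ENNReal.ofReal_pow hd0, ENNReal.ofReal_one]
    exact h1.trans (by gcongr)
  have hq : 0 ≤ 1 - ‖ξ t x‖ := by linarith
  by_cases hcd : c * d ^ 2 ≤ 1
  · rw [ENNReal.ofReal_le_ofReal_iff (by linarith)] at h2
    have : c * d ^ 2 ≤ 1 - ‖ξ t x‖ := by linarith
    have h3 : d ^ 2 ≤ 1 / c * (1 - ‖ξ t x‖) := by
      rw [div_mul_eq_mul_div, one_mul, le_div_iff₀ hc]
      linarith
    linarith
  · rw [ENNReal.ofReal_of_nonpos (p := 1 - c * d ^ 2) (by linarith)] at h2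
    have h3 : ‖ξ t x‖ = 0 :=
      (ENNReal.ofReal_eq_zero.1 (le_antisymm h2 bot_le)).antisymm (norm_nonneg _)
    rw [h3, sub_zero, mul_one]
    have : 0 < 1 / c := by positivity
    nlinarith

theorem hasFDerivAt_theta (h : IsCalibration σ T 𝒜 ξ B ϑ) {t : ℝ} (ht : t ∈ Icc 0 T)
    (x : E N) : HasFDerivAt (ϑ t) ((fderivWithin ℝ (Function.uncurry ϑ) (Icc 0 T ×ˢ univ) (t, x)).comp
      (ContinuousLinearMap.inr ℝ ℝ (E N))) x := by
  have h1 := (h.regular_ϑ.differentiableOn one_ne_zero (t, x) ⟨ht, mem_univ _⟩).hasFDerivWithinAt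
  have h2 : HasFDerivWithinAt (fun y : E N => (t, y)) (ContinuousLinearMap.inr ℝ ℝ (E N)) univ x :=
    (hasFDerivAt_prodMk_right t x).hasFDerivWithinAt
  have h3 := h1.comp x h2 (fun y _ => ⟨ht, mem_univ _⟩)
  exact hasFDerivWithinAt_univ.1 h3

theorem hasDerivWithinAt_theta (h : IsCalibration σ T 𝒜 ξ B ϑ) {t : ℝ}
    (ht : t ∈ Icc 0 T) (x : E N) : HasDerivWithinAt (fun s => ϑ s x)
      (fderivWithin ℝ (Function.uncurry ϑ) (Icc 0 T ×ˢ univ) (t, x) (1, 0)) (Icc 0 T) t := by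
  have h1 := (h.regular_ϑ.differentiableOn one_ne_zero (t, x) ⟨ht, mem_univ _⟩).hasFDerivWithinAt
  have h2 : HasDerivWithinAt (fun s : ℝ => (s, x)) (1, 0) (Icc 0 T) t :=
    (hasDerivWithinAt_id t _).prodMk (hasDerivWithinAt_const _ _ _)
  exact h1.comp_hasDerivWithinAt t h2
    (show MapsTo (fun s : ℝ => (s, x)) (Icc 0 T) (Icc 0 T ×ˢ univ) from fun s hs => ⟨hs, mem_univ _⟩)

theorem continuousOn_fderivWithin_theta (hT : 0 < T) (h : IsCalibration σ T 𝒜 ξ B ϑ) :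
    ContinuousOn (fderivWithin ℝ (Function.uncurry ϑ) (Icc 0 T ×ˢ univ)) (Icc 0 T ×ˢ univ) :=
  h.regular_ϑ.continuousOn_fderivWithin ((uniqueDiffOn_Icc hT).prod uniqueDiffOn_univ) le_rfl

theorem contDiff_theta (h : IsCalibration σ T 𝒜 ξ B ϑ) {t : ℝ} (ht : t ∈ Icc 0 T) :
    ContDiff ℝ 1 (ϑ t) := by
  rw [← contDiffOn_univ]
  have hf : ContDiffOn ℝ 1 (fun y : E N => (t, y)) univ := by fun_prop
  have hm : MapsTo (fun y : E N => (t, y)) univ (Icc 0 T ×ˢ univ) := fun y _ => ⟨ht, mem_univ _⟩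
  exact h.regular_ϑ.comp hf hm

/-- At distance at least one, boundedness of `ϑ` suffices. Closer to the boundary, `ϑ` vanishes at
the nearest boundary point and the mean value inequality applies. Both points lie in the ball of
radius `R + 1`, since the boundaries lie in the ball of radius `R`; there the derivative is bounded
by compactness. -/
theorem exists_theta_le (hT : 0 < T) (h : IsCalibration σ T 𝒜 ξ B ϑ) :
    ∃ K : ℝ, ∀ t ∈ Icc 0 T, ∀ x, |ϑ t x| ≤ K * cutDist (frontier (𝒜 t)) x := by
  obtain ⟨R, hR⟩ := h.exists_frontier_bound
  obtain ⟨M, hM⟩ := h.bounded_ϑ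
  obtain ⟨L, hL⟩ := (isCompact_Icc (a := (0 : ℝ)) (b := T)).prod
    (isCompact_closedBall (0 : E N) (R + 1)) |>.exists_bound_of_continuousOn
    ((h.continuousOn_fderivWithin_theta hT).mono (prod_mono le_rfl (subset_univ _)))
  refine ⟨max M L, fun t ht x => ?_⟩
  have hd0 := cutDist_nonneg (frontier (𝒜 t)) x
  rcases le_or_gt 1 (Metric.infEDist x (frontier (𝒜 t))) with h1 | h1
  · have : cutDist (frontier (𝒜 t)) x = 1 := by simp [cutDist, min_eq_right h1]
    rw [this, mul_one]
    exact (hM t ht x).trans (le_max_left _ _)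
  · have hcomp : IsCompact (frontier (𝒜 t)) :=
      (isCompact_closedBall 0 R).of_isClosed_subset isClosed_frontier (hR t ht)
    have hne : (frontier (𝒜 t)).Nonempty := by
      by_contra hne
      rw [not_nonempty_iff_eq_empty.1 hne, Metric.infEDist_empty] at h1
      exact not_top_lt h1
    obtain ⟨y, hy, hxy⟩ := hcomp.exists_infEDist_eq_edist hne x
    have hcut : cutDist (frontier (𝒜 t)) x = dist x y := by
      rw [cutDist, min_eq_left h1.le, hxy, edist_dist, ENNReal.toReal_ofReal dist_nonneg]
    have hdist : dist x y ≤ 1 := by rw [← hcut]; exact cutDist_le_one _ _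
    have hyR := hR t ht hy
    rw [Metric.mem_closedBall, dist_zero_right] at hyR
    have hyB : y ∈ Metric.closedBall (0 : E N) (R + 1) := by
      rw [Metric.mem_closedBall, dist_zero_right]; linarith
    have hxB : x ∈ Metric.closedBall (0 : E N) (R + 1) := by
      rw [Metric.mem_closedBall, dist_zero_right]
      have := norm_le_norm_add_norm_sub' x y
      rw [← dist_eq_norm] at this
      linarith
    have hlip := (convex_closedBall (0 : E N) (R + 1)).norm_image_sub_le_of_norm_hasFDerivWithin_le
      (f := ϑ t) (C := L) (fun z _ => (h.hasFDerivAt_theta ht z).hasFDerivWithinAt)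
      (fun z hz => ?_) hyB hxB
    · rw [h.ϑ_zero t ht y hy, sub_zero, ← dist_eq_norm, ← hcut] at hlip
      exact hlip.trans (by gcongr; exact le_max_right _ _)
    · refine (ContinuousLinearMap.opNorm_comp_le _ _).trans ?_
      refine (mul_le_of_le_one_right (norm_nonneg _) (ContinuousLinearMap.norm_inr_le_one _ _ _)).trans ?_
      exact hL (t, z) ⟨ht, hz⟩

end IsCalibration

/-- Quantitative form, with a single constant, of the properties of a calibration. -/
structure CalibrationBounds (σ : E N → ℝ) (T : ℝ) (𝒜 : ℝ → Set (E N)) (ξ B : ℝ → E N → E N)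
    (ϑ : ℝ → E N → ℝ) (δ K : ℝ) : Prop where
  pos : 0 < δ
  one_le : 1 ≤ K
  σ_ge : ∀ x, δ ≤ σ x
  σ_le : ∀ x, σ x ≤ K
  dσ_le : ∀ x, ‖fderiv ℝ σ x‖ ≤ K
  ξ_le : ∀ t ∈ Icc 0 T, ∀ x, ‖ξ t x‖ ≤ 1
  dist_sq_le : ∀ t ∈ Icc 0 T, ∀ x, cutDist (frontier (𝒜 t)) x ^ 2 ≤ K * (1 - ‖ξ t x‖)
  dξ_le : ∀ t ∈ Icc 0 T, ∀ x, ‖fderiv ℝ (ξ t) x‖ ≤ K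
  B_le : ∀ t ∈ Icc 0 T, ∀ x, ‖B t x‖ ≤ K
  dB_le : ∀ t ∈ Icc 0 T, ∀ x, ‖fderiv ℝ (B t) x‖ ≤ K
  dist_le : ∀ t ∈ Icc 0 T, ∀ x, cutDist (frontier (𝒜 t)) x ≤ K * |ϑ t x|
  ϑ_le : ∀ t ∈ Icc 0 T, ∀ x, |ϑ t x| ≤ K * cutDist (frontier (𝒜 t)) x
  evolution_ξ : ∀ t ∈ Icc 0 T, ∀ x, ‖timeDeriv T ξ t x + fderiv ℝ (ξ t) x (B t x) +
      ContinuousLinearMap.adjoint (fderiv ℝ (B t) x) (ξ t x)‖ ≤ K * cutDist (frontier (𝒜 t)) x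
  evolution_ξ_sq : ∀ t ∈ Icc 0 T, ∀ x, |timeDeriv T (fun s y => ‖ξ s y‖ ^ 2) t x +
      fderiv ℝ (fun y => ‖ξ t y‖ ^ 2) x (B t x)| ≤ K * cutDist (frontier (𝒜 t)) x ^ 2
  evolution_ϑ : ∀ t ∈ Icc 0 T, ∀ x, |timeDeriv T ϑ t x + fderiv ℝ (ϑ t) x (B t x)| ≤
      K * cutDist (frontier (𝒜 t)) x
  geometric : ∀ t ∈ Icc 0 T, ∀ x, |- vdiv (ξ t) x - fderiv ℝ (fun y => Real.log (σ y)) x (ξ t x) -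
      ⟪B t x, ξ t x⟫_ℝ| ≤ K * cutDist (frontier (𝒜 t)) x

theorem IsCalibration.exists_bounds {σ : E N → ℝ} {T : ℝ} {𝒜 : ℝ → Set (E N)}
    {ξ B : ℝ → E N → E N} {ϑ : ℝ → E N → ℝ} (hT : 0 < T) (hσ : IsSurfaceTension σ)
    (h : IsCalibration σ T 𝒜 ξ B ϑ) : ∃ δ K, CalibrationBounds σ T 𝒜 ξ B ϑ δ K := by
  obtain ⟨δ, Cδ, hδ, hb⟩ := hσ.bounds
  obtain ⟨G, hG⟩ := hσ.exists_fderiv_bound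
  obtain ⟨c, hc⟩ := h.exists_cutDist_sq_le
  obtain ⟨C1, h1⟩ := h.regular_ξ.continuous_fderiv.exists_bound hT.le
  obtain ⟨C2, h2⟩ := h.regular_B.continuous.exists_bound hT.le
  obtain ⟨C3, h3⟩ := h.regular_B.continuous_fderiv.exists_bound hT.le
  obtain ⟨C4, -, h4⟩ := h.ϑ_coercive
  obtain ⟨C5, h5⟩ := h.exists_theta_le hT
  obtain ⟨C6, h6⟩ := h.evolution_ξ
  obtain ⟨C7, h7⟩ := h.evolution_ξ_sq
  obtain ⟨C8, h8⟩ := h.evolution_ϑ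
  obtain ⟨C9, h9⟩ := h.geometric
  simp only [pow_one, Real.norm_eq_abs] at h6 h7 h8 h9
  have hev : ∀ C : ℝ, ∀ᶠ K : ℝ in atTop, C ≤ K := fun C => eventually_ge_atTop C
  -- Each requirement on `K` is a lower bound, so all of them hold for large `K`.
  obtain ⟨K, k0, k1, k2, k3, k4, k5, k6, k7, k8, k9, k10, k11, k12⟩ :=
    ((hev 1).and <| (hev Cδ).and <| (hev G).and <| (hev c).and <| (hev C1).and <| (hev C2).and <|
      (hev C3).and <| (hev C4).and <| (hev C5).and <| (hev C6).and <| (hev C7).and <|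
      (hev C8).and (hev C9)).exists
  have hd := fun t x => cutDist_nonneg (frontier (𝒜 t)) x
  exact ⟨δ, K, {
    pos := hδ
    one_le := k0
    σ_ge := fun x => (hb x).1
    σ_le := fun x => (hb x).2.trans k1
    dσ_le := fun x => (hG x).trans k2
    ξ_le := fun t ht x => (hc t ht x).1
    dist_sq_le := fun t ht x => (hc t ht x).2.trans
      (mul_le_mul_of_nonneg_right k3 (by linarith [(hc t ht x).1]))
    dξ_le := fun t ht x => (h1 t ht x).trans k4
    B_le := fun t ht x => (h2 t ht x).trans k5
    dB_le := fun t ht x => (h3 t ht x).trans k6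
    dist_le := fun t ht x => (h4 t ht x).trans (mul_le_mul_of_nonneg_right k7 (abs_nonneg _))
    ϑ_le := fun t ht x => (h5 t ht x).trans (mul_le_mul_of_nonneg_right k8 (hd t x))
    evolution_ξ := fun t ht x => (h6 t ht x).trans (mul_le_mul_of_nonneg_right k9 (hd t x))
    evolution_ξ_sq := fun t ht x => (h7 t ht x).trans
      (mul_le_mul_of_nonneg_right k10 (sq_nonneg _))
    evolution_ϑ := fun t ht x => (h8 t ht x).trans (mul_le_mul_of_nonneg_right k11 (hd t x))
    geometric := fun t ht x => (h9 t ht x).trans (mul_le_mul_of_nonneg_right k12 (hd t x)) }⟩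

open ProbabilityTheory (Kernel IsFiniteKernel)

/-! ### The space-time perimeter measure -/

/-- The space-time measure `κ t ⊗ dt` on `(0,S) × ℝ^N`. -/
abbrev spaceTime (S : ℝ) (κ : Kernel ℝ (E N)) : Measure (ℝ × E N) :=
  (volume.restrict (Ioo 0 S)).compProd κ

/-- `κ` is a measurable version of `t ↦ |∇χ_{A(t)}|`. -/
def IsPerimeterKernel (S : ℝ) (A : ℝ → Set (E N)) (κ : Kernel ℝ (E N)) : Prop :=
  ∀ᵐ t ∂(volume.restrict (Ioo 0 S)), κ t = perimeterMeasure (A t)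

/-- Optimal dissipation and `σ ≥ δ` bound the perimeter by `E[A(0)] / δ` at almost every time.
Replacing a measurable version of the perimeter measures by zero wherever this bound fails gives a
kernel bounded at every time. -/
theorem exists_perimeterKernel {σ : E N → ℝ} {δ K S : ℝ} (hδ : 0 < δ) (hσδ : ∀ x, δ ≤ σ x)
    (hσK : ∀ x, σ x ≤ K) {A : ℝ → Set (E N)} (h0 : HasFinitePerimeter (A 0))
    (hm : AEMeasurable (fun t => perimeterMeasure (A t)) (volume.restrict (Ioo 0 S)))
    {V : ℝ → E N → ℝ} (hdiss : OptimalDissipation σ S A V) :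
    ∃ κ : Kernel ℝ (E N), IsFiniteKernel κ ∧ IsPerimeterKernel S A κ := by
  have hfin0 := h0.isIndicatorGradient.finite
  set W : ℝ≥0∞ := weightedPerimeter σ (A 0) / ENNReal.ofReal δ with hW
  have hW0 : weightedPerimeter σ (A 0) < ⊤ := by
    refine (lintegral_mono fun x => ENNReal.ofReal_le_ofReal (hσK x)).trans_lt ?_
    rw [lintegral_const]
    exact ENNReal.mul_lt_top ENNReal.ofReal_lt_top (measure_lt_top _ _)
  have hδ' : ENNReal.ofReal δ ≠ 0 := by simpa using hδ
  have hWtop : W < ⊤ := ENNReal.div_lt_top hW0.ne hδ'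
  have hle : ∀ᵐ t ∂(volume.restrict (Ioo 0 S)), perimeterMeasure (A t) univ ≤ W := by
    filter_upwards [hdiss] with t ht
    rw [hW, ENNReal.le_div_iff_mul_le (Or.inl hδ') (Or.inl ENNReal.ofReal_ne_top), mul_comm,
      ← lintegral_const]
    refine le_trans ?_ ((le_add_right le_rfl).trans ht)
    exact lintegral_mono fun x => ENNReal.ofReal_le_ofReal (hσδ x)
  let m := hm.mk _
  have hmm : Measurable m := hm.measurable_mk
  have hset : MeasurableSet {t | m t univ ≤ W} :=
    measurableSet_le ((Measure.measurable_coe MeasurableSet.univ).comp hmm) measurable_const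
  classical
  let κ : Kernel ℝ (E N) :=
    ⟨fun t => if m t univ ≤ W then m t else 0, Measurable.ite hset hmm measurable_const⟩
  refine ⟨κ, ⟨W, hWtop, fun t => ?_⟩, ?_⟩
  · change (if m t univ ≤ W then m t else 0) univ ≤ W
    split_ifs with h
    · exact h
    · simp
  · filter_upwards [hle, hm.ae_eq_mk] with t h1 h2
    change (if m t univ ≤ W then m t else 0) = _
    have h3 : m t = perimeterMeasure (A t) := h2.symm
    rw [h3, if_pos h1]

section

variable {S : ℝ} {A : ℝ → Set (E N)} {κ : Kernel ℝ (E N)} [IsFiniteKernel κ]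

theorem IsPerimeterKernel.integrable_integral (hκ : IsPerimeterKernel S A κ) {f : ℝ × E N → ℝ}
    (hf : Integrable f (spaceTime S κ)) :
    IntegrableOn (fun t => ∫ x, f (t, x) ∂(perimeterMeasure (A t))) (Ioo 0 S) := by
  have h1 : Integrable (fun t => ∫ x, f (t, x) ∂(κ t)) (volume.restrict (Ioo 0 S)) :=
    MeasureTheory.Integrable.integral_compProd (a := ()) (κ := Kernel.const Unit (volume.restrict (Ioo 0 S)))
      (η := Kernel.prodMkLeft Unit κ) hf
  refine h1.congr ?_
  filter_upwards [hκ] with t ht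
  rw [ht]

theorem IsPerimeterKernel.setIntegral_eq (hκ : IsPerimeterKernel S A κ) {f : ℝ × E N → ℝ}
    (hf : Integrable f (spaceTime S κ)) {s : ℝ} (hs : s ≤ S) :
    ∫ p in Iio s ×ˢ univ, f p ∂(spaceTime S κ) =
      ∫ t in Ioo 0 s, ∫ x, f (t, x) ∂(perimeterMeasure (A t)) := by
  rw [Measure.setIntegral_compProd measurableSet_Iio MeasurableSet.univ hf.integrableOn,
    Measure.restrict_restrict measurableSet_Iio]
  have h1 : Iio s ∩ Ioo 0 S = Ioo 0 s := by
    ext t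
    simp only [mem_inter_iff, mem_Iio, mem_Ioo]
    constructor
    · rintro ⟨h1, h2, -⟩; exact ⟨h2, h1⟩
    · rintro ⟨h1, h2⟩; exact ⟨h2, h1, h2.trans_le hs⟩
  rw [h1]
  refine integral_congr_ae ?_
  have h2 : Ioo 0 s ⊆ Ioo 0 S := Ioo_subset_Ioo_right hs
  filter_upwards [ae_restrict_of_ae_restrict_of_subset h2 hκ] with t ht
  rw [ht, Measure.restrict_univ]

theorem IsPerimeterKernel.lintegral_eq (hκ : IsPerimeterKernel S A κ) {f : ℝ × E N → ℝ≥0∞}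
    (hf : Measurable f) : ∫⁻ p, f p ∂(spaceTime S κ) =
      ∫⁻ t in Ioo 0 S, ∫⁻ x, f (t, x) ∂(perimeterMeasure (A t)) := by
  rw [Measure.lintegral_compProd hf]
  refine lintegral_congr_ae ?_
  filter_upwards [hκ] with t ht
  rw [ht]

theorem IsPerimeterKernel.ae_integrable (hκ : IsPerimeterKernel S A κ) {f : ℝ × E N → ℝ}
    (hf : Integrable f (spaceTime S κ)) :
    ∀ᵐ t ∂(volume.restrict (Ioo 0 S)), Integrable (fun x => f (t, x)) (perimeterMeasure (A t)) := by
  filter_upwards [hκ, ((Measure.integrable_compProd_iff hf.aestronglyMeasurable).1 hf).1] with t h1 h2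
  rwa [← h1]

/-- The velocity is square integrable on space-time. -/
theorem IsBVNormalVelocity.integrable_mul_sq {σ : E N → ℝ} {δ : ℝ} (hδ : 0 < δ)
    (hσc : Continuous σ) (hσδ : ∀ x, δ ≤ σ x) {V : ℝ → E N → ℝ}
    (hκ : IsPerimeterKernel S A κ) (hV : IsBVNormalVelocity σ S A V) :
    Integrable (fun p : ℝ × E N => σ p.2 * V p.1 p.2 ^ 2) (spaceTime S κ) := by
  have hVm : Measurable (fun p : ℝ × E N => V p.1 p.2) := hV.measurable
  have hm : Measurable (fun p : ℝ × E N => σ p.2 * V p.1 p.2 ^ 2) := by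
    have := hσc.measurable
    fun_prop
  refine ⟨hm.aestronglyMeasurable, ?_⟩
  rw [hasFiniteIntegral_iff_ofReal (ae_of_all _ fun p =>
      mul_nonneg (hδ.le.trans (hσδ _)) (sq_nonneg _)), hκ.lintegral_eq hm.ennreal_ofReal]
  exact hV.square_integrable

theorem IsBVNormalVelocity.memLp_two {σ : E N → ℝ} {δ : ℝ} (hδ : 0 < δ)
    (hσc : Continuous σ) (hσδ : ∀ x, δ ≤ σ x) {V : ℝ → E N → ℝ}
    (hκ : IsPerimeterKernel S A κ) (hV : IsBVNormalVelocity σ S A V) :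
    MemLp (fun p : ℝ × E N => V p.1 p.2) 2 (spaceTime S κ) := by
  have hVm : Measurable (fun p : ℝ × E N => V p.1 p.2) := hV.measurable
  rw [memLp_two_iff_integrable_sq hVm.aestronglyMeasurable]
  refine Integrable.mono' ((hV.integrable_mul_sq hδ hσc hσδ hκ).const_mul δ⁻¹)
    (hVm.pow_const 2).aestronglyMeasurable (ae_of_all _ fun p => ?_)
  rw [Real.norm_of_nonneg (sq_nonneg _), ← mul_assoc]
  have h1 : 1 ≤ δ⁻¹ * σ p.2 := by
    rw [inv_mul_eq_div, one_le_div hδ]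
    exact hσδ _
  exact le_mul_of_one_le_left (sq_nonneg _) h1

/-! ### The transport equation for bounded measurable test functions -/

/-- The transport equation in integrated form, tested with functions of `x` only. -/
def TransportsTo (S : ℝ) (A : ℝ → Set (E N)) (V : ℝ → E N → ℝ) (κ : Kernel ℝ (E N)) (s : ℝ) :
    Prop :=
  ∀ g : E N → ℝ, Measurable g → (∃ C, ∀ x, ‖g x‖ ≤ C) →
    (∫ x in A s, g x) - ∫ x in A 0, g x =
      - ∫ p in Iio s ×ˢ univ, V p.1 p.2 * g p.2 ∂(spaceTime S κ)

theorem exists_time_cutoff {s S : ℝ} (hs : 0 < s) (hS : s < S) :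
    ∃ α : ℝ → ℝ, ContDiff ℝ ∞ α ∧ HasCompactSupport α ∧ tsupport α ⊆ Iio S ∧
      ∀ t ∈ Icc 0 s, α t = 1 ∧ deriv α t = 0 := by
  -- The bump equals one up to time `s + (S - s) / 3` and is supported up to time `s + 2 (S - s) / 3
  -- < S`, so it is constant near `[0, s]`.
  let b : ContDiffBump (s / 2) := ⟨s / 2 + (S - s) / 3, s / 2 + 2 * (S - s) / 3, by linarith, by linarith⟩
  refine ⟨b, b.contDiff, b.hasCompactSupport, ?_, fun t ht => ?_⟩
  · rw [b.tsupport_eq, Real.closedBall_eq_Icc]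
    intro t ht
    have h2 : t ≤ s / 2 + (s / 2 + 2 * (S - s) / 3) := ht.2
    rw [mem_Iio]
    linarith
  · have hmem : t ∈ Metric.ball (s / 2) b.rIn := by
      rw [Real.ball_eq_Ioo]
      change t ∈ Ioo (s / 2 - (s / 2 + (S - s) / 3)) (s / 2 + (s / 2 + (S - s) / 3))
      exact ⟨by linarith [ht.1], by linarith [ht.2]⟩
    refine ⟨b.one_of_mem_closedBall (Metric.ball_subset_closedBall hmem), ?_⟩
    exact (b.eventuallyEq_one_of_mem_ball hmem).deriv_eq.trans (by simp)

theorem integral_map_withDensity_ofReal {μ : Measure (ℝ × E N)} {f : ℝ × E N → ℝ} (hf : Measurable f)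
    {g : E N → ℝ} (hg : Measurable g) :
    ∫ x, g x ∂((μ.withDensity fun p => ENNReal.ofReal (f p)).map Prod.snd) =
      ∫ p, max (f p) 0 * g p.2 ∂μ := by
  rw [integral_map measurable_snd.aemeasurable hg.aestronglyMeasurable,
    integral_withDensity_eq_integral_toReal_smul hf.ennreal_ofReal
      (ae_of_all _ fun _ => ENNReal.ofReal_lt_top)]
  simp [ENNReal.toReal_ofReal']

/-- Multiplication by a time cutoff makes smooth compactly supported functions of `x` admissible.
The resulting identity compares two finite measures on such functions, so the measures are equal,
and this extends the identity to all bounded measurable tests, including ones without compact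
support. -/
theorem IsBVNormalVelocity.ae_transportsTo {σ : E N → ℝ} {V : ℝ → E N → ℝ}
    (hA : ∀ t ∈ Icc 0 S, HasFinitePerimeter (A t)) (hS : 0 < S)
    (hκ : IsPerimeterKernel S A κ) (hV : IsBVNormalVelocity σ S A V)
    (hVi : Integrable (fun p : ℝ × E N => V p.1 p.2) (spaceTime S κ)) :
    ∀ᵐ s ∂(volume.restrict (Ioo 0 S)), TransportsTo S A V κ s := by
  have hVm : Measurable (fun p : ℝ × E N => V p.1 p.2) := hV.measurable
  filter_upwards [hV.transport, ae_restrict_mem measurableSet_Ioo] with s hs hsS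
  have hmulg : ∀ g : E N → ℝ, Measurable g → (∃ C, ∀ x, ‖g x‖ ≤ C) →
      Integrable (fun p : ℝ × E N => V p.1 p.2 * g p.2) (spaceTime S κ) := by
    rintro g hg ⟨C, hC⟩
    exact hVi.mul_bdd (hg.comp measurable_snd).aestronglyMeasurable (c := C) (ae_of_all _ fun p => hC _)
  have hsmooth : ∀ g : E N → ℝ, ContDiff ℝ ∞ g → HasCompactSupport g →
      (∫ x in A s, g x) - ∫ x in A 0, g x =
        - ∫ p in Iio s ×ˢ univ, V p.1 p.2 * g p.2 ∂(spaceTime S κ) := by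
    intro g hg hgc
    obtain ⟨α, hα, hαc, hαS, hα1⟩ := exists_time_cutoff hsS.1 hsS.2
    have hsub : tsupport (Function.uncurry fun t x => α t * g x) ⊆ tsupport α ×ˢ tsupport g := by
      refine closure_minimal (fun p hp => ?_) ((isClosed_tsupport α).prod (isClosed_tsupport g))
      have hp' : α p.1 * g p.2 ≠ 0 := hp
      exact ⟨subset_tsupport _ (left_ne_zero_of_mul hp'), subset_tsupport _ (right_ne_zero_of_mul hp')⟩
    have h1 := hs (fun t x => α t * g x)
      ((hα.comp contDiff_fst).mul (hg.comp contDiff_snd))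
      ((hαc.isCompact.prod hgc.isCompact).of_isClosed_subset (isClosed_tsupport _) hsub)
      (hsub.trans (prod_mono hαS (subset_univ _)))
    have e1 := hα1 s ⟨hsS.1.le, le_rfl⟩
    have e2 := hα1 0 ⟨le_rfl, hsS.1.le⟩
    simp only [e1.1, e2.1, one_mul] at h1
    rw [h1, hκ.setIntegral_eq (hmulg g hg.continuous.measurable
      (hgc.exists_bound_of_continuous hg.continuous)) hsS.2.le]
    have e3 : ∫ t in Ioo 0 s, ∫ x in A t, deriv (fun s => α s * g x) t = 0 := by
      refine (setIntegral_congr_fun (g := fun _ => (0 : ℝ)) measurableSet_Ioo fun t ht => ?_).trans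
        (by simp)
      have : ∀ x, deriv (fun s => α s * g x) t = 0 := fun x => by
        rw [deriv_mul_const (hα.differentiable (by simp) t), (hα1 t ⟨ht.1.le, ht.2.le⟩).2, zero_mul]
      simp [this]
    have e4 : ∫ t in Ioo 0 s, ∫ x, V t x * (α t * g x) ∂(perimeterMeasure (A t)) =
        ∫ t in Ioo 0 s, ∫ x, V t x * g x ∂(perimeterMeasure (A t)) := by
      refine setIntegral_congr_fun measurableSet_Ioo fun t ht => ?_
      simp [(hα1 t ⟨ht.1.le, ht.2.le⟩).1]
    rw [e3, e4, zero_sub]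
  set μ := (spaceTime S κ).restrict (Iio s ×ˢ univ) with hμ
  have hVμ : Integrable (fun p : ℝ × E N => V p.1 p.2) μ := hVi.restrict
  have hfin : ∀ t ∈ Icc 0 S, IsFiniteMeasure ((volume : Measure (E N)).restrict (A t)) := fun t ht =>
    ⟨by rw [Measure.restrict_apply_univ]; exact (hA t ht).volume_lt_top⟩
  have := hfin s ⟨hsS.1.le, hsS.2.le⟩
  have := hfin 0 ⟨le_rfl, hS.le⟩
  have hPfin : IsFiniteMeasure (μ.withDensity fun p => ENNReal.ofReal (V p.1 p.2)) :=
    isFiniteMeasure_withDensity_ofReal hVμ.2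
  have hQfin : IsFiniteMeasure (μ.withDensity fun p => ENNReal.ofReal (-V p.1 p.2)) :=
    isFiniteMeasure_withDensity_ofReal hVμ.neg.2
  set P := (μ.withDensity fun p => ENNReal.ofReal (V p.1 p.2)).map Prod.snd with hP
  set Q := (μ.withDensity fun p => ENNReal.ofReal (-V p.1 p.2)).map Prod.snd with hQ
  have hdiff : ∀ g : E N → ℝ, Measurable g → (∃ C, ∀ x, ‖g x‖ ≤ C) →
      ∫ x, g x ∂P - ∫ x, g x ∂Q = ∫ p, V p.1 p.2 * g p.2 ∂μ := by
    rintro g hg ⟨C, hC⟩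
    rw [hP, hQ, integral_map_withDensity_ofReal hVm hg, integral_map_withDensity_ofReal (f := fun p => -V p.1 p.2) hVm.neg hg,
      ← integral_sub]
    · congr 1
      ext p
      rw [← sub_mul]
      congr 1
      rcases le_total 0 (V p.1 p.2) with h | h
      · rw [max_eq_left h, max_eq_right (by linarith), sub_zero]
      · rw [max_eq_right h, max_eq_left (by linarith)]; ring
    · exact hVμ.pos_part.mul_bdd (hg.comp measurable_snd).aestronglyMeasurable
        (c := C) (ae_of_all _ fun p => hC _)
    · exact hVμ.neg.pos_part.mul_bdd (hg.comp measurable_snd).aestronglyMeasurable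
        (c := C) (ae_of_all _ fun p => hC _)
  have hint : ∀ (ν : Measure (E N)) [IsFiniteMeasure ν] (g : E N → ℝ), Measurable g →
      (∃ C, ∀ x, ‖g x‖ ≤ C) → Integrable g ν := by
    rintro ν _ g hg ⟨C, hC⟩
    exact Integrable.mono' (integrable_const C) hg.aestronglyMeasurable (ae_of_all _ hC)
  -- `P` and `Q` are the spatial marginals of the positive and negative parts of `V`. Moving the
  -- negative part to the other side leaves only positive measures.
  have heq : (volume.restrict (A s)) + P = volume.restrict (A 0) + Q := by
    refine measure_eq_of_integral_smooth_eq fun g hg hgc => ?_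
    have hgm := hg.continuous.measurable
    have hgb := hgc.exists_bound_of_continuous hg.continuous
    rw [integral_add_measure (hint _ g hgm hgb) (hint _ g hgm hgb),
      integral_add_measure (hint _ g hgm hgb) (hint _ g hgm hgb)]
    have h1 := hdiff g hgm hgb
    have h2 := hsmooth g hg hgc
    linarith
  intro g hgm hgb
  have h1 := hdiff g hgm hgb
  have h2 : ∫ x, g x ∂((volume.restrict (A s)) + P) = ∫ x, g x ∂(volume.restrict (A 0) + Q) := by
    rw [heq]
  rw [integral_add_measure (hint _ g hgm hgb) (hint _ g hgm hgb),
    integral_add_measure (hint _ g hgm hgb) (hint _ g hgm hgb)] at h2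
  linarith

end

/-! ### The transport equation for time dependent test functions -/

theorem ae_mem_Ioo_restrict_spaceTime {S s : ℝ} {κ : Kernel ℝ (E N)} :
    ∀ᵐ p ∂((spaceTime S κ).restrict (Iio s ×ˢ univ)), p.1 ∈ Ioo 0 s := by
  have h1 : ∀ᵐ p ∂(spaceTime S κ), p.1 ∈ Ioo 0 S :=
    Measure.ae_compProd_of_ae_fst κ measurableSet_Ioo (ae_restrict_mem measurableSet_Ioo)
  filter_upwards [ae_restrict_of_ae h1,
    ae_restrict_mem (measurableSet_Iio.prod MeasurableSet.univ)] with p hp hp'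
  exact ⟨hp.1, hp'.1⟩

theorem sub_eq_setIntegral_indicator {f f' : ℝ → ℝ} {r s : ℝ} (hr : 0 ≤ r) (hrs : r ≤ s)
    (hf : Continuous f) (hf' : Continuous f') (hd : ∀ t ∈ Ioo 0 s, HasDerivAt f (f' t) t) :
    f s - f r = ∫ t in Ioo 0 s, (Ioi r).indicator f' t := by
  rw [setIntegral_indicator measurableSet_Ioi]
  have h1 : Ioo 0 s ∩ Ioi r = Ioo r s := by
    ext t
    simp only [mem_inter_iff, mem_Ioo, mem_Ioi]
    constructor
    · rintro ⟨⟨-, h2⟩, h3⟩; exact ⟨h3, h2⟩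
    · rintro ⟨h2, h3⟩; exact ⟨⟨hr.trans_lt h2, h3⟩, h2⟩
  rw [h1, ← integral_Ioc_eq_integral_Ioo, ← intervalIntegral.integral_of_le hrs]
  exact (intervalIntegral.integral_eq_sub_of_hasDerivAt_of_le hrs hf.continuousOn
    (fun t ht => hd t ⟨hr.trans_lt ht.1, ht.2⟩) (hf'.intervalIntegrable _ _)).symm

/-- The function `ζ s` is an admissible test depending on `x` only. The corrections `ζ s - ζ r` are
written as time integrals of `ζ'`; after Fubini, the identity at almost every time `t`, tested with
`ζ' t`, recombines them. Integrability of `t ↦ ∫_{A t} ζ' t` comes out of the same formula. -/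
theorem TransportsTo.time_dependent {S : ℝ} {A : ℝ → Set (E N)} {κ : Kernel ℝ (E N)} {V : ℝ → E N → ℝ} {s C : ℝ} (hs : 0 < s) (hsS : s ≤ S)
    (hts : TransportsTo S A V κ s)
    (hae : ∀ᵐ r ∂(volume.restrict (Ioo 0 S)), TransportsTo S A V κ r)
    (hVi : Integrable (fun p : ℝ × E N => V p.1 p.2) (spaceTime S κ))
    (hA0 : volume (A 0) < ⊤) {ζ ζ' : ℝ → E N → ℝ} (hζ : Continuous (Function.uncurry ζ))
    (hζ' : Continuous (Function.uncurry ζ')) (hb : ∀ t x, ‖ζ t x‖ ≤ C) (hb' : ∀ t x, ‖ζ' t x‖ ≤ C)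
    (hd : ∀ x, ∀ t ∈ Ioo 0 s, HasDerivAt (fun r => ζ r x) (ζ' t x) t) :
    IntegrableOn (fun t => ∫ x in A t, ζ' t x) (Ioo 0 s) ∧
    (∫ x in A s, ζ s x) - ∫ x in A 0, ζ 0 x = (∫ t in Ioo 0 s, ∫ x in A t, ζ' t x) -
      ∫ p in Iio s ×ˢ univ, V p.1 p.2 * ζ p.1 p.2 ∂(spaceTime S κ) := by
  have hct : ∀ t, Continuous (ζ t) := fun t => hζ.comp (by fun_prop : Continuous fun x => (t, x))
  have hct' : ∀ t, Continuous (ζ' t) := fun t => hζ'.comp (by fun_prop : Continuous fun x => (t, x))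
  have hcx : ∀ x, Continuous (fun t => ζ t x) := fun x =>
    hζ.comp (by fun_prop : Continuous fun t => (t, x))
  have hcx' : ∀ x, Continuous (fun t => ζ' t x) := fun x =>
    hζ'.comp (by fun_prop : Continuous fun t => (t, x))
  set M := spaceTime S κ with hM
  set μ := M.restrict (Iio s ×ˢ univ) with hμ
  set ν : Measure ℝ := volume.restrict (Ioo 0 s) with hν
  set lam : Measure (E N) := volume.restrict (A 0) with hlam
  have : IsFiniteMeasure lam := ⟨by rw [hlam, Measure.restrict_apply_univ]; exact hA0⟩
  have hVμ : Integrable (fun p : ℝ × E N => V p.1 p.2) μ := hVi.restrict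
  have hμae : ∀ᵐ p ∂μ, p.1 ∈ Ioo 0 s := ae_mem_Ioo_restrict_spaceTime
  -- the part on `A 0`
  have hi0 : Integrable (fun q : E N × ℝ => ζ' q.2 q.1) (lam.prod ν) :=
    Integrable.mono' (integrable_const C)
      (hζ'.comp continuous_swap).aestronglyMeasurable (ae_of_all _ fun q => hb' _ _)
  have h0 : (∫ x, ζ s x ∂lam) - ∫ x, ζ 0 x ∂lam = ∫ t, ∫ x, ζ' t x ∂lam ∂ν := by
    rw [← integral_integral_swap hi0, ← integral_sub]
    · congr 1
      ext x
      rw [sub_eq_setIntegral_indicator le_rfl hs.le (hcx x) (hcx' x) (hd x)]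
      refine setIntegral_congr_fun measurableSet_Ioo fun t ht => ?_
      exact indicator_of_mem (show t ∈ Ioi 0 from ht.1) _
    · exact Integrable.mono' (integrable_const C) (hct s).aestronglyMeasurable (ae_of_all _ (hb s))
    · exact Integrable.mono' (integrable_const C) (hct 0).aestronglyMeasurable (ae_of_all _ (hb 0))
  -- the part on space-time
  let k : (ℝ × E N) → ℝ → ℝ := fun p t => V p.1 p.2 * (Ioi p.1).indicator (fun t => ζ' t p.2) t
  have hk : Integrable (Function.uncurry k) (μ.prod ν) := by
    have hset : MeasurableSet {q : (ℝ × E N) × ℝ | q.1.1 < q.2} :=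
      measurableSet_lt (by fun_prop) (by fun_prop)
    have h1 : Measurable (fun q : (ℝ × E N) × ℝ => ζ' q.2 q.1.2) :=
      (hζ'.comp (by fun_prop : Continuous fun q : (ℝ × E N) × ℝ => (q.2, q.1.2))).measurable
    have h2 : Function.uncurry k = fun q => V q.1.1 q.1.2 *
        {q : (ℝ × E N) × ℝ | q.1.1 < q.2}.indicator (fun q => ζ' q.2 q.1.2) q := by
      ext q
      by_cases hq : q.1.1 < q.2
      · simp [k, Function.uncurry, hq]
      · simp [k, Function.uncurry, hq]
    rw [h2]
    refine (hVμ.comp_fst ν).mul_bdd (h1.indicator hset).aestronglyMeasurable (c := C)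
      (ae_of_all _ fun q => ?_)
    exact (norm_indicator_le_norm_self _ _).trans (hb' _ _)
  have h1 : ∫ p, V p.1 p.2 * ζ s p.2 ∂μ - ∫ p, V p.1 p.2 * ζ p.1 p.2 ∂μ =
      ∫ t, ∫ p, k p t ∂μ ∂ν := by
    rw [← integral_integral_swap hk, ← integral_sub]
    · refine integral_congr_ae ?_
      filter_upwards [hμae] with p hp
      simp only [k]
      rw [integral_const_mul, ← mul_sub,
        ← sub_eq_setIntegral_indicator hp.1.le hp.2.le (hcx p.2) (hcx' p.2) (hd p.2)]
    · exact hVμ.mul_bdd ((hct s).comp continuous_snd).aestronglyMeasurable (c := C)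
        (ae_of_all _ fun p => hb _ _)
    · exact hVμ.mul_bdd hζ.aestronglyMeasurable (c := C) (ae_of_all _ fun p => hb _ _)
  have h2 : ∀ᵐ t ∂ν, ∫ x in A t, ζ' t x = ∫ x, ζ' t x ∂lam - ∫ p, k p t ∂μ := by
    have hsub : Ioo 0 s ⊆ Ioo 0 S := Ioo_subset_Ioo_right hsS
    filter_upwards [ae_restrict_of_ae_restrict_of_subset hsub hae,
      ae_restrict_mem measurableSet_Ioo] with t ht htm
    have h3 := ht (ζ' t) (hct' t).measurable ⟨C, hb' t⟩
    have h4 : ∫ p, k p t ∂μ = ∫ p in Iio t ×ˢ univ, V p.1 p.2 * ζ' t p.2 ∂M := by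
      have hms : MeasurableSet (Iio t ×ˢ (univ : Set (E N))) := measurableSet_Iio.prod .univ
      have h5 : (fun p => k p t) = (Iio t ×ˢ (univ : Set (E N))).indicator
          (fun p => V p.1 p.2 * ζ' t p.2) := by
        ext p
        by_cases hp : p.1 < t <;> simp [k, indicator, hp]
      rw [h5, integral_indicator hms, hμ, Measure.restrict_restrict hms]
      congr 2
      ext p
      simp only [mem_inter_iff, mem_prod, mem_Iio, mem_univ, and_true]
      exact ⟨And.left, fun hp => ⟨hp, hp.trans htm.2⟩⟩
    rw [h4]
    linarith
  have hI1 : Integrable (fun t => ∫ x, ζ' t x ∂lam) ν := hi0.integral_prod_right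
  have hI2 : Integrable (fun t => ∫ p, k p t ∂μ) ν := hk.integral_prod_right
  refine ⟨(hI1.sub hI2).congr (h2.mono fun t ht => ht.symm), ?_⟩
  rw [integral_congr_ae h2, integral_sub hI1 hI2]
  have h3 := hts (ζ s) (hct s).measurable ⟨C, hb s⟩
  linarith

section

variable {S : ℝ} {A : ℝ → Set (E N)} {κ : Kernel ℝ (E N)} [IsFiniteKernel κ]

theorem IsPerimeterKernel.integrable_real_measure (hκ : IsPerimeterKernel S A κ) :
    IntegrableOn (fun t => (perimeterMeasure (A t)).real univ) (Ioo 0 S) := by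
  have := hκ.integrable_integral (f := fun _ => 1) (integrable_const _)
  simpa using this

/-- The transport equation tested with the divergence of a vector field that is only Lipschitz in
time; the time derivative of the test function is interpreted distributionally. -/
theorem TransportsTo.vector_field {V : ℝ → E N → ℝ} {s T C : ℝ} (hs : 0 < s) (hsT : s < T)
    (hTS : T ≤ S) (hA : ∀ t ∈ Icc 0 S, HasFinitePerimeter (A t))
    (hκ : IsPerimeterKernel S A κ) (hts : TransportsTo S A V κ s)
    (hae : ∀ᵐ r ∂(volume.restrict (Ioo 0 S)), TransportsTo S A V κ r)
    (hVi : Integrable (fun p : ℝ × E N => V p.1 p.2) (spaceTime S κ))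
    {X X' : ℝ → E N → E N} {ζ : ℝ → E N → ℝ} (hX : ∀ t ∈ Icc 0 T, ContDiff ℝ 1 (X t))
    (hXc : ∀ t ∈ Icc 0 T, HasCompactSupport (X t)) (hXζ : ∀ t ∈ Icc 0 T, ∀ x, vdiv (X t) x = ζ t x)
    (hζ : Continuous (Function.uncurry ζ)) (hb : ∀ t x, ‖ζ t x‖ ≤ C)
    (hX' : ∀ t ∈ Icc 0 T, ∀ x, HasDerivWithinAt (fun r => X r x) (X' t x) (Icc 0 T) t)
    (hXb' : ∀ t ∈ Icc 0 T, ∀ x, ‖X' t x‖ ≤ C) :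
    IntegrableOn (fun t => ∫ x, ⟪X' t x, measureNormal (A t) x⟫_ℝ ∂(perimeterMeasure (A t)))
      (Ioo 0 s) ∧
    (∫ x in A s, ζ s x) - ∫ x in A 0, ζ 0 x =
      - (∫ t in Ioo 0 s, ∫ x, ⟪X' t x, measureNormal (A t) x⟫_ℝ ∂(perimeterMeasure (A t))) -
      ∫ p in Iio s ×ˢ univ, V p.1 p.2 * ζ p.1 p.2 ∂(spaceTime S κ) := by
  have hC : 0 ≤ C := (norm_nonneg _).trans (hb 0 0)
  have hgrad : ∀ t ∈ Icc 0 S, IsIndicatorGradient (A t) (perimeterMeasure (A t))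
      (measureNormal (A t)) := fun t ht => (hA t ht).isIndicatorGradient
  -- Steklov averages
  let Z : ℝ → ℝ → E N → ℝ := fun h t x => ∫ r in (0 : ℝ)..1, ζ (t + r * h) x
  have hZc : Continuous fun q : ℝ × ℝ × E N => Z q.1 q.2.1 q.2.2 := by
    have hu : Continuous (Function.uncurry fun (q : ℝ × ℝ × E N) (r : ℝ) => ζ (q.2.1 + r * q.1) q.2.2) :=
      hζ.comp (by fun_prop : Continuous fun w : (ℝ × ℝ × E N) × ℝ =>
        (w.1.2.1 + w.2 * w.1.1, w.1.2.2))
    exact intervalIntegral.continuous_parametric_intervalIntegral_of_continuous' hu 0 1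
  -- The average is taken over the unit interval of the rescaled variable, so step size zero is
  -- included and convergence of the averages is continuity at zero.
  have hZ0 : ∀ t x, Z 0 t x = ζ t x := fun t x => by simp [Z]
  have hZb : ∀ h t x, ‖Z h t x‖ ≤ C := fun h t x => by
    have := intervalIntegral.norm_integral_le_of_norm_le_const (a := 0) (b := 1)
      (f := fun r => ζ (t + r * h) x) (C := C) fun r _ => hb _ _
    simpa using this
  have hcx : ∀ x, Continuous (fun t => ζ t x) := fun x =>
    hζ.comp (by fun_prop : Continuous fun t => (t, x))
  have hZd : ∀ h, h ≠ 0 → ∀ x t, HasDerivAt (fun r => Z h r x) (h⁻¹ * (ζ (t + h) x - ζ t x)) t := by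
    intro h hh x t
    let F : ℝ → ℝ := fun u => ∫ r in (0 : ℝ)..u, ζ r x
    have hF : ∀ u, HasDerivAt F (ζ u x) u := fun u =>
      intervalIntegral.integral_hasDerivAt_right ((hcx x).intervalIntegrable _ _)
        ((hcx x).stronglyMeasurableAtFilter _ _) (hcx x).continuousAt
    have hZF : (fun r => Z h r x) = fun r => h⁻¹ * (F (r + h) - F r) := by
      ext r
      have h1 : ∫ q in (0 : ℝ)..1, ζ (r + q * h) x = h⁻¹ • ∫ q in r + 0 * h..r + 1 * h, ζ q x := by
        have := intervalIntegral.integral_comp_add_mul (a := 0) (b := 1) (fun q => ζ q x) hh r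
        simpa [mul_comm] using this
      simp only [Z, h1, zero_mul, one_mul, add_zero, smul_eq_mul, F]
      rw [intervalIntegral.integral_interval_sub_left ((hcx x).intervalIntegrable _ _)
        ((hcx x).intervalIntegrable _ _)]
    rw [hZF]
    exact (((hF (t + h)).comp_add_const t h).sub (hF t)).const_mul _
  -- step sizes
  let h : ℕ → ℝ := fun k => (T - s) / ((k : ℝ) + 1)
  have hhpos : ∀ k, 0 < h k := fun k => div_pos (by linarith) (by positivity)
  have hhle : ∀ k, h k ≤ T - s := fun k => div_le_self (by linarith) (by
    have : (0 : ℝ) ≤ k := Nat.cast_nonneg k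
    linarith)
  have hhlim : Tendsto h atTop (𝓝 0) := by
    have := tendsto_one_div_add_atTop_nhds_zero_nat (𝕜 := ℝ) |>.const_mul (T - s)
    simpa [h, div_eq_mul_inv] using this
  have hZlim : ∀ t x, Tendsto (fun k => Z (h k) t x) atTop (𝓝 (ζ t x)) := by
    intro t x
    have h1 : Continuous fun u => Z u t x :=
      hZc.comp (by fun_prop : Continuous fun u : ℝ => (u, t, x))
    have := (h1.tendsto 0).comp hhlim
    rwa [hZ0] at this
  have hT := fun k => TransportsTo.time_dependent (C := C + (h k)⁻¹ * (C + C)) hs (hsT.le.trans hTS)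
    hts hae hVi (hA 0 ⟨le_rfl, by linarith⟩).volume_lt_top (ζ := Z (h k))
    (ζ' := fun t x => (h k)⁻¹ * (ζ (t + h k) x - ζ t x))
    (hZc.comp (by fun_prop : Continuous fun q : ℝ × E N => (h k, q.1, q.2)))
    (continuous_const.mul ((hζ.comp (by fun_prop :
      Continuous fun q : ℝ × E N => (q.1 + h k, q.2))).sub hζ))
    (fun t x => (hZb _ t x).trans (le_add_of_nonneg_right
      (mul_nonneg (inv_nonneg.2 (hhpos k).le) (by linarith))))
    (fun t x => by
      rw [norm_mul, norm_inv, Real.norm_of_nonneg (hhpos k).le]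
      refine le_trans ?_ (le_add_of_nonneg_left hC)
      gcongr
      exact (norm_sub_le _ _).trans (add_le_add (hb _ _) (hb _ _)))
    (fun x t _ => hZd (h k) (hhpos k).ne' x t)
  -- difference quotients of `X`
  let D : ℕ → ℝ → E N → E N := fun k t x => (h k)⁻¹ • (X (t + h k) x - X t x)
  -- The steps are at most `T - s`, so the forward differences stay in the interval on which `X` is
  -- controlled.
  have hmem : ∀ k, ∀ t ∈ Ioo 0 s, t ∈ Icc 0 T ∧ t + h k ∈ Icc 0 T := fun k t ht =>
    ⟨⟨ht.1.le, by linarith [ht.2]⟩, ⟨by linarith [ht.1, hhpos k], by linarith [ht.2, hhle k]⟩⟩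
  have hDb : ∀ k, ∀ t ∈ Ioo 0 s, ∀ x, ‖D k t x‖ ≤ C := by
    intro k t ht x
    obtain ⟨h1, h2⟩ := hmem k t ht
    have := (convex_Icc 0 T).norm_image_sub_le_of_norm_hasDerivWithin_le
      (fun r hr => hX' r hr x) (fun r hr => hXb' r hr x) h1 h2
    simp only [D]
    rw [norm_smul, norm_inv, Real.norm_of_nonneg (hhpos k).le, inv_mul_le_iff₀ (hhpos k)]
    rw [add_sub_cancel_left, Real.norm_of_nonneg (hhpos k).le] at this
    linarith
  have hDlim : ∀ t ∈ Ioo 0 s, ∀ x, Tendsto (fun k => D k t x) atTop (𝓝 (X' t x)) := by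
    intro t ht x
    have h1 : HasDerivAt (fun r => X r x) (X' t x) t :=
      (hX' t ⟨ht.1.le, by linarith [ht.2]⟩ x).hasDerivAt
        (Icc_mem_nhds ht.1 (ht.2.trans hsT))
    have h2 := h1.tendsto_slope_zero
    refine h2.comp (tendsto_nhdsWithin_iff.2 ⟨hhlim, Eventually.of_forall fun k => (hhpos k).ne'⟩)
  have hDcont : ∀ k, ∀ t ∈ Ioo 0 s, ContDiff ℝ 1 (D k t) ∧ HasCompactSupport (D k t) := by
    intro k t ht
    obtain ⟨h1, h2⟩ := hmem k t ht
    refine ⟨((hX _ h2).sub (hX _ h1)).const_smul _, ?_⟩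
    exact ((hXc _ h2).sub (hXc _ h1)).smul_left (f := fun _ => (h k)⁻¹)
  -- The difference quotients of the divergence need not converge, but Gauss–Green replaces them by
  -- those of `X` itself, which are bounded and converge to `X'`.
  have hDdiv : ∀ k, ∀ t ∈ Ioo 0 s, ∫ x in A t, (h k)⁻¹ * (ζ (t + h k) x - ζ t x) =
      - ∫ x, ⟪D k t x, measureNormal (A t) x⟫_ℝ ∂(perimeterMeasure (A t)) := by
    intro k t ht
    obtain ⟨h1, h2⟩ := hmem k t ht
    rw [← (hgrad t ⟨ht.1.le, by linarith [ht.2]⟩).integral_div _ (hDcont k t ht).1 (hDcont k t ht).2]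
    congr 1
    ext x
    have hd1 := (hX _ h1).differentiable one_ne_zero x
    have hd2 := (hX _ h2).differentiable one_ne_zero x
    rw [← hXζ _ h1, ← hXζ _ h2]
    have : fderiv ℝ (D k t) x = (h k)⁻¹ • (fderiv ℝ (X (t + h k)) x - fderiv ℝ (X t) x) := by
      exact ((hd2.hasFDerivAt.sub hd1.hasFDerivAt).const_smul ((h k)⁻¹)).fderiv
    simp only [vdiv, this]
    simp [Finset.mul_sum, mul_sub]
  have hDint : ∀ t ∈ Ioo 0 s, Tendsto (fun k => ∫ x, ⟪D k t x, measureNormal (A t) x⟫_ℝ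
      ∂(perimeterMeasure (A t))) atTop
      (𝓝 (∫ x, ⟪X' t x, measureNormal (A t) x⟫_ℝ ∂(perimeterMeasure (A t)))) := by
    intro t ht
    have hg := hgrad t ⟨ht.1.le, by linarith [ht.2]⟩
    have := hg.finite
    refine tendsto_integral_of_dominated_convergence (fun _ => C) (fun k =>
      ((hDcont k t ht).1.continuous.measurable.inner hg.measurable_normal).aestronglyMeasurable)
      (integrable_const C) (fun k => ?_)
      (ae_of_all _ fun x => (hDlim t ht x).inner tendsto_const_nhds)
    filter_upwards [hg.norm_normal] with x hx
    refine (norm_inner_le_norm _ _).trans ?_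
    rw [hx, mul_one]
    exact hDb k t ht x
  have hDabs : ∀ k, ∀ t ∈ Ioo 0 s, ‖∫ x, ⟪D k t x, measureNormal (A t) x⟫_ℝ
      ∂(perimeterMeasure (A t))‖ ≤ C * (perimeterMeasure (A t)).real univ := by
    intro k t ht
    have hg := hgrad t ⟨ht.1.le, by linarith [ht.2]⟩
    have := hg.finite
    refine norm_integral_le_of_norm_le_const ?_
    filter_upwards [hg.norm_normal] with x hx
    refine (norm_inner_le_norm _ _).trans ?_
    rw [hx, mul_one]
    exact hDb k t ht x
  have hsub : Ioo 0 s ⊆ Ioo 0 S := Ioo_subset_Ioo_right (by linarith)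
  have hbound : IntegrableOn (fun t => C * (perimeterMeasure (A t)).real univ) (Ioo 0 s) :=
    (hκ.integrable_real_measure.mono_set hsub).const_mul C
  have hDI : ∀ k, IntegrableOn (fun t => ∫ x, ⟪D k t x, measureNormal (A t) x⟫_ℝ
      ∂(perimeterMeasure (A t))) (Ioo 0 s) := by
    intro k
    refine ((hT k).1.neg).congr_fun (fun t ht => ?_) measurableSet_Ioo
    simp only [Pi.neg_apply]
    rw [hDdiv k t ht, neg_neg]
  have hXI : IntegrableOn (fun t => ∫ x, ⟪X' t x, measureNormal (A t) x⟫_ℝ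
      ∂(perimeterMeasure (A t))) (Ioo 0 s) := by
    refine Integrable.mono' hbound (aestronglyMeasurable_of_tendsto_ae atTop
      (fun k => (hDI k).aestronglyMeasurable)
      ((ae_restrict_iff' measurableSet_Ioo).2 (ae_of_all _ hDint))) ?_
    refine (ae_restrict_iff' measurableSet_Ioo).2 (ae_of_all _ fun t ht => ?_)
    exact le_of_tendsto' (hDint t ht).norm fun k => hDabs k t ht
  refine ⟨hXI, ?_⟩
  have hlim1 : Tendsto (fun k => ∫ t in Ioo 0 s, ∫ x in A t, (h k)⁻¹ * (ζ (t + h k) x - ζ t x)) atTop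
      (𝓝 (- ∫ t in Ioo 0 s, ∫ x, ⟪X' t x, measureNormal (A t) x⟫_ℝ ∂(perimeterMeasure (A t)))) := by
    have h1 := tendsto_integral_of_dominated_convergence _
      (fun k => (hDI k).aestronglyMeasurable) hbound
      (fun k => (ae_restrict_iff' measurableSet_Ioo).2 (ae_of_all _ fun t ht => hDabs k t ht))
      ((ae_restrict_iff' measurableSet_Ioo).2 (ae_of_all _ hDint))
    refine h1.neg.congr fun k => ?_
    rw [← integral_neg]
    exact setIntegral_congr_fun measurableSet_Ioo fun t ht => (hDdiv k t ht).symm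
  have hlimA : ∀ t ∈ Icc 0 S, Tendsto (fun k => ∫ x in A t, Z (h k) t x) atTop
      (𝓝 (∫ x in A t, ζ t x)) := by
    intro t ht
    have : IsFiniteMeasure ((volume : Measure (E N)).restrict (A t)) :=
      ⟨by rw [Measure.restrict_apply_univ]; exact (hA t ht).volume_lt_top⟩
    refine tendsto_integral_of_dominated_convergence (fun _ => C) (fun k => ?_)
      (integrable_const C) (fun k => ae_of_all _ fun x => hZb _ _ _)
      (ae_of_all _ fun x => hZlim t x)
    exact (hZc.comp (by fun_prop : Continuous fun x : E N => (h k, t, x))).aestronglyMeasurable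
  have hlimV : Tendsto (fun k => ∫ p in Iio s ×ˢ univ, V p.1 p.2 * Z (h k) p.1 p.2 ∂(spaceTime S κ))
      atTop (𝓝 (∫ p in Iio s ×ˢ univ, V p.1 p.2 * ζ p.1 p.2 ∂(spaceTime S κ))) := by
    have hVμ := hVi.restrict (s := Iio s ×ˢ univ)
    refine tendsto_integral_of_dominated_convergence (fun p => ‖V p.1 p.2‖ * C) (fun k => ?_)
      (hVμ.norm.mul_const C) (fun k => ae_of_all _ fun p => ?_)
      (ae_of_all _ fun p => (hZlim p.1 p.2).const_mul _)
    · exact hVμ.aestronglyMeasurable.mul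
        (hZc.comp (by fun_prop : Continuous fun q : ℝ × E N => (h k, q.1, q.2))).aestronglyMeasurable
    · rw [norm_mul]
      exact mul_le_mul_of_nonneg_left (hZb _ _ _) (norm_nonneg _)
  have hL := (hlimA s ⟨hs.le, by linarith⟩).sub (hlimA 0 ⟨le_rfl, by linarith⟩)
  have hR := hlim1.sub hlimV
  refine tendsto_nhds_unique hL (hR.congr fun k => ((hT k).2).symm)

end

/-! ### The dissipation estimate at a fixed time -/

/-- The pointwise form of the relative energy inequality. -/
theorem dissipation_pointwise {δ K K₂ s V d hh β sB : ℝ} {n ξ B τ : E N} {Dξ DB : E N →L[ℝ] E N}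
    (hδ : 0 < δ) (hs : δ ≤ s) (hK : 0 ≤ K) (hn : ‖n‖ = 1) (hξ : ‖ξ‖ ≤ 1)
    (hdξ : d ^ 2 ≤ K * (1 - ‖ξ‖)) (hB : ‖B‖ ≤ K) (hDB : ‖DB‖ ≤ K)
    (he1 : ‖τ + Dξ B + ContinuousLinearMap.adjoint DB ξ‖ ≤ K * d)
    (he2 : |2 * ⟪ξ, τ⟫_ℝ + 2 * ⟪ξ, Dξ B⟫_ℝ| ≤ K * d ^ 2)
    (hg : |-hh - ⟪B, ξ⟫_ℝ| ≤ K * d) (hdiv : |s * β + sB| ≤ K₂) :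
    -(s * V ^ 2) - s * ⟪τ, n⟫_ℝ - V * (s * hh) + s * V * ⟪B, n⟫_ℝ + s * (β - ⟪n, DB n⟫_ℝ) + sB +
      (⟪n, B⟫_ℝ * (s * hh) + s * ⟪n, DB ξ⟫_ℝ -
        (s * ⟪n, ξ⟫_ℝ * β + (s * ⟪n, Dξ B⟫_ℝ + sB * ⟪n, ξ⟫_ℝ))) ≤
      -(1 / 2) * (s * (V - ⟪B, n⟫_ℝ) ^ 2) +
        (3 * K ^ 2 + K ^ 3 + 3 * K + K₂ / δ) * (s * (1 - ⟪n, ξ⟫_ℝ)) := by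
  have hs0 : 0 < s := hδ.trans_le hs
  set q := 1 - ⟪n, ξ⟫_ℝ with hq
  set w := n - ξ with hw
  have hnξ : ⟪n, ξ⟫_ℝ ≤ ‖ξ‖ := by
    have := real_inner_le_norm n ξ
    rwa [hn, one_mul] at this
  have hq0 : 0 ≤ q := by rw [hq]; linarith
  -- Expanding the square and using `|ξ| ≤ 1` leaves `2 - 2 n·ξ`.
  have hw2 : ‖w‖ ^ 2 ≤ 2 * q := by
    rw [hw, norm_sub_sq_real, hn]
    nlinarith [norm_nonneg ξ]
  have hd2 : d ^ 2 ≤ K * q := hdξ.trans (mul_le_mul_of_nonneg_left (by rw [hq]; linarith) hK)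
  have hw0 := norm_nonneg w
  -- the error terms
  set e := τ + Dξ B + ContinuousLinearMap.adjoint DB ξ with he
  have hE1 : |⟪e, w⟫_ℝ| ≤ K * d * ‖w‖ :=
    (abs_real_inner_le_norm _ _).trans (mul_le_mul_of_nonneg_right he1 hw0)
  have hE1' : ⟪e, w⟫_ℝ = ⟪τ, n⟫_ℝ - ⟪ξ, τ⟫_ℝ + ⟪n, Dξ B⟫_ℝ - ⟪ξ, Dξ B⟫_ℝ + ⟪ξ, DB n⟫_ℝ - ⟪ξ, DB ξ⟫_ℝ := by
    rw [he, hw, inner_sub_right, inner_add_left, inner_add_left, inner_add_left, inner_add_left,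
      ContinuousLinearMap.adjoint_inner_left, ContinuousLinearMap.adjoint_inner_left,
      real_inner_comm n (Dξ B), real_inner_comm ξ (Dξ B), real_inner_comm ξ τ]
    ring
  have hW : |⟪w, DB w⟫_ℝ| ≤ K * ‖w‖ ^ 2 := by
    refine (abs_real_inner_le_norm _ _).trans ?_
    have h1 : ‖DB w‖ ≤ K * ‖w‖ := (DB.le_opNorm w).trans (mul_le_mul_of_nonneg_right hDB hw0)
    nlinarith
  have hW' : ⟪w, DB w⟫_ℝ = ⟪n, DB n⟫_ℝ - ⟪n, DB ξ⟫_ℝ - ⟪ξ, DB n⟫_ℝ + ⟪ξ, DB ξ⟫_ℝ := by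
    rw [hw, map_sub, inner_sub_left, inner_sub_right, inner_sub_right]
    ring
  have hBw : |⟪B, w⟫_ℝ| ≤ K * ‖w‖ :=
    (abs_real_inner_le_norm _ _).trans (mul_le_mul_of_nonneg_right hB hw0)
  have hBw' : ⟪B, w⟫_ℝ = ⟪B, n⟫_ℝ - ⟪B, ξ⟫_ℝ := by rw [hw, inner_sub_right]
  have hBn : ⟪n, B⟫_ℝ = ⟪B, n⟫_ℝ := real_inner_comm _ _
  have hξn : ⟪n, ξ⟫_ℝ = 1 - q := by rw [hq]; ring
  set g := -hh - ⟪B, ξ⟫_ℝ with hg'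
  set e2 := 2 * ⟪ξ, τ⟫_ℝ + 2 * ⟪ξ, Dξ B⟫_ℝ with he2'
  set r := ⟪B, w⟫_ℝ - g with hr
  -- By definition `r = hh + B·n`, so the product on the right is `(V - B·n)(V + hh)`. The terms
  -- with `τ`, `Dξ` and `DB` regroup into the defect `e` tested with `n - ξ`, half the defect `e2`
  -- of the length equation, and a quadratic form in `n - ξ`. Each of these is quadratically small.
  have hid : -(s * V ^ 2) - s * ⟪τ, n⟫_ℝ - V * (s * hh) + s * V * ⟪B, n⟫_ℝ +
      s * (β - ⟪n, DB n⟫_ℝ) + sB + (⟪n, B⟫_ℝ * (s * hh) + s * ⟪n, DB ξ⟫_ℝ -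
        (s * ⟪n, ξ⟫_ℝ * β + (s * ⟪n, Dξ B⟫_ℝ + sB * ⟪n, ξ⟫_ℝ))) =
      s * (-((V - ⟪B, n⟫_ℝ) * (V - ⟪B, n⟫_ℝ + r)) - ⟪e, w⟫_ℝ - e2 / 2 - ⟪w, DB w⟫_ℝ) +
        (s * β + sB) * q := by
    rw [hr, hBw', hE1', hW', he2', hg', hBn, hξn]
    ring
  rw [hid]
  have hr2 : r ^ 2 ≤ 4 * K ^ 2 * q + 2 * K ^ 3 * q := by
    have h1 : |r| ≤ K * (‖w‖ + d) := by
      rw [hr]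
      refine (abs_sub _ _).trans ?_
      linarith
    have h2 : r ^ 2 ≤ (K * (‖w‖ + d)) ^ 2 := by
      rw [← sq_abs r]
      exact pow_le_pow_left₀ (abs_nonneg _) h1 2
    have h3 : (‖w‖ + d) ^ 2 ≤ 4 * q + 2 * (K * q) := by
      have := add_sq_le (a := ‖w‖) (b := d)
      linarith
    calc r ^ 2 ≤ K ^ 2 * (‖w‖ + d) ^ 2 := by rw [← mul_pow]; exact h2
      _ ≤ K ^ 2 * (4 * q + 2 * (K * q)) := mul_le_mul_of_nonneg_left h3 (sq_nonneg K)
      _ = _ := by ring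
  generalize hx : V - ⟪B, n⟫_ℝ = x
  -- Young's inequality spends only half of the square of `x`; the other half is kept to absorb the
  -- velocity error in the bulk estimate.
  have h1 : -(x * (x + r)) ≤ -(1 / 2) * x ^ 2 + (2 * K ^ 2 + K ^ 3) * q := by
    have := sq_nonneg (x + r)
    linarith
  have h2 : -⟪e, w⟫_ℝ ≤ (K + K ^ 2 / 2) * q := by
    have h3 : d * ‖w‖ ≤ (2 * q + K * q) / 2 := by
      have := two_mul_le_add_sq d ‖w‖
      linarith
    have h4 := mul_le_mul_of_nonneg_left h3 hK
    have := neg_abs_le ⟪e, w⟫_ℝ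
    linarith
  have h3 : -(e2 / 2) ≤ K ^ 2 / 2 * q := by
    have h4 : K * d ^ 2 ≤ K * (K * q) := mul_le_mul_of_nonneg_left hd2 hK
    have := neg_abs_le e2
    linarith
  have h4 : -⟪w, DB w⟫_ℝ ≤ 2 * K * q := by
    have h5 : K * ‖w‖ ^ 2 ≤ K * (2 * q) := mul_le_mul_of_nonneg_left hw2 hK
    have := neg_abs_le ⟪w, DB w⟫_ℝ
    linarith
  have h5 : (s * β + sB) * q ≤ s * (K₂ / δ * q) := by
    have h6 : s * β + sB ≤ K₂ := (le_abs_self _).trans hdiv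
    have h7 : K₂ ≤ s * (K₂ / δ) := by
      have : 0 ≤ K₂ := (abs_nonneg _).trans hdiv
      rw [mul_div_assoc', le_div_iff₀ hδ, mul_comm s]
      exact mul_le_mul_of_nonneg_left hs this
    calc (s * β + sB) * q ≤ s * (K₂ / δ) * q := mul_le_mul_of_nonneg_right (h6.trans h7) hq0
      _ = _ := by ring
  have h6 := mul_le_mul_of_nonneg_left (add_le_add (add_le_add (add_le_add h1 h2) h3) h4) hs0.le
  linarith

theorem measurable_clm_apply {F : Type*} [NormedAddCommGroup F] [NormedSpace ℝ F]
    [FiniteDimensional ℝ F] [MeasurableSpace F] [BorelSpace F] {L : E N → E N →L[ℝ] F}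
    (hL : Continuous L) {u : E N → E N} (hu : Measurable u) : Measurable fun x => L x (u x) := by
  have h : Continuous fun p : E N × E N => L p.1 p.2 :=
    (hL.comp continuous_fst).clm_apply continuous_snd
  exact h.measurable.comp (measurable_id.prodMk hu)

theorem integrable_and_integral_combination {α : Type*} [MeasurableSpace α] {μ : Measure α}
    {f₁ f₂ f₃ f₄ f₅ f₆ f₇ : α → ℝ} (h₁ : Integrable f₁ μ) (h₂ : Integrable f₂ μ)
    (h₃ : Integrable f₃ μ) (h₄ : Integrable f₄ μ) (h₅ : Integrable f₅ μ) (h₆ : Integrable f₆ μ)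
    (h₇ : Integrable f₇ μ) :
    Integrable (fun x => -f₁ x - f₂ x - f₃ x + f₄ x + f₅ x + f₆ x + f₇ x) μ ∧
    ∫ x, (-f₁ x - f₂ x - f₃ x + f₄ x + f₅ x + f₆ x + f₇ x) ∂μ =
      -(∫ x, f₁ x ∂μ) - (∫ x, f₂ x ∂μ) - (∫ x, f₃ x ∂μ) + (∫ x, f₄ x ∂μ) + (∫ x, f₅ x ∂μ) +
        (∫ x, f₆ x ∂μ) + ∫ x, f₇ x ∂μ := by
  have i₁ : Integrable (fun x => -f₁ x) μ := h₁.neg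
  have i₂ : Integrable (fun x => -f₁ x - f₂ x) μ := i₁.sub h₂
  have i₃ : Integrable (fun x => -f₁ x - f₂ x - f₃ x) μ := i₂.sub h₃
  have i₄ : Integrable (fun x => -f₁ x - f₂ x - f₃ x + f₄ x) μ := i₃.add h₄
  have i₅ : Integrable (fun x => -f₁ x - f₂ x - f₃ x + f₄ x + f₅ x) μ := i₄.add h₅
  have i₆ : Integrable (fun x => -f₁ x - f₂ x - f₃ x + f₄ x + f₅ x + f₆ x) μ := i₅.add h₆
  refine ⟨i₆.add h₇, ?_⟩
  rw [integral_add i₆ h₇, integral_add i₅ h₆, integral_add i₄ h₅, integral_add i₃ h₄,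
    integral_sub i₂ h₃, integral_sub i₁ h₂, integral_neg]

theorem IsCalibration.timeDeriv_norm_sq {σ : E N → ℝ} {T : ℝ} {𝒜 : ℝ → Set (E N)}
    {ξ B : ℝ → E N → E N} {ϑ : ℝ → E N → ℝ} (hT : 0 < T) (h : IsCalibration σ T 𝒜 ξ B ϑ) {t : ℝ}
    (ht : t ∈ Icc 0 T) (x : E N) :
    timeDeriv T (fun s y => ‖ξ s y‖ ^ 2) t x = 2 * ⟪ξ t x, timeDeriv T ξ t x⟫_ℝ := by
  obtain ⟨g', -, -, hg'⟩ := h.regular_ξ_time.exists_timeDeriv two_ne_zero hT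
  obtain ⟨h1, h2⟩ := hg' t ht x
  rw [h2]
  exact h1.norm_sq.derivWithin (uniqueDiffOn_Icc hT t ht)

theorem IsContinuousC1c.fderiv_norm_sq {T : ℝ} {ξ : ℝ → E N → E N} (h : IsContinuousC1c T ξ)
    {t : ℝ} (ht : t ∈ Icc 0 T) (x v : E N) :
    fderiv ℝ (fun y => ‖ξ t y‖ ^ 2) x v = 2 * ⟪ξ t x, fderiv ℝ (ξ t) x v⟫_ℝ := by
  have h1 := ((h.contDiff t ht).differentiable one_ne_zero x).hasFDerivAt
  rw [h1.norm_sq.fderiv]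
  simp

/-- The Gronwall constant of the relative energy inequality. -/
def energyConst (N : ℕ) (δ K : ℝ) : ℝ :=
  3 * K ^ 2 + K ^ 3 + 3 * K + (K * (N * K) + K * K) / δ

section

variable {σ : E N → ℝ} {T : ℝ} {𝒜 : ℝ → Set (E N)} {ξ B : ℝ → E N → E N} {ϑ : ℝ → E N → ℝ} {δ K : ℝ}

theorem CalibrationBounds.energyConst_nonneg (hb : CalibrationBounds σ T 𝒜 ξ B ϑ δ K) :
    0 ≤ energyConst N δ K := by
  have h1 := hb.pos
  have h2 : 0 ≤ K := zero_le_one.trans hb.one_le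
  unfold energyConst
  positivity

theorem CalibrationBounds.abs_fderiv_le (hb : CalibrationBounds σ T 𝒜 ξ B ϑ δ K) {t : ℝ}
    (ht : t ∈ Icc 0 T) (x : E N) : |fderiv ℝ σ x (B t x)| ≤ K * K := by
  have hK : 0 ≤ K := zero_le_one.trans hb.one_le
  exact ((fderiv ℝ σ x).le_opNorm _).trans
    (mul_le_mul (hb.dσ_le x) (hb.B_le t ht x) (norm_nonneg _) hK)

theorem CalibrationBounds.abs_vdiv_B_le (hb : CalibrationBounds σ T 𝒜 ξ B ϑ δ K) {t : ℝ}
    (ht : t ∈ Icc 0 T) (x : E N) : |vdiv (B t) x| ≤ N * K :=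
  (abs_vdiv_le _ _).trans (mul_le_mul_of_nonneg_left (hb.dB_le t ht x) (Nat.cast_nonneg _))

theorem CalibrationBounds.abs_σ_mul_vdiv_le (hb : CalibrationBounds σ T 𝒜 ξ B ϑ δ K) {t : ℝ}
    (ht : t ∈ Icc 0 T) (x : E N) :
    |σ x * vdiv (B t) x + fderiv ℝ σ x (B t x)| ≤ K * (N * K) + K * K := by
  have hK : 0 ≤ K := zero_le_one.trans hb.one_le
  refine (abs_add_le _ _).trans (add_le_add ?_ (hb.abs_fderiv_le ht x))
  rw [abs_mul, abs_of_nonneg (hb.pos.le.trans (hb.σ_ge x))]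
  exact mul_le_mul (hb.σ_le x) (hb.abs_vdiv_B_le ht x) (abs_nonneg _) hK

/-- The motion law tested with `B` and the zero flux of the antisymmetric field built from `σξ` and
`B` are added to the left-hand side without changing its value. Only with these terms present does
the integrand obey the pointwise inequality. -/
theorem CalibrationBounds.dissipation_le (hb : CalibrationBounds σ T 𝒜 ξ B ϑ δ K)
    (hσ : IsSurfaceTension σ) (hT : 0 < T) (hcal : IsCalibration σ T 𝒜 ξ B ϑ) {t : ℝ}
    (ht : t ∈ Icc 0 T) {A : Set (E N)} (hA : HasFinitePerimeter A) {v : E N → ℝ} (hv : Measurable v)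
    (hv2 : Integrable (fun x => v x ^ 2) (perimeterMeasure A))
    (hmotion : ∫ x, σ x * v x * ⟪B t x, measureNormal A x⟫_ℝ ∂(perimeterMeasure A) =
      - (∫ x, σ x * (vdiv (B t) x - ⟪measureNormal A x, fderiv ℝ (B t) x (measureNormal A x)⟫_ℝ)
          ∂(perimeterMeasure A)) - ∫ x, fderiv ℝ σ x (B t x) ∂(perimeterMeasure A)) :
    -(∫ x, σ x * v x ^ 2 ∂(perimeterMeasure A)) -
      (∫ x, ⟪σ x • timeDeriv T ξ t x, measureNormal A x⟫_ℝ ∂(perimeterMeasure A)) -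
      (∫ x, v x * vdiv (fun y => σ y • ξ t y) x ∂(perimeterMeasure A)) ≤
    -(1 / 2) * (∫ x, σ x * (v x - ⟪B t x, measureNormal A x⟫_ℝ) ^ 2 ∂(perimeterMeasure A)) +
      energyConst N δ K * ∫ x, σ x * (1 - ⟪measureNormal A x, ξ t x⟫_ℝ) ∂(perimeterMeasure A) := by
  have hg := hA.isIndicatorGradient
  set μ := perimeterMeasure A
  set n := measureNormal A
  have hfin : IsFiniteMeasure μ := hg.finite
  have hn : Measurable n := hg.measurable_normal
  have hK : 0 ≤ K := zero_le_one.trans hb.one_le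
  have hσ1 := hσ.contDiff
  have hσc := hσ1.continuous
  have hσm := hσc.measurable
  have hσ0 : ∀ x, 0 < σ x := fun x => hb.pos.trans_le (hb.σ_ge x)
  have hσabs : ∀ x, ‖σ x‖ ≤ K := fun x => by rw [Real.norm_of_nonneg (hσ0 x).le]; exact hb.σ_le x
  have hB1 := hcal.regular_B.contDiff t ht
  have hξ1 := hcal.regular_ξ.contDiff t ht
  have hBm := hB1.continuous.measurable
  have hξm := hξ1.continuous.measurable
  have hdB := hB1.continuous_fderiv one_ne_zero
  have hdσ := hσ1.continuous_fderiv one_ne_zero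
  obtain ⟨g', hg'c, ⟨Cτ, hCτ⟩, hg'⟩ := hcal.regular_ξ_time.exists_timeDeriv two_ne_zero hT
  have hτ : ∀ x, timeDeriv T ξ t x = g' t x := fun x => (hg' t ht x).2
  have hτm : Measurable fun x => timeDeriv T ξ t x := by
    simp_rw [hτ]; exact (g' t).continuous.measurable
  have hτb : ∀ x, ‖timeDeriv T ξ t x‖ ≤ Cτ := fun x => by
    rw [hτ]; exact ((g' t).norm_coe_le_norm x).trans (hCτ t)
  set P : E N → E N := fun y => σ y • ξ t y with hP
  have hP1 : ContDiff ℝ 1 P := hσ1.smul hξ1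
  have hPc : HasCompactSupport P :=
    (hcal.regular_ξ.compactSupport t ht).mono fun x hx h => hx (by simp [hP, h])
  have hZc := continuous_vdiv hP1
  obtain ⟨CZ, hCZ⟩ := (hasCompactSupport_vdiv hPc).exists_bound_of_continuous hZc
  obtain ⟨CP, hCP⟩ := hPc.exists_bound_of_continuous hP1.continuous
  have hdP := hP1.continuous_fderiv one_ne_zero
  obtain ⟨CD, hCD⟩ := (hPc.fderiv ℝ).exists_bound_of_continuous hdP
  have hvi : Integrable v μ :=
    ((memLp_two_iff_integrable_sq hv.aestronglyMeasurable).2 hv2).integrable one_le_two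
  have hbdd : ∀ (f : E N → ℝ) (c : ℝ), Measurable f → (∀ᵐ x ∂μ, ‖f x‖ ≤ c) → Integrable f μ :=
    fun f c hf hc => Integrable.mono' (integrable_const c) hf.aestronglyMeasurable hc
  have hin : ∀ u : E N → E N, Measurable u → Measurable fun x => ⟪u x, n x⟫_ℝ := fun u hu =>
    hu.inner hn
  have hin' : ∀ u : E N → E N, Measurable u → Measurable fun x => ⟪n x, u x⟫_ℝ := fun u hu =>
    hn.inner hu
  have hinb : ∀ (u : E N) (x : E N) (c : ℝ), ‖n x‖ = 1 → ‖u‖ ≤ c → ‖⟪n x, u⟫_ℝ‖ ≤ c := by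
    intro u x c hx hu
    refine (norm_inner_le_norm _ _).trans ?_
    rwa [hx, one_mul]
  have i1 : Integrable (fun x => σ x * v x ^ 2) μ :=
    hv2.bdd_mul hσm.aestronglyMeasurable (c := K) (ae_of_all _ hσabs)
  have i2 : Integrable (fun x => ⟪σ x • timeDeriv T ξ t x, n x⟫_ℝ) μ := by
    refine hg.integrable_inner (hσm.smul hτm) (C := K * Cτ) fun x => ?_
    rw [norm_smul]
    exact mul_le_mul (hσabs x) (hτb x) (norm_nonneg _) hK
  have i3 : Integrable (fun x => v x * vdiv P x) μ :=
    hvi.mul_bdd hZc.measurable.aestronglyMeasurable (c := CZ) (ae_of_all _ hCZ)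
  have hBn : ∀ᵐ x ∂μ, ‖⟪B t x, n x⟫_ℝ‖ ≤ K := by
    filter_upwards [hg.norm_normal] with x hx
    rw [real_inner_comm]
    exact hinb _ x _ hx (hb.B_le t ht x)
  have i4 : Integrable (fun x => σ x * v x * ⟪B t x, n x⟫_ℝ) μ :=
    (hvi.bdd_mul hσm.aestronglyMeasurable (c := K) (ae_of_all _ hσabs)).mul_bdd
      (hin _ hBm).aestronglyMeasurable hBn
  have i5 : Integrable (fun x => σ x * (vdiv (B t) x - ⟪n x, fderiv ℝ (B t) x (n x)⟫_ℝ)) μ := by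
    refine hbdd _ (K * (N * K + K)) (hσm.mul ((continuous_vdiv hB1).measurable.sub
      (hin' _ (measurable_clm_apply hdB hn)))) ?_
    filter_upwards [hg.norm_normal] with x hx
    rw [norm_mul]
    refine mul_le_mul (hσabs x) ((norm_sub_le _ _).trans (add_le_add (hb.abs_vdiv_B_le ht x) ?_))
      (norm_nonneg _) hK
    refine hinb _ x _ hx (((fderiv ℝ (B t) x).le_opNorm _).trans ?_)
    rw [hx, mul_one]
    exact hb.dB_le t ht x
  have i6 : Integrable (fun x => fderiv ℝ σ x (B t x)) μ :=
    hbdd _ (K * K) (measurable_clm_apply hdσ hBm) (ae_of_all _ fun x => hb.abs_fderiv_le ht x)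
  have i7 : Integrable (fun x => ⟪n x, B t x⟫_ℝ * vdiv P x + ⟪n x, fderiv ℝ (B t) x (P x)⟫_ℝ -
      (⟪n x, P x⟫_ℝ * vdiv (B t) x + ⟪n x, fderiv ℝ P x (B t x)⟫_ℝ)) μ := by
    have hPm := hP1.continuous.measurable
    have hCP0 : 0 ≤ CP := (norm_nonneg _).trans (hCP 0)
    have hCD0 : 0 ≤ CD := (norm_nonneg _).trans (hCD 0)
    refine ((hbdd _ (K * CZ) ((hin' _ hBm).mul hZc.measurable) ?_).add
      (hbdd _ (K * CP) (hin' _ (measurable_clm_apply hdB hPm)) ?_)).sub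
      ((hbdd _ (CP * (N * K)) ((hin' _ hPm).mul (continuous_vdiv hB1).measurable) ?_).add
      (hbdd _ (CD * K) (hin' _ (measurable_clm_apply hdP hBm)) ?_))
    · filter_upwards [hg.norm_normal] with x hx
      rw [Pi.mul_apply, norm_mul]
      exact mul_le_mul (hinb _ x _ hx (hb.B_le t ht x)) (hCZ x) (norm_nonneg _) hK
    · filter_upwards [hg.norm_normal] with x hx
      exact hinb _ x _ hx (((fderiv ℝ (B t) x).le_opNorm _).trans
        (mul_le_mul (hb.dB_le t ht x) (hCP x) (norm_nonneg _) hK))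
    · filter_upwards [hg.norm_normal] with x hx
      rw [Pi.mul_apply, norm_mul]
      exact mul_le_mul (hinb _ x _ hx (hCP x)) (hb.abs_vdiv_B_le ht x) (norm_nonneg _) hCP0
    · filter_upwards [hg.norm_normal] with x hx
      exact hinb _ x _ hx (((fderiv ℝ P x).le_opNorm _).trans
        (mul_le_mul (hCD x) (hb.B_le t ht x) (norm_nonneg _) hCD0))
  have j1 : Integrable (fun x => σ x * (v x - ⟪B t x, n x⟫_ℝ) ^ 2) μ := by
    have hvL := (memLp_two_iff_integrable_sq hv.aestronglyMeasurable).2 hv2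
    have hBL : MemLp (fun x => ⟪B t x, n x⟫_ℝ) 2 μ :=
      MemLp.of_bound (hin _ hBm).aestronglyMeasurable K hBn
    exact (hvL.sub hBL).integrable_sq.bdd_mul hσm.aestronglyMeasurable (c := K)
      (ae_of_all _ hσabs)
  have j2 : Integrable (fun x => σ x * (1 - ⟪n x, ξ t x⟫_ℝ)) μ := by
    refine hbdd _ (K * (1 + 1)) (hσm.mul (measurable_const.sub (hin' _ hξm))) ?_
    filter_upwards [hg.norm_normal] with x hx
    rw [norm_mul]
    refine mul_le_mul (hσabs x) ((norm_sub_le _ _).trans (add_le_add (by simp) ?_))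
      (norm_nonneg _) hK
    exact hinb _ x _ hx (hb.ξ_le t ht x)
  have hcurl := hg.integral_antisymm hP1 hB1 hPc
  obtain ⟨hint, hsum⟩ := integrable_and_integral_combination i1 i2 i3 i4 i5 i6 i7
  have hle : ∫ x, (-(σ x * v x ^ 2) - ⟪σ x • timeDeriv T ξ t x, n x⟫_ℝ -
        v x * vdiv P x + σ x * v x * ⟪B t x, n x⟫_ℝ +
        σ x * (vdiv (B t) x - ⟪n x, fderiv ℝ (B t) x (n x)⟫_ℝ) + fderiv ℝ σ x (B t x) +
        (⟪n x, B t x⟫_ℝ * vdiv P x + ⟪n x, fderiv ℝ (B t) x (P x)⟫_ℝ -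
      (⟪n x, P x⟫_ℝ * vdiv (B t) x + ⟪n x, fderiv ℝ P x (B t x)⟫_ℝ))) ∂μ ≤
      ∫ x, (-(1 / 2) * (σ x * (v x - ⟪B t x, n x⟫_ℝ) ^ 2) +
        energyConst N δ K * (σ x * (1 - ⟪n x, ξ t x⟫_ℝ))) ∂μ := by
    refine integral_mono_ae hint ((j1.const_mul _).add (j2.const_mul _)) ?_
    filter_upwards [hg.norm_normal] with x hx
    have hσd := hσ1.differentiable one_ne_zero x
    have hξd := hξ1.differentiable one_ne_zero x
    have hlog : fderiv ℝ (fun y => Real.log (σ y)) x (ξ t x) = (σ x)⁻¹ * fderiv ℝ σ x (ξ t x) := by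
      rw [fderiv.log hσd (hσ0 x).ne']
      simp
    -- Factoring out `σ` exhibits the quantity that the geometric equation identifies with `-B·ξ` up
    -- to an error of the order of the distance.
    have hZ : vdiv P x = σ x * (vdiv (ξ t) x + fderiv ℝ (fun y => Real.log (σ y)) x (ξ t x)) := by
      rw [hP, vdiv_smul hσd hξd, hlog, mul_add, mul_inv_cancel_left₀ (hσ0 x).ne']
    have hDP : fderiv ℝ P x (B t x) = σ x • fderiv ℝ (ξ t) x (B t x) + fderiv ℝ σ x (B t x) • ξ t x := by
      rw [hP, fderiv_fun_smul hσd hξd]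
      simp
    have he2 := hb.evolution_ξ_sq t ht x
    rw [hcal.timeDeriv_norm_sq hT ht, hcal.regular_ξ.fderiv_norm_sq ht] at he2
    have hgeo := hb.geometric t ht x
    rw [show -vdiv (ξ t) x - fderiv ℝ (fun y => Real.log (σ y)) x (ξ t x) - ⟪B t x, ξ t x⟫_ℝ =
      -(vdiv (ξ t) x + fderiv ℝ (fun y => Real.log (σ y)) x (ξ t x)) - ⟪B t x, ξ t x⟫_ℝ by ring] at hgeo
    have key := dissipation_pointwise (V := v x) (n := n x) hb.pos (hb.σ_ge x) hK hx (hb.ξ_le t ht x)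
      (hb.dist_sq_le t ht x) (hb.B_le t ht x) (hb.dB_le t ht x) (hb.evolution_ξ t ht x) he2 hgeo
      (hb.abs_σ_mul_vdiv_le ht x)
    rw [hZ, hDP]
    simp only [hP, map_smul, inner_smul_left, inner_smul_right, inner_add_right, RCLike.conj_to_real]
    exact key
  rw [hsum, hcurl, hmotion, integral_add (j1.const_mul _) (j2.const_mul _), integral_const_mul,
    integral_const_mul] at hle
  linarith

end

/-! ### The relative energy inequality -/

/-- A BV solution with a fixed velocity `V` and measurable version `κ` of the perimeter measures. -/
structure IsBVFlow (σ : E N → ℝ) (S : ℝ) (A : ℝ → Set (E N)) (V : ℝ → E N → ℝ)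
    (κ : Kernel ℝ (E N)) : Prop where
  finitePerimeter : ∀ t ∈ Icc 0 S, HasFinitePerimeter (A t)
  velocity : IsBVNormalVelocity σ S A V
  motionLaw : MotionLaw σ S A V
  dissipation : OptimalDissipation σ S A V
  kernel : IsPerimeterKernel S A κ

theorem IsBVSolution.exists_isBVFlow {σ : E N → ℝ} {δ K S : ℝ} (hδ : 0 < δ) (hσδ : ∀ x, δ ≤ σ x)
    (hσK : ∀ x, σ x ≤ K) (hS : 0 < S) {A : ℝ → Set (E N)} (h : IsBVSolution σ S A) :
    ∃ V κ, IsFiniteKernel κ ∧ IsBVFlow σ S A V κ := by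
  obtain ⟨V, h1, h2, h3⟩ := h.exists_velocity
  obtain ⟨κ, hκ, hκ'⟩ := exists_perimeterKernel hδ hσδ hσK (h.finitePerimeter 0 ⟨le_rfl, hS.le⟩)
    h.aemeasurable_perimeter h3
  exact ⟨V, κ, hκ, ⟨h.finitePerimeter, h1, h2, h3, hκ'⟩⟩

/-- The real-valued relative energy. -/
def realRelativeEnergy (σ : E N → ℝ) (ξ : E N → E N) (A : Set (E N)) : ℝ :=
  ∫ x, σ x * (1 - ⟪measureNormal A x, ξ x⟫_ℝ) ∂(perimeterMeasure A)

/-- The density in time of the right-hand side of the relative energy inequality. -/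
def dissipationRate (σ : E N → ℝ) (T : ℝ) (ξ : ℝ → E N → E N) (A : ℝ → Set (E N))
    (V : ℝ → E N → ℝ) (t : ℝ) : ℝ :=
  -(∫ x, σ x * V t x ^ 2 ∂(perimeterMeasure (A t))) -
    (∫ x, ⟪σ x • timeDeriv T ξ t x, measureNormal (A t) x⟫_ℝ ∂(perimeterMeasure (A t))) -
    (∫ x, V t x * vdiv (fun y => σ y • ξ t y) x ∂(perimeterMeasure (A t)))

/-- The squared deviation of the normal velocity from that of the calibrated flow. -/
def velocityError (σ : E N → ℝ) (B : ℝ → E N → E N) (A : ℝ → Set (E N)) (V : ℝ → E N → ℝ)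
    (t : ℝ) : ℝ :=
  ∫ x, σ x * (V t x - ⟪B t x, measureNormal (A t) x⟫_ℝ) ^ 2 ∂(perimeterMeasure (A t))

section

variable {σ : E N → ℝ} {T : ℝ} {𝒜 : ℝ → Set (E N)} {ξ B : ℝ → E N → E N} {ϑ : ℝ → E N → ℝ} {δ K : ℝ}

theorem CalibrationBounds.abs_σ_le (hb : CalibrationBounds σ T 𝒜 ξ B ϑ δ K) (x : E N) :
    ‖σ x‖ ≤ K := by
  rw [Real.norm_of_nonneg (hb.pos.le.trans (hb.σ_ge x))]
  exact hb.σ_le x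

/-- The integrand is nonnegative and bounded, since `|ξ| ≤ 1` and `|n| = 1`, so the extended and
real integrals agree. Gauss–Green for `σξ` turns the part linear in `n` into a volume integral,
which the transport equation can differentiate. -/
theorem CalibrationBounds.relativeEnergy_eq (hb : CalibrationBounds σ T 𝒜 ξ B ϑ δ K)
    (hσ : IsSurfaceTension σ) (hcal : IsCalibration σ T 𝒜 ξ B ϑ) {t : ℝ} (ht : t ∈ Icc 0 T)
    {A : Set (E N)} (hA : HasFinitePerimeter A) :
    0 ≤ realRelativeEnergy σ (ξ t) A ∧
    relativeEnergy σ (ξ t) A = ENNReal.ofReal (realRelativeEnergy σ (ξ t) A) ∧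
    realRelativeEnergy σ (ξ t) A = (∫ x, σ x ∂(perimeterMeasure A)) +
      ∫ x in A, vdiv (fun y => σ y • ξ t y) x := by
  have hg := hA.isIndicatorGradient
  have hfin := hg.finite
  have hK : 0 ≤ K := zero_le_one.trans hb.one_le
  have hξ1 := hcal.regular_ξ.contDiff t ht
  have hX1 : ContDiff ℝ 1 (fun y => σ y • ξ t y) := hσ.contDiff.smul hξ1
  have hXc : HasCompactSupport (fun y => σ y • ξ t y) :=
    (hcal.regular_ξ.compactSupport t ht).mono fun x hx h => hx (by simp [h])
  have hσi : Integrable σ (perimeterMeasure A) := Integrable.mono' (integrable_const K)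
    hσ.contDiff.continuous.aestronglyMeasurable (ae_of_all _ hb.abs_σ_le)
  have hXi : Integrable (fun x => ⟪σ x • ξ t x, measureNormal A x⟫_ℝ) (perimeterMeasure A) := by
    refine hg.integrable_inner hX1.continuous.measurable (C := K * 1) fun x => ?_
    rw [norm_smul]
    exact mul_le_mul (hb.abs_σ_le x) (hb.ξ_le t ht x) (norm_nonneg _) hK
  have heq : (fun x => σ x * (1 - ⟪measureNormal A x, ξ t x⟫_ℝ)) =
      fun x => σ x - ⟪σ x • ξ t x, measureNormal A x⟫_ℝ := by
    ext x
    rw [real_inner_smul_left, real_inner_comm]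
    ring
  have hnn : ∀ᵐ x ∂(perimeterMeasure A), 0 ≤ σ x * (1 - ⟪measureNormal A x, ξ t x⟫_ℝ) := by
    filter_upwards [hg.norm_normal] with x hx
    refine mul_nonneg (hb.pos.le.trans (hb.σ_ge x)) ?_
    have := real_inner_le_norm (measureNormal A x) (ξ t x)
    rw [hx, one_mul] at this
    linarith [hb.ξ_le t ht x]
  refine ⟨integral_nonneg_of_ae hnn, ?_, ?_⟩
  · rw [relativeEnergy, realRelativeEnergy, ofReal_integral_eq_lintegral_ofReal _ hnn]
    rw [heq]
    exact hσi.sub hXi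
  · rw [realRelativeEnergy, heq, integral_sub hσi hXi, hg.integral_div _ hX1 hXc]
    ring

theorem CalibrationBounds.weightedPerimeter_eq (hb : CalibrationBounds σ T 𝒜 ξ B ϑ δ K)
    (hσ : IsSurfaceTension σ) {A : Set (E N)} (hA : HasFinitePerimeter A) :
    weightedPerimeter σ A = ENNReal.ofReal (∫ x, σ x ∂(perimeterMeasure A)) := by
  have hfin := hA.isIndicatorGradient.finite
  rw [weightedPerimeter, ofReal_integral_eq_lintegral_ofReal]
  · exact Integrable.mono' (integrable_const K) hσ.contDiff.continuous.aestronglyMeasurable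
      (ae_of_all _ hb.abs_σ_le)
  · exact ae_of_all _ fun x => hb.pos.le.trans (hb.σ_ge x)

/-- The product rule expresses `div(σξ)` through `ξ` and its spatial derivative alone. Both extend
to bounded continuous curves in `C_b` defined for all times, which the Steklov averages require. -/
theorem IsCalibration.exists_divergence_extension (hT : 0 < T) (hσ : IsSurfaceTension σ)
    (hb : CalibrationBounds σ T 𝒜 ξ B ϑ δ K) (h : IsCalibration σ T 𝒜 ξ B ϑ) :
    ∃ (ζ : ℝ → E N → ℝ) (C : ℝ), Continuous (Function.uncurry ζ) ∧ (∀ t x, ‖ζ t x‖ ≤ C) ∧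
      ∀ t ∈ Icc 0 T, ∀ x, vdiv (fun y => σ y • ξ t y) x = ζ t x := by
  obtain ⟨g, hg, ⟨C1, hC1⟩, hgξ⟩ := h.regular_ξ.continuous.exists_extension hT.le
  obtain ⟨G, hG, ⟨C2, hC2⟩, hGξ⟩ := h.regular_ξ.continuous_fderiv.exists_extension hT.le
  have hK : 0 ≤ K := zero_le_one.trans hb.one_le
  have hdσ := hσ.contDiff.continuous_fderiv one_ne_zero
  have hgc : Continuous fun p : ℝ × E N => g p.1 p.2 :=
    (hg.comp continuous_fst).eval continuous_snd
  have hGc : Continuous fun p : ℝ × E N => G p.1 p.2 :=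
    (hG.comp continuous_fst).eval continuous_snd
  refine ⟨fun t x => σ x * ∑ i : Fin N, (G t x (EuclideanSpace.single i 1)) i +
    fderiv ℝ σ x (g t x), K * (N * C2) + K * C1, ?_, fun t x => ?_, fun t ht x => ?_⟩
  · refine ((hσ.contDiff.continuous.comp continuous_snd).mul ?_).add
      ((hdσ.comp continuous_snd).clm_apply hgc)
    refine continuous_finsetSum _ fun i _ => ?_
    have := hGc.clm_apply (continuous_const (y := (EuclideanSpace.single i 1 : E N)))
    fun_prop
  · refine (norm_add_le _ _).trans (add_le_add ?_ ?_)
    · rw [norm_mul]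
      refine mul_le_mul (hb.abs_σ_le x) ((norm_sum_le _ _).trans ?_) (norm_nonneg _) hK
      have : ∀ i ∈ (Finset.univ : Finset (Fin N)),
          ‖(G t x (EuclideanSpace.single i 1)) i‖ ≤ C2 := by
        intro i _
        refine (PiLp.norm_apply_le (p := 2) (G t x (EuclideanSpace.single i 1)) i).trans ?_
        refine ((G t x).le_opNorm _).trans ?_
        simpa using ((G t).norm_coe_le_norm x).trans (hC2 t)
      simpa using Finset.sum_le_sum this
    · exact ((fderiv ℝ σ x).le_opNorm _).trans (mul_le_mul (hb.dσ_le x)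
        (((g t).norm_coe_le_norm x).trans (hC1 t)) (norm_nonneg _) hK)
  · rw [vdiv_smul (hσ.contDiff.differentiable one_ne_zero x)
      ((h.regular_ξ.contDiff t ht).differentiable one_ne_zero x)]
    simp only [hGξ t ht, hgξ t ht]
    rfl

variable {S : ℝ} {A : ℝ → Set (E N)} {V : ℝ → E N → ℝ} {κ : Kernel ℝ (E N)} [IsFiniteKernel κ]

theorem IsBVFlow.integrable_sq (hb : CalibrationBounds σ T 𝒜 ξ B ϑ δ K) (hσ : IsSurfaceTension σ)
    (h : IsBVFlow σ S A V κ) :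
    Integrable (fun p : ℝ × E N => V p.1 p.2 ^ 2) (spaceTime S κ) :=
  (h.velocity.memLp_two hb.pos hσ.contDiff.continuous hb.σ_ge h.kernel).integrable_sq

theorem IsBVFlow.integrable_velocity (hb : CalibrationBounds σ T 𝒜 ξ B ϑ δ K)
    (hσ : IsSurfaceTension σ) (h : IsBVFlow σ S A V κ) :
    Integrable (fun p : ℝ × E N => V p.1 p.2) (spaceTime S κ) :=
  (h.velocity.memLp_two hb.pos hσ.contDiff.continuous hb.σ_ge h.kernel).integrable one_le_two

/-- The estimate of the dissipation rate at almost every time. -/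
theorem IsBVFlow.ae_dissipationRate_le (hb : CalibrationBounds σ T 𝒜 ξ B ϑ δ K)
    (hσ : IsSurfaceTension σ) (hT : 0 < T) (hcal : IsCalibration σ T 𝒜 ξ B ϑ) (hTS : T ≤ S)
    (h : IsBVFlow σ S A V κ) : ∀ᵐ t ∂(volume.restrict (Ioo 0 T)),
      Integrable (fun x => V t x ^ 2) (perimeterMeasure (A t)) ∧
      dissipationRate σ T ξ A V t ≤ -(1 / 2) * velocityError σ B A V t +
        energyConst N δ K * realRelativeEnergy σ (ξ t) (A t) := by
  have hsub : Ioo 0 T ⊆ Ioo 0 S := Ioo_subset_Ioo_right hTS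
  filter_upwards [ae_restrict_of_ae_restrict_of_subset hsub h.motionLaw,
    ae_restrict_of_ae_restrict_of_subset hsub (h.kernel.ae_integrable (h.integrable_sq hb hσ)),
    ae_restrict_mem measurableSet_Ioo] with t h1 h2 ht
  have htI : t ∈ Icc 0 T := ⟨ht.1.le, ht.2.le⟩
  refine ⟨h2, ?_⟩
  exact hb.dissipation_le hσ hT hcal htI (h.finitePerimeter t ⟨ht.1.le, ht.2.le.trans hTS⟩)
    h.velocity.measurable.of_uncurry_left h2
    (h1 (B t) (hcal.regular_B.contDiff t htI) (hcal.regular_B.compactSupport t htI))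

/-- The relative energy is the weighted perimeter plus the volume integral of `div(σξ)`. Optimal
dissipation estimates the first summand, and transport tested with the field `σξ` computes the
change of the second exactly. -/
theorem IsBVFlow.ae_energy_le (hb : CalibrationBounds σ T 𝒜 ξ B ϑ δ K) (hσ : IsSurfaceTension σ)
    (hT : 0 < T) (hcal : IsCalibration σ T 𝒜 ξ B ϑ) (hTS : T ≤ S) (h : IsBVFlow σ S A V κ) :
    ∀ᵐ s ∂(volume.restrict (Ioo 0 T)), IntegrableOn (dissipationRate σ T ξ A V) (Ioo 0 s) ∧
      realRelativeEnergy σ (ξ s) (A s) ≤ realRelativeEnergy σ (ξ 0) (A 0) +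
        ∫ t in Ioo 0 s, dissipationRate σ T ξ A V t := by
  have hsub : Ioo 0 T ⊆ Ioo 0 S := Ioo_subset_Ioo_right hTS
  have hS : 0 < S := hT.trans_le hTS
  have hK : 0 ≤ K := zero_le_one.trans hb.one_le
  obtain ⟨ζ, C, hζ, hζC, hζv⟩ := hcal.exists_divergence_extension hT hσ hb
  obtain ⟨g', hg'c, ⟨Cτ, hCτ⟩, hg'⟩ := hcal.regular_ξ_time.exists_timeDeriv two_ne_zero hT
  have hVi := h.integrable_velocity hb hσ
  have htr := h.velocity.ae_transportsTo h.finitePerimeter hS h.kernel hVi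
  have hsq := h.velocity.integrable_mul_sq hb.pos hσ.contDiff.continuous hb.σ_ge h.kernel
  have hVζ : Integrable (fun p : ℝ × E N => V p.1 p.2 * ζ p.1 p.2) (spaceTime S κ) :=
    hVi.mul_bdd hζ.aestronglyMeasurable (c := C) (ae_of_all _ fun p => hζC _ _)
  filter_upwards [ae_restrict_of_ae_restrict_of_subset hsub htr,
    ae_restrict_of_ae_restrict_of_subset hsub h.dissipation,
    ae_restrict_mem measurableSet_Ioo] with s h1 h2 hs
  have hsT : s ∈ Icc 0 T := ⟨hs.1.le, hs.2.le⟩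
  have h0T : (0 : ℝ) ∈ Icc 0 T := ⟨le_rfl, hT.le⟩
  have hsS : s ≤ S := hs.2.le.trans hTS
  have hAs := h.finitePerimeter s ⟨hs.1.le, hsS⟩
  have hA0 := h.finitePerimeter 0 ⟨le_rfl, hS.le⟩
  have hssub : Ioo 0 s ⊆ Ioo 0 S := Ioo_subset_Ioo_right hsS
  obtain ⟨hI2, hX⟩ := TransportsTo.vector_field (C := max C (K * Cτ)) hs.1 hs.2 hTS
    h.finitePerimeter h.kernel h1 htr hVi (X := fun t x => σ x • ξ t x)
    (X' := fun t x => σ x • timeDeriv T ξ t x)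
    (fun t ht => hσ.contDiff.smul (hcal.regular_ξ.contDiff t ht))
    (fun t ht => (hcal.regular_ξ.compactSupport t ht).mono fun x hx h => hx (by simp [h]))
    hζv hζ (fun t x => (hζC t x).trans (le_max_left _ _))
    (fun t ht x => by
      obtain ⟨e1, e2⟩ := hg' t ht x
      rw [e2]
      exact e1.const_smul (σ x))
    (fun t ht x => by
      rw [(hg' t ht x).2, norm_smul]
      exact (mul_le_mul (hb.abs_σ_le x) (((g' t).norm_coe_le_norm x).trans (hCτ t)) (norm_nonneg _)
        hK).trans (le_max_right _ _))
  -- the dissipation term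
  have hI1 : IntegrableOn (fun t => ∫ x, σ x * V t x ^ 2 ∂(perimeterMeasure (A t))) (Ioo 0 s) :=
    (h.kernel.integrable_integral hsq).mono_set hssub
  have hI3' : IntegrableOn (fun t => ∫ x, V t x * ζ t x ∂(perimeterMeasure (A t))) (Ioo 0 s) :=
    (h.kernel.integrable_integral hVζ).mono_set hssub
  have hcongr : ∀ t ∈ Ioo 0 s, ∫ x, V t x * ζ t x ∂(perimeterMeasure (A t)) =
      ∫ x, V t x * vdiv (fun y => σ y • ξ t y) x ∂(perimeterMeasure (A t)) := by
    intro t ht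
    congr 1
    ext x
    rw [hζv t ⟨ht.1.le, ht.2.le.trans hs.2.le⟩]
  have hI3 : IntegrableOn (fun t => ∫ x, V t x * vdiv (fun y => σ y • ξ t y) x
      ∂(perimeterMeasure (A t))) (Ioo 0 s) := hI3'.congr_fun hcongr measurableSet_Ioo
  have hσ0 : ∀ x, 0 ≤ σ x := fun x => hb.pos.le.trans (hb.σ_ge x)
  have hdiss : (∫ x, σ x ∂(perimeterMeasure (A s))) +
      ∫ t in Ioo 0 s, ∫ x, σ x * V t x ^ 2 ∂(perimeterMeasure (A t)) ≤
      ∫ x, σ x ∂(perimeterMeasure (A 0)) := by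
    have e1 : ∫⁻ t in Ioo 0 s, ∫⁻ x, ENNReal.ofReal (σ x * V t x ^ 2) ∂(perimeterMeasure (A t)) =
        ENNReal.ofReal (∫ t in Ioo 0 s, ∫ x, σ x * V t x ^ 2 ∂(perimeterMeasure (A t))) := by
      rw [ofReal_integral_eq_lintegral_ofReal hI1
        (ae_of_all _ fun t => integral_nonneg fun x => mul_nonneg (hσ0 x) (sq_nonneg _))]
      refine lintegral_congr_ae ?_
      filter_upwards [ae_restrict_of_ae_restrict_of_subset hssub (h.kernel.ae_integrable hsq)]
        with t ht
      rw [ofReal_integral_eq_lintegral_ofReal ht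
        (ae_of_all _ fun x => mul_nonneg (hσ0 x) (sq_nonneg _))]
    rw [e1, hb.weightedPerimeter_eq hσ hAs, hb.weightedPerimeter_eq hσ hA0,
      ← ENNReal.ofReal_add (integral_nonneg hσ0) (integral_nonneg fun t =>
        integral_nonneg fun x => mul_nonneg (hσ0 x) (sq_nonneg _)),
      ENNReal.ofReal_le_ofReal_iff (integral_nonneg hσ0)] at h2
    exact h2
  have hDI : IntegrableOn (dissipationRate σ T ξ A V) (Ioo 0 s) := (hI1.neg.sub hI2).sub hI3
  refine ⟨hDI, ?_⟩
  have hD : ∫ t in Ioo 0 s, dissipationRate σ T ξ A V t =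
      -(∫ t in Ioo 0 s, ∫ x, σ x * V t x ^ 2 ∂(perimeterMeasure (A t))) -
      (∫ t in Ioo 0 s, ∫ x, ⟪σ x • timeDeriv T ξ t x, measureNormal (A t) x⟫_ℝ
        ∂(perimeterMeasure (A t))) -
      ∫ t in Ioo 0 s, ∫ x, V t x * ζ t x ∂(perimeterMeasure (A t)) := by
    have hneg : IntegrableOn (fun t => -∫ x, σ x * V t x ^ 2 ∂(perimeterMeasure (A t)))
      (Ioo 0 s) := hI1.neg
    have h12 : IntegrableOn (fun t => -(∫ x, σ x * V t x ^ 2 ∂(perimeterMeasure (A t))) -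
      ∫ x, ⟪σ x • timeDeriv T ξ t x, measureNormal (A t) x⟫_ℝ ∂(perimeterMeasure (A t)))
      (Ioo 0 s) := hneg.sub hI2
    unfold dissipationRate
    rw [setIntegral_congr_fun measurableSet_Ioo hcongr, integral_sub h12 hI3,
      integral_sub hneg hI2, integral_neg]
  rw [h.kernel.setIntegral_eq hVζ hsS] at hX
  have e3 := (hb.relativeEnergy_eq hσ hcal hsT hAs).2.2
  have e4 := (hb.relativeEnergy_eq hσ hcal h0T hA0).2.2
  simp_rw [hζv s hsT] at e3
  simp_rw [hζv 0 h0T] at e4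
  linarith

end

/-! ### The bulk error with a spatial cutoff -/

/-- Dilating one bump by factors at least `1` does not increase its gradient. A uniform bound is
enough: the term containing the cutoff gradient also carries the factor `ϑ` and is absorbed by the
bulk error. -/
theorem exists_cutoff_sequence (N : ℕ) : ∃ (η : ℕ → E N → ℝ) (L : ℝ), (∀ k, ContDiff ℝ 1 (η k)) ∧
    (∀ k, HasCompactSupport (η k)) ∧ (∀ k x, 0 ≤ η k x ∧ η k x ≤ 1) ∧
    (∀ k x, ‖fderiv ℝ (η k) x‖ ≤ L) ∧ ∀ x, Tendsto (fun k => η k x) atTop (𝓝 1) := by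
  let b : ContDiffBump (0 : E N) := ⟨1, 2, one_pos, one_lt_two⟩
  have hb1 : ContDiff ℝ 1 b := b.contDiff
  have hd := hb1.differentiable one_ne_zero
  obtain ⟨L, hL⟩ := (b.hasCompactSupport.fderiv ℝ).exists_bound_of_continuous
    (hb1.continuous_fderiv one_ne_zero)
  have hc : ∀ k : ℕ, 0 < ((k : ℝ) + 1)⁻¹ := fun k => by positivity
  refine ⟨fun k x => b (((k : ℝ) + 1)⁻¹ • x), L, fun k => by fun_prop, fun k => ?_,
    fun k x => ⟨b.nonneg, b.le_one⟩, fun k x => ?_, fun x => ?_⟩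
  · exact b.hasCompactSupport.comp_smul (hc k).ne'
  · have h1 : HasFDerivAt (fun x : E N => ((k : ℝ) + 1)⁻¹ • x)
        (((k : ℝ) + 1)⁻¹ • ContinuousLinearMap.id ℝ (E N)) x :=
      (((k : ℝ) + 1)⁻¹ • ContinuousLinearMap.id ℝ (E N)).hasFDerivAt
    have h2 := (hd (((k : ℝ) + 1)⁻¹ • x)).hasFDerivAt.comp x h1
    have h3 : fderiv ℝ (fun x => b (((k : ℝ) + 1)⁻¹ • x)) x =
        ((k : ℝ) + 1)⁻¹ • fderiv ℝ b (((k : ℝ) + 1)⁻¹ • x) := by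
      refine h2.fderiv.trans ?_
      ext v
      simp
    rw [h3, norm_smul, Real.norm_of_nonneg (hc k).le]
    refine (mul_le_of_le_one_left (norm_nonneg _) ?_).trans (hL _)
    exact inv_le_one_of_one_le₀ (by linarith [(Nat.cast_nonneg k : (0 : ℝ) ≤ k)])
  · have h1 : Tendsto (fun k : ℕ => b (((k : ℝ) + 1)⁻¹ • x)) atTop (𝓝 (b ((0 : ℝ) • x))) := by
      refine (hb1.continuous.tendsto _).comp (Tendsto.smul_const ?_ x)
      simpa [one_div] using tendsto_one_div_add_atTop_nhds_zero_nat (𝕜 := ℝ)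
    rwa [zero_smul, b.one_of_mem_closedBall (by simp [b])] at h1

/-- The bulk error with a cutoff. -/
def bulkCut (η σ θ : E N → ℝ) (𝒜 A : Set (E N)) : ℝ :=
  (∫ x in 𝒜, η x * σ x * θ x) - ∫ x in A, η x * σ x * θ x

/-- The time derivative of the bulk error with a cutoff. -/
def bulkRate (η σ : E N → ℝ) (T : ℝ) (𝒜 : ℝ → Set (E N)) (ϑ : ℝ → E N → ℝ) (A : ℝ → Set (E N))
    (V : ℝ → E N → ℝ) (t : ℝ) : ℝ :=
  (∫ x in 𝒜 t, η x * σ x * timeDeriv T ϑ t x) - (∫ x in A t, η x * σ x * timeDeriv T ϑ t x) +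
    ∫ x, V t x * (η x * σ x * ϑ t x) ∂(perimeterMeasure (A t))

/-- Differentiation under the integral of a positive part. -/
theorem integral_pos_part_sub {s C : ℝ} (hs : 0 ≤ s) {ζ ζ' : ℝ → E N → ℝ} {Q : Set (E N)}
    (hQ : IsCompact Q) (hζ : Continuous (Function.uncurry ζ))
    (hζ' : Continuous (Function.uncurry ζ')) (hb' : ∀ t x, ‖ζ' t x‖ ≤ C)
    (hz : ∀ t, ∀ x ∉ Q, ζ t x = 0) (hz' : ∀ t, ∀ x ∉ Q, ζ' t x = 0)
    (hd : ∀ x, ∀ t ∈ Ioo 0 s, HasDerivAt (fun r => ζ r x) (ζ' t x) t) :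
    IntegrableOn (fun t => ∫ x in {x | 0 < ζ t x}, ζ' t x) (Ioo 0 s) ∧
    (∫ x in {x | 0 < ζ s x}, ζ s x) - ∫ x in {x | 0 < ζ 0 x}, ζ 0 x =
      ∫ t in Ioo 0 s, ∫ x in {x | 0 < ζ t x}, ζ' t x := by
  have hct : ∀ t, Continuous (ζ t) := fun t => hζ.comp (by fun_prop : Continuous fun x => (t, x))
  have hms : ∀ t, MeasurableSet {x | 0 < ζ t x} := fun t =>
    measurableSet_lt measurable_const (hct t).measurable
  have hpos : ∀ t, ∫ x in {x | 0 < ζ t x}, ζ t x = ∫ x, max (ζ t x) 0 := by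
    intro t
    rw [← integral_indicator (hms t)]
    congr 1
    ext x
    by_cases h : 0 < ζ t x
    · rw [indicator_of_mem (by exact h), max_eq_left h.le]
    · rw [indicator_of_notMem (by exact h), max_eq_right (not_lt.1 h)]
  have hposI : ∀ t, Integrable fun x => max (ζ t x) 0 := fun t =>
    ((hct t).max continuous_const).integrable_of_hasCompactSupport
      (HasCompactSupport.intro hQ fun x hx => by simp [hz t x hx])
  let k : E N → ℝ → ℝ := fun x t => (Ioi (0 : ℝ)).indicator (fun _ => 1) (ζ t x) * ζ' t x
  have hkt : ∀ t, ∫ x in {x | 0 < ζ t x}, ζ' t x = ∫ x, k x t := by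
    intro t
    rw [← integral_indicator (hms t)]
    congr 1
    ext x
    by_cases h : 0 < ζ t x <;> simp [k, h, indicator]
  have hk : Integrable (Function.uncurry k) (volume.prod (volume.restrict (Ioo 0 s))) := by
    have hm : Measurable (Function.uncurry k) := by
      have h1 : Measurable fun q : E N × ℝ => ζ q.2 q.1 := (hζ.comp continuous_swap).measurable
      have h2 : Measurable fun q : E N × ℝ => ζ' q.2 q.1 := (hζ'.comp continuous_swap).measurable
      exact ((measurable_const.indicator measurableSet_Ioi).comp h1).mul h2
    have hdom : Integrable (fun q : E N × ℝ => Q.indicator (fun _ => C) q.1 * (1 : ℝ))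
        (volume.prod (volume.restrict (Ioo 0 s))) := by
      refine Integrable.mul_prod (f := Q.indicator fun _ => C) (g := fun _ : ℝ => (1 : ℝ)) ?_
        (integrable_const _)
      rw [integrable_indicator_iff hQ.measurableSet]
      exact integrableOn_const (hs := hQ.measure_lt_top.ne)
    refine hdom.mono' hm.aestronglyMeasurable (ae_of_all _ fun q => ?_)
    rw [mul_one]
    by_cases hq : q.1 ∈ Q
    · rw [indicator_of_mem hq]
      simp only [Function.uncurry, k, norm_mul]
      refine (mul_le_of_le_one_left (norm_nonneg _) ?_).trans (hb' q.2 q.1)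
      by_cases h : 0 < ζ q.2 q.1 <;> simp [h, indicator]
    · rw [indicator_of_notMem hq]
      simp [Function.uncurry, k, hz' q.2 q.1 hq]
  simp_rw [hkt]
  refine ⟨hk.integral_prod_right, ?_⟩
  rw [hpos, hpos, ← integral_sub (hposI s) (hposI 0), ← integral_integral_swap hk]
  congr 1
  ext x
  rw [← integral_Ioc_eq_integral_Ioo, ← intervalIntegral.integral_of_le hs]
  exact (integral_indicator_pos_mul_deriv hs
    (hζ.comp (by fun_prop : Continuous fun t => (t, x)))
    (hζ'.comp (by fun_prop : Continuous fun t => (t, x))) (hd x)).symm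

section

variable {σ : E N → ℝ} {T : ℝ} {𝒜 : ℝ → Set (E N)} {ξ B : ℝ → E N → E N} {ϑ : ℝ → E N → ℝ} {δ K : ℝ}

theorem IsCalibration.timeDeriv_theta (hT : 0 < T) (h : IsCalibration σ T 𝒜 ξ B ϑ) {t : ℝ}
    (ht : t ∈ Icc 0 T) (x : E N) : timeDeriv T ϑ t x =
      fderivWithin ℝ (Function.uncurry ϑ) (Icc 0 T ×ˢ univ) (t, x) (1, 0) :=
  (h.hasDerivWithinAt_theta ht x).derivWithin (uniqueDiffOn_Icc hT t ht)

theorem IsCalibration.continuous_timeDeriv_theta (hT : 0 < T) (h : IsCalibration σ T 𝒜 ξ B ϑ)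
    {t : ℝ} (ht : t ∈ Icc 0 T) : Continuous (timeDeriv T ϑ t) := by
  have h1 : timeDeriv T ϑ t = fun x =>
      fderivWithin ℝ (Function.uncurry ϑ) (Icc 0 T ×ˢ univ) (t, x) (1, 0) :=
    funext fun x => h.timeDeriv_theta hT ht x
  rw [h1]
  exact ((h.continuousOn_fderivWithin_theta hT).comp_continuous
    (by fun_prop : Continuous fun x : E N => (t, x)) fun x => ⟨ht, mem_univ _⟩).clm_apply
    continuous_const

/-- A continuous extension in time of `η σ ϑ` and of its time derivative. -/
theorem IsCalibration.exists_cutoff_theta_extension (hT : 0 < T) (hσ : IsSurfaceTension σ)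
    (h : IsCalibration σ T 𝒜 ξ B ϑ) {η : E N → ℝ} (hη : Continuous η) (hηc : HasCompactSupport η) :
    ∃ (ζ ζ' : ℝ → E N → ℝ) (C : ℝ), Continuous (Function.uncurry ζ) ∧
      Continuous (Function.uncurry ζ') ∧ (∀ t x, ‖ζ t x‖ ≤ C) ∧ (∀ t x, ‖ζ' t x‖ ≤ C) ∧
      (∀ t, ∀ x ∉ tsupport η, ζ t x = 0) ∧ (∀ t, ∀ x ∉ tsupport η, ζ' t x = 0) ∧
      (∀ t ∈ Icc 0 T, ∀ x, ζ t x = η x * σ x * ϑ t x) ∧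
      (∀ t ∈ Icc 0 T, ∀ x, ζ' t x = η x * σ x * timeDeriv T ϑ t x) ∧
      ∀ t ∈ Ioo 0 T, ∀ x, HasDerivAt (fun r => ζ r x) (ζ' t x) t := by
  let c : ℝ → ℝ := fun t => projIcc 0 T hT.le t
  have hc : Continuous c := continuous_subtype_val.comp continuous_projIcc
  have hcm : ∀ t, c t ∈ Icc 0 T := fun t => (projIcc 0 T hT.le t).2
  have hcid : ∀ t ∈ Icc 0 T, c t = t := fun t ht => by simp only [c]; rw [projIcc_of_mem hT.le ht]
  have hσc := hσ.contDiff.continuous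
  let f : ℝ × E N → ℝ := fun p => η p.2 * σ p.2 * ϑ p.1 p.2
  let f' : ℝ × E N → ℝ := fun p => η p.2 * σ p.2 *
    fderivWithin ℝ (Function.uncurry ϑ) (Icc 0 T ×ˢ univ) p (1, 0)
  have hησ : Continuous fun p : ℝ × E N => η p.2 * σ p.2 := by fun_prop
  have hf : ContinuousOn f (Icc 0 T ×ˢ univ) := hησ.continuousOn.mul h.regular_ϑ.continuousOn
  have hf' : ContinuousOn f' (Icc 0 T ×ˢ univ) :=
    hησ.continuousOn.mul ((h.continuousOn_fderivWithin_theta hT).clm_apply continuousOn_const)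
  have hQ : IsCompact (Icc 0 T ×ˢ tsupport η) := isCompact_Icc.prod hηc
  have hQs : Icc 0 T ×ˢ tsupport η ⊆ Icc 0 T ×ˢ univ := prod_mono le_rfl (subset_univ _)
  obtain ⟨C1, hC1⟩ := hQ.exists_bound_of_continuousOn (hf.mono hQs)
  obtain ⟨C2, hC2⟩ := hQ.exists_bound_of_continuousOn (hf'.mono hQs)
  have hcp : Continuous fun p : ℝ × E N => (c p.1, p.2) := by fun_prop
  have hη0 : ∀ x ∉ tsupport η, η x = 0 := fun x hx => image_eq_zero_of_notMem_tsupport hx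
  refine ⟨fun t x => f (c t, x), fun t x => f' (c t, x), max (max C1 C2) 0,
    hf.comp_continuous hcp fun p => ⟨hcm _, mem_univ _⟩,
    hf'.comp_continuous hcp fun p => ⟨hcm _, mem_univ _⟩, fun t x => ?_, fun t x => ?_,
    fun t x hx => by simp [f, hη0 x hx], fun t x hx => by simp [f', hη0 x hx],
    fun t ht x => by simp [f, hcid t ht],
    fun t ht x => by simp [f', hcid t ht, h.timeDeriv_theta hT ht], fun t ht x => ?_⟩
  · by_cases hx : x ∈ tsupport η
    · exact (hC1 (c t, x) ⟨hcm t, hx⟩).trans ((le_max_left _ _).trans (le_max_left _ _))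
    · simp [f, hη0 x hx]
  · by_cases hx : x ∈ tsupport η
    · exact (hC2 (c t, x) ⟨hcm t, hx⟩).trans ((le_max_right _ _).trans (le_max_left _ _))
    · simp [f', hη0 x hx]
  · have htI : t ∈ Icc 0 T := ⟨ht.1.le, ht.2.le⟩
    have h1 := ((h.hasDerivWithinAt_theta htI x).hasDerivAt (Icc_mem_nhds ht.1 ht.2)).const_mul
      (η x * σ x)
    simp only [f', hcid t htI]
    refine h1.congr_of_eventuallyEq ?_
    filter_upwards [Icc_mem_nhds ht.1 ht.2] with r hr
    simp only [f, hcid r hr]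

variable {S : ℝ} {A : ℝ → Set (E N)} {V : ℝ → E N → ℝ} {κ : Kernel ℝ (E N)} [IsFiniteKernel κ]

/-- For `A`, transport is tested with `ησϑ`. For the calibrated set, the integral is that of the
positive part of `ησϑ`, whose time derivative has no boundary term. The normal velocity of the
calibrated interface is thus never used directly; only `ϑ` carries its motion. -/
theorem IsBVFlow.ae_bulkCut_eq (hb : CalibrationBounds σ T 𝒜 ξ B ϑ δ K) (hσ : IsSurfaceTension σ)
    (hT : 0 < T) (hcal : IsCalibration σ T 𝒜 ξ B ϑ) (hTS : T ≤ S) (h : IsBVFlow σ S A V κ)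
    {η : E N → ℝ} (hη : Continuous η) (hηc : HasCompactSupport η) (hη0 : ∀ x, 0 ≤ η x) :
    ∀ᵐ s ∂(volume.restrict (Ioo 0 T)), IntegrableOn (bulkRate η σ T 𝒜 ϑ A V) (Ioo 0 s) ∧
      bulkCut η σ (ϑ s) (𝒜 s) (A s) = bulkCut η σ (ϑ 0) (𝒜 0) (A 0) +
        ∫ t in Ioo 0 s, bulkRate η σ T 𝒜 ϑ A V t := by
  have hsub : Ioo 0 T ⊆ Ioo 0 S := Ioo_subset_Ioo_right hTS
  have hS : 0 < S := hT.trans_le hTS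
  have hVi := h.integrable_velocity hb hσ
  have htr := h.velocity.ae_transportsTo h.finitePerimeter hS h.kernel hVi
  obtain ⟨ζ, ζ', C, hζ, hζ', hζb, hζb', hz, hz', hζe, hζe', hd⟩ :=
    hcal.exists_cutoff_theta_extension hT hσ hη hηc
  have hVζ : Integrable (fun p : ℝ × E N => V p.1 p.2 * ζ p.1 p.2) (spaceTime S κ) :=
    hVi.mul_bdd hζ.aestronglyMeasurable (c := C) (ae_of_all _ fun p => hζb _ _)
  have hσ0 : ∀ x, 0 < σ x := fun x => hb.pos.trans_le (hb.σ_ge x)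
  -- replacing `{ζ t > 0}` by `𝒜 t`
  have hset : ∀ t ∈ Icc 0 T, ∀ f : E N → ℝ, (∀ x, η x = 0 → f x = 0) →
      ∫ x in {x | 0 < ζ t x}, f x = ∫ x in 𝒜 t, f x := by
    intro t ht f hf
    have hζt : Continuous (ζ t) := hζ.comp (by fun_prop : Continuous fun x => (t, x))
    rw [← integral_indicator (measurableSet_lt measurable_const hζt.measurable),
      ← integral_indicator (hcal.isOpen t ht).measurableSet]
    congr 1
    ext x
    rcases (hη0 x).eq_or_lt with h0 | h0
    · simp [indicator, hf x h0.symm]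
    · have h1 : 0 < ζ t x ↔ x ∈ 𝒜 t := by
        rw [hζe t ht, hcal.eq_setOf_pos ht, mem_ofPred_eq,
          mul_pos_iff_of_pos_left (mul_pos h0 (hσ0 x))]
      by_cases hx : x ∈ 𝒜 t
      · rw [indicator_of_mem hx, indicator_of_mem (show x ∈ {x | 0 < ζ t x} from h1.2 hx)]
      · rw [indicator_of_notMem hx, indicator_of_notMem
          (show x ∉ {x | 0 < ζ t x} from fun h => hx (h1.1 h))]
  filter_upwards [ae_restrict_of_ae_restrict_of_subset hsub htr,
    ae_restrict_mem measurableSet_Ioo] with s h1 hs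
  have hsT : s ∈ Icc 0 T := ⟨hs.1.le, hs.2.le⟩
  have h0T : (0 : ℝ) ∈ Icc 0 T := ⟨le_rfl, hT.le⟩
  have hsS : s ≤ S := hs.2.le.trans hTS
  have hssub : Ioo 0 s ⊆ Ioo 0 S := Ioo_subset_Ioo_right hsS
  have htT : ∀ t ∈ Ioo 0 s, t ∈ Icc 0 T := fun t ht => ⟨ht.1.le, ht.2.le.trans hs.2.le⟩
  obtain ⟨hIA, hA⟩ := TransportsTo.time_dependent hs.1 hsS h1 htr hVi
    (h.finitePerimeter 0 ⟨le_rfl, hS.le⟩).volume_lt_top hζ hζ' hζb hζb'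
    (fun x t ht => hd t ⟨ht.1, ht.2.trans hs.2⟩ x)
  obtain ⟨hI𝒜, h𝒜⟩ := integral_pos_part_sub hs.1.le hηc hζ hζ' hζb' hz hz'
    (fun x t ht => hd t ⟨ht.1, ht.2.trans hs.2⟩ x)
  have hIV : IntegrableOn (fun t => ∫ x, V t x * ζ t x ∂(perimeterMeasure (A t))) (Ioo 0 s) :=
    (h.kernel.integrable_integral hVζ).mono_set hssub
  rw [h.kernel.setIntegral_eq hVζ hsS] at hA
  have hcongr : ∀ t ∈ Ioo 0 s, (∫ x in {x | 0 < ζ t x}, ζ' t x) - (∫ x in A t, ζ' t x) +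
      ∫ x, V t x * ζ t x ∂(perimeterMeasure (A t)) = bulkRate η σ T 𝒜 ϑ A V t := by
    intro t ht
    rw [hset t (htT t ht) _ fun x hx => by rw [hζe' t (htT t ht), hx, zero_mul, zero_mul]]
    simp_rw [hζe' t (htT t ht), hζe t (htT t ht)]
    rfl
  have hI12 : IntegrableOn (fun t => (∫ x in {x | 0 < ζ t x}, ζ' t x) - ∫ x in A t, ζ' t x)
    (Ioo 0 s) := hI𝒜.sub hIA
  refine ⟨(hI12.add hIV).congr_fun hcongr measurableSet_Ioo, ?_⟩
  rw [← setIntegral_congr_fun measurableSet_Ioo hcongr, integral_add hI12 hIV,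
    integral_sub hI𝒜 hIA]
  have e : ∀ t ∈ Icc 0 T, bulkCut η σ (ϑ t) (𝒜 t) (A t) =
      (∫ x in {x | 0 < ζ t x}, ζ t x) - ∫ x in A t, ζ t x := by
    intro t ht
    rw [hset t ht _ fun x hx => by rw [hζe t ht, hx, zero_mul, zero_mul]]
    simp_rw [hζe t ht]
    rfl
  rw [e s hsT, e 0 h0T]
  linarith

end


/-! ### The bulk estimate at a fixed time -/

theorem setIntegral_sub_setIntegral {𝒜 A : Set (E N)} (h𝒜 : MeasurableSet 𝒜)
    (hA : NullMeasurableSet A volume) {f : E N → ℝ} (hf : Integrable f) :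
    Integrable (fun x => (indicator 𝒜 (fun _ => (1 : ℝ)) x - indicator A (fun _ => (1 : ℝ)) x) *
      f x) ∧ (∫ x in 𝒜, f x) - ∫ x in A, f x =
      ∫ x, (indicator 𝒜 (fun _ => (1 : ℝ)) x - indicator A (fun _ => (1 : ℝ)) x) * f x := by
  have e : (fun x => (indicator 𝒜 (fun _ => (1 : ℝ)) x - indicator A (fun _ => (1 : ℝ)) x) * f x) =
      fun x => indicator 𝒜 f x - indicator A f x := by
    ext x
    by_cases h1 : x ∈ 𝒜 <;> by_cases h2 : x ∈ A <;> simp [h1, h2]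
  have i1 : Integrable (indicator 𝒜 f) := hf.indicator h𝒜
  have i2 : Integrable (indicator A f) := hf.indicator₀ hA
  rw [e, integral_sub i1 i2, integral_indicator h𝒜, integral_indicator₀ hA]
  exact ⟨i1.sub i2, rfl⟩

/-- The two factors never have opposite signs: the difference of indicators is nonnegative on `{θ >
0}` and nonpositive elsewhere. -/
theorem abs_indicator_sub_indicator_mul {𝒜 A : Set (E N)} {θ : E N → ℝ} (h : 𝒜 = {x | 0 < θ x})
    (x : E N) : (indicator 𝒜 (fun _ => (1 : ℝ)) x - indicator A (fun _ => (1 : ℝ)) x) * θ x =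
      |indicator 𝒜 (fun _ => (1 : ℝ)) x - indicator A (fun _ => (1 : ℝ)) x| * |θ x| := by
  rw [← abs_mul, eq_comm, abs_eq_self]
  by_cases h1 : x ∈ 𝒜
  · have h3 : 0 < θ x := by rw [h] at h1; exact h1
    by_cases h2 : x ∈ A <;> simp [h1, h2, h3.le]
  · have h3 : θ x ≤ 0 := by rw [h] at h1; exact not_lt.1 h1
    by_cases h2 : x ∈ A <;> simp [h1, h2, h3]

/-- The Gronwall constant of the bulk inequality; `L` bounds the gradient of the cutoff. -/
def bulkConst (N : ℕ) (δ K L : ℝ) : ℝ :=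
  K ^ 3 + (K ^ 3 + (K * (N * K) + (K + L * K) * K)) / δ

section

variable {σ : E N → ℝ} {T : ℝ} {𝒜 : ℝ → Set (E N)} {ξ B : ℝ → E N → E N} {ϑ : ℝ → E N → ℝ} {δ K : ℝ}

theorem IsCalibration.bulk_integrand_nonneg (h : IsCalibration σ T 𝒜 ξ B ϑ)
    (hσ0 : ∀ x, 0 ≤ σ x) {t : ℝ} (ht : t ∈ Icc 0 T) (A : Set (E N)) (x : E N) :
    0 ≤ σ x * (indicator (𝒜 t) (fun _ => (1 : ℝ)) x - indicator A (fun _ => (1 : ℝ)) x) * ϑ t x := by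
  rw [mul_assoc, abs_indicator_sub_indicator_mul (h.eq_setOf_pos ht)]
  have := hσ0 x
  positivity

theorem IsCalibration.bulkError_eq (h : IsCalibration σ T 𝒜 ξ B ϑ) (hσ : IsSurfaceTension σ)
    (hσ0 : ∀ x, 0 ≤ σ x) {t : ℝ} (ht : t ∈ Icc 0 T) {A : Set (E N)}
    (hA : NullMeasurableSet A volume) (hfin : bulkError σ (ϑ t) (𝒜 t) A ≠ ⊤) :
    Integrable (fun x => σ x * (indicator (𝒜 t) (fun _ => (1 : ℝ)) x -
      indicator A (fun _ => (1 : ℝ)) x) * ϑ t x) ∧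
    ∫ x, σ x * (indicator (𝒜 t) (fun _ => (1 : ℝ)) x - indicator A (fun _ => (1 : ℝ)) x) * ϑ t x =
      (bulkError σ (ϑ t) (𝒜 t) A).toReal := by
  have hm : AEStronglyMeasurable (fun x => σ x * (indicator (𝒜 t) (fun _ => (1 : ℝ)) x -
      indicator A (fun _ => (1 : ℝ)) x) * ϑ t x) volume :=
    (hσ.contDiff.continuous.aestronglyMeasurable.mul
      ((aestronglyMeasurable_const.indicator (h.isOpen t ht).measurableSet).sub
        (aestronglyMeasurable_const.indicator₀ hA))).mul
      (h.contDiff_theta ht).continuous.aestronglyMeasurable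
  have hnn := h.bulk_integrand_nonneg hσ0 ht A
  refine ⟨⟨hm, ?_⟩, integral_eq_lintegral_of_nonneg_ae (ae_of_all _ hnn) hm⟩
  rw [hasFiniteIntegral_iff_ofReal (ae_of_all _ hnn)]
  exact hfin.lt_top

theorem CalibrationBounds.bulkConst_nonneg (hb : CalibrationBounds σ T 𝒜 ξ B ϑ δ K) {L : ℝ}
    (hL : 0 ≤ L) : 0 ≤ bulkConst N δ K L := by
  have h1 := hb.pos
  have h2 : 0 ≤ K := zero_le_one.trans hb.one_le
  unfold bulkConst
  positivity

/-- `|ϑ|` is bounded by the truncated distance, whose square is bounded by `1 - |ξ| ≤ 1 - n·ξ`. This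
is how a bulk weight on the surface is paid for by the relative energy. -/
theorem CalibrationBounds.theta_sq_le (hb : CalibrationBounds σ T 𝒜 ξ B ϑ δ K) {t : ℝ}
    (ht : t ∈ Icc 0 T) {x n : E N} (hn : ‖n‖ = 1) : ϑ t x ^ 2 ≤ K ^ 3 * (1 - ⟪n, ξ t x⟫_ℝ) := by
  have hK : 0 ≤ K := zero_le_one.trans hb.one_le
  have h1 := real_inner_le_norm n (ξ t x)
  rw [hn, one_mul] at h1
  have h2 := hb.dist_sq_le t ht x
  have h3 : ϑ t x ^ 2 ≤ (K * cutDist (frontier (𝒜 t)) x) ^ 2 := by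
    rw [← sq_abs]
    exact pow_le_pow_left₀ (abs_nonneg _) (hb.ϑ_le t ht x) 2
  calc ϑ t x ^ 2 ≤ K ^ 2 * cutDist (frontier (𝒜 t)) x ^ 2 := by rwa [mul_pow] at h3
    _ ≤ K ^ 2 * (K * (1 - ⟪n, ξ t x⟫_ℝ)) := by
        refine mul_le_mul_of_nonneg_left (h2.trans ?_) (sq_nonneg _)
        exact mul_le_mul_of_nonneg_left (by linarith) hK
    _ = _ := by ring

/-- The transport of `η σ ϑ` by `B` is controlled by `ϑ`. -/
theorem CalibrationBounds.abs_cutoff_transport_le (hb : CalibrationBounds σ T 𝒜 ξ B ϑ δ K)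
    (hσ : IsSurfaceTension σ) (hcal : IsCalibration σ T 𝒜 ξ B ϑ) {t : ℝ}
    (ht : t ∈ Icc 0 T) {η : E N → ℝ} (hη : ContDiff ℝ 1 η) (hη01 : ∀ x, 0 ≤ η x ∧ η x ≤ 1) {L : ℝ}
    (hL : ∀ x, ‖fderiv ℝ η x‖ ≤ L) (x : E N) :
    |η x * σ x * timeDeriv T ϑ t x + (fderiv ℝ (ϑ t) x ((η x * σ x) • B t x) +
      ϑ t x * vdiv (fun y => (η y * σ y) • B t y) x)| ≤
      (K ^ 3 + (K * (N * K) + (K + L * K) * K)) * |ϑ t x| := by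
  have hK : 0 ≤ K := zero_le_one.trans hb.one_le
  have hσ1 := hσ.contDiff
  have hσ0 : 0 ≤ σ x := hb.pos.le.trans (hb.σ_ge x)
  have hησ0 : 0 ≤ η x * σ x := mul_nonneg (hη01 x).1 hσ0
  have hησ : η x * σ x ≤ K := (mul_le_of_le_one_left hσ0 (hη01 x).2).trans (hb.σ_le x)
  have hdη := hη.differentiable one_ne_zero x
  have hdσ := hσ1.differentiable one_ne_zero x
  have hL0 : 0 ≤ L := (norm_nonneg _).trans (hL x)
  have hd : ‖fderiv ℝ (fun y => η y * σ y) x‖ ≤ K + L * K := by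
    rw [fderiv_fun_mul hdη hdσ]
    refine (norm_add_le _ _).trans (add_le_add ?_ ?_)
    · rw [norm_smul, Real.norm_of_nonneg (hη01 x).1]
      exact (mul_le_of_le_one_left (norm_nonneg _) (hη01 x).2).trans (hb.dσ_le x)
    · rw [norm_smul, mul_comm]
      exact mul_le_mul (hL x) (hb.abs_σ_le x) (norm_nonneg _) hL0
  have hdiv : |vdiv (fun y => (η y * σ y) • B t y) x| ≤ K * (N * K) + (K + L * K) * K := by
    rw [vdiv_smul (u := fun y => η y * σ y) (hdη.mul hdσ) ((hcal.regular_B.contDiff t ht).differentiable one_ne_zero x)]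
    refine (abs_add_le _ _).trans (add_le_add ?_ ?_)
    · rw [abs_mul, abs_of_nonneg hησ0]
      exact mul_le_mul hησ (hb.abs_vdiv_B_le ht x) (abs_nonneg _) hK
    · exact (ContinuousLinearMap.le_opNorm _ _).trans
        (mul_le_mul hd (hb.B_le t ht x) (norm_nonneg _) (by positivity))
  have hev : |timeDeriv T ϑ t x + fderiv ℝ (ϑ t) x (B t x)| ≤ K * (K * |ϑ t x|) :=
    (hb.evolution_ϑ t ht x).trans (mul_le_mul_of_nonneg_left (hb.dist_le t ht x) hK)
  calc _ = |(η x * σ x) * (timeDeriv T ϑ t x + fderiv ℝ (ϑ t) x (B t x)) +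
        vdiv (fun y => (η y * σ y) • B t y) x * ϑ t x| := by
          rw [map_smul, smul_eq_mul]
          ring_nf
    _ ≤ K * (K * (K * |ϑ t x|)) + (K * (N * K) + (K + L * K) * K) * |ϑ t x| := by
        refine (abs_add_le _ _).trans (add_le_add ?_ ?_)
        · rw [abs_mul, abs_of_nonneg hησ0]
          exact mul_le_mul hησ hev (abs_nonneg _) hK
        · rw [abs_mul]
          exact mul_le_mul_of_nonneg_right hdiv (abs_nonneg _)
    _ = _ := by ring

/-- Adding the divergence of `ϑP`, with `P = ησB`, completes the time derivative of `ϑ` to a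
transport derivative, which is of order `|ϑ|`. Its integral over the calibrated set vanishes, while
over `A` it produces the term that turns `V` into `V - B·n` on the surface. -/
theorem CalibrationBounds.bulkRate_le (hb : CalibrationBounds σ T 𝒜 ξ B ϑ δ K)
    (hσ : IsSurfaceTension σ) (hT : 0 < T) (hcal : IsCalibration σ T 𝒜 ξ B ϑ) {t : ℝ}
    (ht : t ∈ Icc 0 T) {A : ℝ → Set (E N)} (hA : HasFinitePerimeter (A t)) {V : ℝ → E N → ℝ}
    (hv : Measurable (V t)) (hv2 : Integrable (fun x => V t x ^ 2) (perimeterMeasure (A t)))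
    {η : E N → ℝ} (hη : ContDiff ℝ 1 η) (hηc : HasCompactSupport η)
    (hη01 : ∀ x, 0 ≤ η x ∧ η x ≤ 1) {L : ℝ} (hL : ∀ x, ‖fderiv ℝ η x‖ ≤ L)
    (hfin : bulkError σ (ϑ t) (𝒜 t) (A t) ≠ ⊤) :
    bulkRate η σ T 𝒜 ϑ A V t ≤ 1 / 2 * velocityError σ B A V t + bulkConst N δ K L *
      (realRelativeEnergy σ (ξ t) (A t) + (bulkError σ (ϑ t) (𝒜 t) (A t)).toReal) := by
  have hg := hA.isIndicatorGradient
  unfold bulkRate velocityError realRelativeEnergy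
  set μ := perimeterMeasure (A t)
  set n := measureNormal (A t)
  set v := V t
  set θ := ϑ t
  set b := B t
  have hfinμ : IsFiniteMeasure μ := hg.finite
  have hn : Measurable n := hg.measurable_normal
  have hK : 0 ≤ K := zero_le_one.trans hb.one_le
  have hσ1 := hσ.contDiff
  have hσm := hσ1.continuous.measurable
  have hσ0 : ∀ x, 0 < σ x := fun x => hb.pos.trans_le (hb.σ_ge x)
  have hL0 : 0 ≤ L := (norm_nonneg _).trans (hL 0)
  have hθ1 : ContDiff ℝ 1 θ := hcal.contDiff_theta ht
  have hb1 : ContDiff ℝ 1 b := hcal.regular_B.contDiff t ht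
  have hbm := hb1.continuous.measurable
  have hξm := (hcal.regular_ξ.contDiff t ht).continuous.measurable
  have hτ := hcal.continuous_timeDeriv_theta hT ht
  have hησ1 : ContDiff ℝ 1 fun x => η x * σ x := hη.mul hσ1
  have h0 : ∀ x ∉ tsupport η, η x = 0 := fun x hx => image_eq_zero_of_notMem_tsupport hx
  set P : E N → E N := fun y => (η y * σ y) • b y with hP
  have hP1 : ContDiff ℝ 1 P := hησ1.smul hb1
  have hPc : HasCompactSupport P := hηc.mono fun x hx h => hx (by simp [hP, h])
  have hθP1 : ContDiff ℝ 1 fun y => θ y • P y := hθ1.smul hP1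
  have hθPc : HasCompactSupport fun y => θ y • P y := hPc.mono fun x hx h => hx (by simp [h])
  -- the two volume integrands
  set f : E N → ℝ := fun x => η x * σ x * timeDeriv T ϑ t x with hf
  set g : E N → ℝ := fun x => fderiv ℝ θ x (P x) + θ x * vdiv P x with hgdef
  have hdivθP : ∀ x, vdiv (fun y => θ y • P y) x = g x := fun x => by
    rw [vdiv_smul (hθ1.differentiable one_ne_zero x) (hP1.differentiable one_ne_zero x)]
    ring
  have hfi : Integrable f := (hησ1.continuous.mul hτ).integrable_of_hasCompactSupport
    (HasCompactSupport.intro hηc fun x hx => by simp [h0 x hx])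
  have hgi : Integrable g := by
    have := (continuous_vdiv hθP1).integrable_of_hasCompactSupport (hasCompactSupport_vdiv hθPc)
      (μ := volume)
    rwa [funext hdivθP] at this
  have hg𝒜 : ∫ x in 𝒜 t, g x = 0 := by
    rw [hcal.eq_setOf_pos ht]
    exact setIntegral_pos_div_eq_zero hθ1 hP1 hPc
  have hgA : ∫ x in A t, g x = -∫ x, ⟪θ x • P x, n x⟫_ℝ ∂μ := by
    rw [← hg.integral_div _ hθP1 hθPc]
    simp_rw [hdivθP]
  have hwi : Integrable fun x => f x + g x := hfi.add hgi
  have hms := (hcal.isOpen t ht).measurableSet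
  have hsum : (∫ x in 𝒜 t, f x) - ∫ x in A t, f x =
      ((∫ x in 𝒜 t, (f x + g x)) - ∫ x in A t, (f x + g x)) - ∫ x, ⟪θ x • P x, n x⟫_ℝ ∂μ := by
    rw [integral_add hfi.integrableOn hgi.integrableOn,
      integral_add hfi.integrableOn hgi.integrableOn, hg𝒜, hgA]
    ring
  -- the volume part
  obtain ⟨hBi, hBe⟩ := hcal.bulkError_eq hσ (fun x => (hσ0 x).le) ht hA.nullMeasurable hfin
  obtain ⟨hwI, hwe⟩ := setIntegral_sub_setIntegral hms hA.nullMeasurable hwi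
  set cw := K ^ 3 + (K * (N * K) + (K + L * K) * K) with hcw
  have hcw0 : 0 ≤ cw := by positivity
  have hvol : (∫ x in 𝒜 t, (f x + g x)) - ∫ x in A t, (f x + g x) ≤
      cw / δ * (bulkError σ θ (𝒜 t) (A t)).toReal := by
    rw [hwe, ← hBe, ← integral_const_mul]
    refine integral_mono hwI (hBi.const_mul _) fun x => ?_
    have h1 := hb.abs_cutoff_transport_le hσ hcal ht hη hη01 hL x
    -- This bound closes the estimate because `|θ|` weighted by the symmetric difference is at most
    -- the bulk density divided by `δ`.
    change |f x + g x| ≤ cw * |θ x| at h1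
    have h2 := abs_indicator_sub_indicator_mul (A := A t) (hcal.eq_setOf_pos ht) x
    change _ ≤ cw / δ * (σ x * _ * θ x)
    rw [mul_assoc (σ x), h2]
    set χ := indicator (𝒜 t) (fun _ => (1 : ℝ)) x - indicator (A t) (fun _ => (1 : ℝ)) x
    have h3 : (1 : ℝ) ≤ σ x / δ := by
      rw [le_div_iff₀ hb.pos, one_mul]
      exact hb.σ_ge x
    calc χ * (f x + g x) ≤ |χ| * |f x + g x| := by rw [← abs_mul]; exact le_abs_self _
      _ ≤ |χ| * (cw * |θ x|) := mul_le_mul_of_nonneg_left h1 (abs_nonneg _)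
      _ ≤ |χ| * (cw * |θ x|) * (σ x / δ) := le_mul_of_one_le_right (by positivity) h3
      _ = _ := by ring
  -- the surface part
  have hvL : MemLp v 2 μ := (memLp_two_iff_integrable_sq hv.aestronglyMeasurable).2 hv2
  have hvi : Integrable v μ := hvL.integrable one_le_two
  have hin : Measurable fun x => ⟪b x, n x⟫_ℝ := hbm.inner hn
  have hBn : ∀ᵐ x ∂μ, ‖⟪b x, n x⟫_ℝ‖ ≤ K := by
    filter_upwards [hg.norm_normal] with x hx
    refine (norm_inner_le_norm _ _).trans ?_
    rw [hx, mul_one]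
    exact hb.B_le t ht x
  have hησθ : Continuous fun x => η x * σ x * θ x := hησ1.continuous.mul hθ1.continuous
  obtain ⟨Cθ, hCθ⟩ := (HasCompactSupport.intro hηc fun x hx => by simp [h0 x hx] :
    HasCompactSupport fun x => η x * σ x * θ x).exists_bound_of_continuous hησθ
  obtain ⟨CP, hCP⟩ := hθPc.exists_bound_of_continuous hθP1.continuous
  have s1 : Integrable (fun x => v x * (η x * σ x * θ x)) μ :=
    hvi.mul_bdd hησθ.measurable.aestronglyMeasurable (c := Cθ) (ae_of_all _ hCθ)
  have s2 : Integrable (fun x => ⟪θ x • P x, n x⟫_ℝ) μ :=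
    hg.integrable_inner hθP1.continuous.measurable hCP
  have j1 : Integrable (fun x => σ x * (v x - ⟪b x, n x⟫_ℝ) ^ 2) μ :=
    (hvL.sub (MemLp.of_bound hin.aestronglyMeasurable K hBn)).integrable_sq.bdd_mul
      hσm.aestronglyMeasurable (c := K) (ae_of_all _ hb.abs_σ_le)
  have j2 : Integrable (fun x => σ x * (1 - ⟪n x, ξ t x⟫_ℝ)) μ := by
    refine Integrable.mono' (integrable_const (K * (1 + 1)))
      (hσm.mul (measurable_const.sub (hn.inner hξm))).aestronglyMeasurable ?_
    filter_upwards [hg.norm_normal] with x hx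
    rw [norm_mul]
    refine mul_le_mul (hb.abs_σ_le x) ((norm_sub_le _ _).trans (add_le_add (by simp) ?_))
      (norm_nonneg _) hK
    refine (norm_inner_le_norm _ _).trans ?_
    rw [hx, one_mul]
    exact hb.ξ_le t ht x
  have hsurf : (∫ x, v x * (η x * σ x * θ x) ∂μ) - ∫ x, ⟪θ x • P x, n x⟫_ℝ ∂μ ≤
      1 / 2 * (∫ x, σ x * (v x - ⟪b x, n x⟫_ℝ) ^ 2 ∂μ) +
        K ^ 3 * ∫ x, σ x * (1 - ⟪n x, ξ t x⟫_ℝ) ∂μ := by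
    rw [← integral_sub s1 s2, ← integral_const_mul, ← integral_const_mul,
      ← integral_add (j1.const_mul _) (j2.const_mul _)]
    refine integral_mono_ae (s1.sub s2) ((j1.const_mul _).add (j2.const_mul _)) ?_
    filter_upwards [hg.norm_normal] with x hx
    have h1 : θ x ^ 2 ≤ K ^ 3 * (1 - ⟪n x, ξ t x⟫_ℝ) := hb.theta_sq_le ht hx
    have h2 : ⟪θ x • P x, n x⟫_ℝ = η x * σ x * θ x * ⟪b x, n x⟫_ℝ := by
      rw [hP, inner_smul_left, inner_smul_left]
      simp only [RCLike.conj_to_real]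
      ring
    rw [h2]
    set β := v x - ⟪b x, n x⟫_ℝ with hβ
    have h3 : v x * (η x * σ x * θ x) - η x * σ x * θ x * ⟪b x, n x⟫_ℝ =
      σ x * (η x * (θ x * β)) := by rw [hβ]; ring
    -- The weight `1 / 2` on the velocity error matches exactly the half gained in the relative
    -- energy estimate.
    have h4 : η x * (θ x * β) ≤ 1 / 2 * β ^ 2 + 1 / 2 * θ x ^ 2 := by
      have h5 : η x * (θ x * β) ≤ |θ x * β| :=
        (mul_le_mul_of_nonneg_left (le_abs_self _) (hη01 x).1).trans
          (mul_le_of_le_one_left (abs_nonneg _) (hη01 x).2)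
      have h6 := two_mul_le_add_sq |θ x| |β|
      rw [sq_abs, sq_abs] at h6
      rw [abs_mul] at h5
      linarith
    rw [h3]
    have h7 : 1 / 2 * β ^ 2 + 1 / 2 * θ x ^ 2 ≤ 1 / 2 * β ^ 2 + K ^ 3 * (1 - ⟪n x, ξ t x⟫_ℝ) := by
      linarith [sq_nonneg (θ x)]
    have h8 := mul_le_mul_of_nonneg_left (h4.trans h7) (hσ0 x).le
    calc _ ≤ _ := h8
      _ = _ := by ring
  have hR0 : 0 ≤ ∫ x, σ x * (1 - ⟪n x, ξ t x⟫_ℝ) ∂μ := by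
    refine integral_nonneg_of_ae ?_
    filter_upwards [hg.norm_normal] with x hx
    have h2 := real_inner_le_norm (n x) (ξ t x)
    rw [hx, one_mul] at h2
    exact mul_nonneg (hσ0 x).le (by linarith [hb.ξ_le t ht x])
  have hB0 : 0 ≤ (bulkError σ θ (𝒜 t) (A t)).toReal := ENNReal.toReal_nonneg
  have hc1 : 0 ≤ cw / δ := div_nonneg hcw0 hb.pos.le
  have hc2 : 0 ≤ K ^ 3 := by positivity
  have e : bulkConst N δ K L = K ^ 3 + cw / δ := rfl
  rw [e, hsum]
  have q1 := mul_nonneg hc1 hR0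
  have q2 := mul_nonneg hc2 hB0
  linarith

end


/-! ### The two stability inequalities -/

theorem ofReal_integral_le_lintegral {α : Type*} [MeasurableSpace α] {μ : Measure α} {f : α → ℝ}
    (hf : Integrable f μ) : ENNReal.ofReal (∫ x, f x ∂μ) ≤ ∫⁻ x, ENNReal.ofReal (f x) ∂μ := by
  rw [integral_eq_lintegral_pos_part_sub_lintegral_neg_part hf]
  exact (ENNReal.ofReal_le_ofReal (sub_le_self _ ENNReal.toReal_nonneg)).trans
    ENNReal.ofReal_toReal_le

section

variable {σ : E N → ℝ} {T : ℝ} {𝒜 : ℝ → Set (E N)} {ξ B : ℝ → E N → E N} {ϑ : ℝ → E N → ℝ} {δ K : ℝ}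
  {S : ℝ} {A : ℝ → Set (E N)} {V : ℝ → E N → ℝ} {κ : Kernel ℝ (E N)} [IsFiniteKernel κ]

theorem CalibrationBounds.velocityError_nonneg (hb : CalibrationBounds σ T 𝒜 ξ B ϑ δ K) (t : ℝ) :
    0 ≤ velocityError σ B A V t :=
  integral_nonneg fun x => mul_nonneg (hb.pos.le.trans (hb.σ_ge x)) (sq_nonneg _)

/-- The velocity error has a favourable sign and is dropped. The comparison with the relative energy
is made inside the lower integral, so its measurability in time is not needed; only the dissipation
rate has to be integrable. -/
theorem IsBVFlow.ae_relativeEnergy_le (hb : CalibrationBounds σ T 𝒜 ξ B ϑ δ K)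
    (hσ : IsSurfaceTension σ) (hT : 0 < T) (hcal : IsCalibration σ T 𝒜 ξ B ϑ) (hTS : T ≤ S)
    (h : IsBVFlow σ S A V κ) {C : ℝ} (hC : energyConst N δ K ≤ C) :
    ∀ᵐ s ∂(volume.restrict (Ioo 0 T)), relativeEnergy σ (ξ s) (A s) ≤
      relativeEnergy σ (ξ 0) (A 0) +
        ENNReal.ofReal C * ∫⁻ t in Ioo 0 s, relativeEnergy σ (ξ t) (A t) := by
  have hC0 : 0 ≤ C := hb.energyConst_nonneg.trans hC
  have hrel : ∀ t ∈ Icc 0 T, 0 ≤ realRelativeEnergy σ (ξ t) (A t) ∧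
      relativeEnergy σ (ξ t) (A t) = ENNReal.ofReal (realRelativeEnergy σ (ξ t) (A t)) :=
    fun t ht => by
      have := hb.relativeEnergy_eq hσ hcal ht (h.finitePerimeter t ⟨ht.1, ht.2.trans hTS⟩)
      exact ⟨this.1, this.2.1⟩
  filter_upwards [h.ae_energy_le hb hσ hT hcal hTS, ae_restrict_mem measurableSet_Ioo]
    with s ⟨hI, hle⟩ hs
  have hsub : Ioo 0 s ⊆ Ioo 0 T := Ioo_subset_Ioo_right hs.2.le
  rw [(hrel s ⟨hs.1.le, hs.2.le⟩).2, (hrel 0 ⟨le_rfl, hT.le⟩).2]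
  refine (ENNReal.ofReal_le_ofReal hle).trans (ENNReal.ofReal_add_le.trans ?_)
  gcongr
  refine (ofReal_integral_le_lintegral hI).trans ?_
  rw [← lintegral_const_mul' _ _ ENNReal.ofReal_ne_top]
  refine lintegral_mono_ae ?_
  filter_upwards [ae_restrict_of_ae_restrict_of_subset hsub
    (h.ae_dissipationRate_le hb hσ hT hcal hTS), ae_restrict_mem measurableSet_Ioo] with t ht htm
  obtain ⟨h0, h1⟩ := hrel t ⟨htm.1.le, htm.2.le.trans hs.2.le⟩
  rw [h1, ← ENNReal.ofReal_mul hC0]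
  refine ENNReal.ofReal_le_ofReal (ht.2.trans ?_)
  have h2 := hb.velocityError_nonneg (A := A) (V := V) t
  have h3 := mul_le_mul_of_nonneg_right hC h0
  linarith

/-- The bulk error with a cutoff as an integral of a nonnegative function. -/
theorem IsCalibration.ofReal_bulkCut (hσ : IsSurfaceTension σ) (hσ0 : ∀ x, 0 ≤ σ x)
    (hcal : IsCalibration σ T 𝒜 ξ B ϑ) {t : ℝ} (ht : t ∈ Icc 0 T) {A : Set (E N)}
    (hA : NullMeasurableSet A volume) {η : E N → ℝ} (hη : Continuous η) (hηc : HasCompactSupport η)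
    (hη0 : ∀ x, 0 ≤ η x) :
    AEMeasurable (fun x => ENNReal.ofReal (η x * (σ x * (indicator (𝒜 t) (fun _ => (1 : ℝ)) x -
      indicator A (fun _ => (1 : ℝ)) x) * ϑ t x))) volume ∧
    ENNReal.ofReal (bulkCut η σ (ϑ t) (𝒜 t) A) =
      ∫⁻ x, ENNReal.ofReal (η x * (σ x * (indicator (𝒜 t) (fun _ => (1 : ℝ)) x -
        indicator A (fun _ => (1 : ℝ)) x) * ϑ t x)) := by
  have hc : Continuous fun x => η x * σ x * ϑ t x :=
    (hη.mul hσ.contDiff.continuous).mul (hcal.contDiff_theta ht).continuous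
  have hi : Integrable fun x => η x * σ x * ϑ t x := hc.integrable_of_hasCompactSupport
    (hηc.mono fun x hx h => hx (by simp [h]))
  obtain ⟨h1, h2⟩ := setIntegral_sub_setIntegral (hcal.isOpen t ht).measurableSet hA hi
  have e : (fun x => η x * (σ x * (indicator (𝒜 t) (fun _ => (1 : ℝ)) x -
        indicator A (fun _ => (1 : ℝ)) x) * ϑ t x)) =
      fun x => (indicator (𝒜 t) (fun _ => (1 : ℝ)) x - indicator A (fun _ => (1 : ℝ)) x) *
        (η x * σ x * ϑ t x) := by
    ext x
    ring
  rw [← e] at h1 h2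
  refine ⟨h1.aemeasurable.ennreal_ofReal, ?_⟩
  rw [bulkCut, h2, ofReal_integral_eq_lintegral_ofReal h1]
  exact ae_of_all _ fun x => mul_nonneg (hη0 x) (hcal.bulk_integrand_nonneg hσ0 ht A x)

/-- The relative energy inequality and the bulk identity are added, so the two velocity error terms
cancel. Dropping the relative energy at the final time leaves its initial value on the right. All
bounds are uniform in the cutoff. -/
theorem IsBVFlow.ae_bulkError_le (hb : CalibrationBounds σ T 𝒜 ξ B ϑ δ K)
    (hσ : IsSurfaceTension σ) (hT : 0 < T) (hcal : IsCalibration σ T 𝒜 ξ B ϑ) (hTS : T ≤ S)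
    (h : IsBVFlow σ S A V κ) {η : ℕ → E N → ℝ} {L : ℝ} (hη : ∀ k, ContDiff ℝ 1 (η k))
    (hηc : ∀ k, HasCompactSupport (η k)) (hη01 : ∀ k x, 0 ≤ η k x ∧ η k x ≤ 1)
    (hηL : ∀ k x, ‖fderiv ℝ (η k) x‖ ≤ L) (hηt : ∀ x, Tendsto (fun k => η k x) atTop (𝓝 1))
    {C : ℝ} (hC : energyConst N δ K + bulkConst N δ K L ≤ C) (hC0 : 0 < C) :
    ∀ᵐ s ∂(volume.restrict (Ioo 0 T)), bulkError σ (ϑ s) (𝒜 s) (A s) ≤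
      relativeEnergy σ (ξ 0) (A 0) + bulkError σ (ϑ 0) (𝒜 0) (A 0) +
        ENNReal.ofReal C * ∫⁻ t in Ioo 0 s,
          (relativeEnergy σ (ξ t) (A t) + bulkError σ (ϑ t) (𝒜 t) (A t)) := by
  have hL0 : 0 ≤ L := (norm_nonneg _).trans (hηL 0 0)
  have hσ0 : ∀ x, 0 ≤ σ x := fun x => hb.pos.le.trans (hb.σ_ge x)
  have hfp : ∀ t ∈ Icc 0 T, HasFinitePerimeter (A t) := fun t ht =>
    h.finitePerimeter t ⟨ht.1, ht.2.trans hTS⟩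
  have hrel : ∀ t ∈ Icc 0 T, 0 ≤ realRelativeEnergy σ (ξ t) (A t) ∧
      relativeEnergy σ (ξ t) (A t) = ENNReal.ofReal (realRelativeEnergy σ (ξ t) (A t)) :=
    fun t ht => by
      have := hb.relativeEnergy_eq hσ hcal ht (hfp t ht)
      exact ⟨this.1, this.2.1⟩
  have hbulk : ∀ᵐ s ∂(volume.restrict (Ioo 0 T)), ∀ k,
      IntegrableOn (bulkRate (η k) σ T 𝒜 ϑ A V) (Ioo 0 s) ∧
      bulkCut (η k) σ (ϑ s) (𝒜 s) (A s) = bulkCut (η k) σ (ϑ 0) (𝒜 0) (A 0) +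
        ∫ t in Ioo 0 s, bulkRate (η k) σ T 𝒜 ϑ A V t :=
    ae_all_iff.2 fun k => h.ae_bulkCut_eq hb hσ hT hcal hTS (hη k).continuous (hηc k)
      fun x => (hη01 k x).1
  filter_upwards [hbulk, h.ae_energy_le hb hσ hT hcal hTS, ae_restrict_mem measurableSet_Ioo]
    with s hbs ⟨hI, hle⟩ hs
  have hsub : Ioo 0 s ⊆ Ioo 0 T := Ioo_subset_Ioo_right hs.2.le
  have hsT : s ∈ Icc 0 T := ⟨hs.1.le, hs.2.le⟩
  have h0T : (0 : ℝ) ∈ Icc 0 T := ⟨le_rfl, hT.le⟩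
  have hk : ∀ k, ENNReal.ofReal (bulkCut (η k) σ (ϑ s) (𝒜 s) (A s)) ≤
      relativeEnergy σ (ξ 0) (A 0) + bulkError σ (ϑ 0) (𝒜 0) (A 0) +
        ENNReal.ofReal C * ∫⁻ t in Ioo 0 s,
          (relativeEnergy σ (ξ t) (A t) + bulkError σ (ϑ t) (𝒜 t) (A t)) := by
    intro k
    obtain ⟨hIk, hek⟩ := hbs k
    have e1 : bulkCut (η k) σ (ϑ s) (𝒜 s) (A s) ≤ realRelativeEnergy σ (ξ 0) (A 0) +
        bulkCut (η k) σ (ϑ 0) (𝒜 0) (A 0) +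
        ∫ t in Ioo 0 s, (dissipationRate σ T ξ A V t + bulkRate (η k) σ T 𝒜 ϑ A V t) := by
      rw [integral_add hI hIk]
      linarith [(hrel s hsT).1]
    refine (ENNReal.ofReal_le_ofReal e1).trans (ENNReal.ofReal_add_le.trans ?_)
    refine add_le_add (ENNReal.ofReal_add_le.trans (add_le_add ?_ ?_)) ?_
    · exact (hrel 0 h0T).2.ge
    · rw [(hcal.ofReal_bulkCut hσ hσ0 h0T (hfp 0 h0T).nullMeasurable (hη k).continuous (hηc k)
        fun x => (hη01 k x).1).2]
      exact lintegral_mono fun x => ENNReal.ofReal_le_ofReal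
        (mul_le_of_le_one_left (hcal.bulk_integrand_nonneg hσ0 h0T _ x) (hη01 k x).2)
    · have hDF : IntegrableOn (fun t => dissipationRate σ T ξ A V t +
          bulkRate (η k) σ T 𝒜 ϑ A V t) (Ioo 0 s) := hI.add hIk
      refine (ofReal_integral_le_lintegral hDF).trans ?_
      rw [← lintegral_const_mul' _ _ ENNReal.ofReal_ne_top]
      refine lintegral_mono_ae ?_
      filter_upwards [ae_restrict_of_ae_restrict_of_subset hsub
        (h.ae_dissipationRate_le hb hσ hT hcal hTS), ae_restrict_mem measurableSet_Ioo] with t ht htm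
      have htT : t ∈ Icc 0 T := ⟨htm.1.le, htm.2.le.trans hs.2.le⟩
      obtain ⟨h0, h1⟩ := hrel t htT
      -- An infinite bulk error makes the right-hand side infinite because `C > 0`; the rate
      -- estimate is needed only for finite values.
      by_cases hfin : bulkError σ (ϑ t) (𝒜 t) (A t) = ⊤
      · rw [hfin, add_top, ENNReal.mul_top (ENNReal.ofReal_pos.2 hC0).ne']
        exact le_top
      · have h2 := hb.bulkRate_le hσ hT hcal htT (hfp t htT) h.velocity.measurable.of_uncurry_left
          ht.1 (hη k) (hηc k) (hη01 k) (hηL k) hfin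
        rw [h1, ← ENNReal.ofReal_toReal hfin, ← ENNReal.ofReal_add h0 ENNReal.toReal_nonneg,
          ← ENNReal.ofReal_mul hC0.le]
        refine ENNReal.ofReal_le_ofReal ?_
        have h3 : 0 ≤ (bulkError σ (ϑ t) (𝒜 t) (A t)).toReal := ENNReal.toReal_nonneg
        have h4 := mul_le_mul_of_nonneg_right hC (add_nonneg h0 h3)
        have h5 := mul_nonneg hb.energyConst_nonneg h3
        linarith [ht.2]
  have hcut := fun k => hcal.ofReal_bulkCut hσ hσ0 hsT (hfp s hsT).nullMeasurable (hη k).continuous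
    (hηc k) fun x => (hη01 k x).1
  -- Fatou's lemma removes the cutoff: the integrands are nonnegative and converge pointwise, and
  -- the bound does not depend on `k`.
  calc bulkError σ (ϑ s) (𝒜 s) (A s) = ∫⁻ x, liminf (fun k => ENNReal.ofReal (η k x *
        (σ x * (indicator (𝒜 s) (fun _ => (1 : ℝ)) x - indicator (A s) (fun _ => (1 : ℝ)) x) *
          ϑ s x))) atTop := by
        refine lintegral_congr fun x => ?_
        have := (ENNReal.continuous_ofReal.tendsto _).comp ((hηt x).mul_const
          (σ x * (indicator (𝒜 s) (fun _ => (1 : ℝ)) x - indicator (A s) (fun _ => (1 : ℝ)) x) *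
          ϑ s x))
        rw [one_mul] at this
        exact this.liminf_eq.symm
    _ ≤ liminf (fun k => ∫⁻ x, ENNReal.ofReal (η k x * (σ x * (indicator (𝒜 s) (fun _ => (1 : ℝ)) x -
          indicator (A s) (fun _ => (1 : ℝ)) x) * ϑ s x))) atTop :=
        lintegral_liminf_le' fun k => (hcut k).1
    _ ≤ _ := by
        refine liminf_le_of_frequently_le' (Frequently.of_forall fun k => ?_)
        rw [← (hcut k).2]
        exact hk k

end


/-! ### The perimeter measure of a set with smooth boundary -/

/-- For a smooth increasing step `s`, the divergence of `s(f) φ` integrates to zero, and the term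
`s'(f) ∇f·φ` in it is nonnegative. Letting the steps tend to the indicator of `(0,∞)` gives the sign
without a surface measure on `{f = 0}`. -/
theorem setIntegral_pos_vdiv_nonpos {f : E N → ℝ} {φ : E N → E N} (hf : ContDiff ℝ 1 f)
    (hφ : ContDiff ℝ 1 φ) (hc : HasCompactSupport φ) (h : ∀ x, 0 ≤ fderiv ℝ f x (φ x)) :
    ∫ x in {x | 0 < f x}, vdiv φ x ≤ 0 := by
  have hv := continuous_vdiv hφ
  have hvi : Integrable (vdiv φ) := hv.integrable_of_hasCompactSupport (hasCompactSupport_vdiv hc)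
  have hfc := hf.continuous
  have hmeas : MeasurableSet {x | 0 < f x} := measurableSet_lt measurable_const hfc.measurable
  let s : ℕ → ℝ → ℝ := fun k r => Real.smoothTransition (((k : ℝ) + 1) * r)
  have hs : ∀ k, ContDiff ℝ 1 (s k) := fun k =>
    (Real.smoothTransition.contDiff (n := 1)).comp (by fun_prop)
  have hsm : ∀ k, Monotone (s k) := fun k a b hab =>
    Real.smoothTransition.monotone (mul_le_mul_of_nonneg_left hab (by positivity))
  have hs1 : ∀ k r, ‖s k r‖ ≤ 1 := fun k r => by
    rw [Real.norm_of_nonneg (Real.smoothTransition.nonneg _)]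
    exact Real.smoothTransition.le_one _
  have h1 : ∀ k, ∫ x, s k (f x) * vdiv φ x ≤ 0 := by
    intro k
    have hsf : ContDiff ℝ 1 fun x => s k (f x) := (hs k).comp hf
    have hsφ : HasCompactSupport fun x => s k (f x) • φ x := hc.mono fun x hx h => hx (by simp [h])
    have e : ∀ x, vdiv (fun x => s k (f x) • φ x) x =
        s k (f x) * vdiv φ x + deriv (s k) (f x) * fderiv ℝ f x (φ x) := by
      intro x
      rw [vdiv_smul (hsf.differentiable one_ne_zero x) (hφ.differentiable one_ne_zero x)]
      have h2 : fderiv ℝ (fun x => s k (f x)) x = deriv (s k) (f x) • fderiv ℝ f x :=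
        (((hs k).differentiable one_ne_zero (f x)).hasDerivAt.comp_hasFDerivAt x
          (hf.differentiable one_ne_zero x).hasFDerivAt).fderiv
      rw [h2]
      simp
    have hz := integral_vdiv_eq_zero (hsf.smul hφ) hsφ
    have hle : ∫ x, s k (f x) * vdiv φ x ≤ ∫ x, vdiv (fun x => s k (f x) • φ x) x := by
      refine integral_mono
        (hvi.bdd_mul hsf.continuous.aestronglyMeasurable (ae_of_all _ fun x => hs1 k (f x)))
        ((continuous_vdiv (hsf.smul hφ)).integrable_of_hasCompactSupport
          (hasCompactSupport_vdiv hsφ)) fun x => ?_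
      rw [e]
      have := mul_nonneg ((hsm k).deriv_nonneg (x := f x)) (h x)
      linarith
    exact hle.trans hz.le
  have h2 := tendsto_integral_of_dominated_convergence (μ := (volume : Measure (E N)))
    (F := fun k x => s k (f x) * vdiv φ x) (f := {x | 0 < f x}.indicator (vdiv φ))
    (fun x => ‖vdiv φ x‖)
    (fun k => (((hs k).continuous.comp hfc).mul hv).aestronglyMeasurable) hvi.norm
    (fun k => ae_of_all _ fun x => by
      rw [norm_mul]
      exact mul_le_of_le_one_left (norm_nonneg _) (hs1 k _))
    (ae_of_all _ fun x => by
      by_cases hx : 0 < f x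
      · rw [indicator_of_mem (by exact hx)]
        refine tendsto_const_nhds.congr' ?_
        obtain ⟨m, hm⟩ := exists_nat_ge (1 / f x)
        filter_upwards [eventually_ge_atTop m] with k hk
        have h3 : 1 ≤ ((k : ℝ) + 1) * f x := by
          have h4 : (m : ℝ) ≤ k := by exact_mod_cast hk
          rw [← div_le_iff₀ hx]
          linarith
        simp [s, Real.smoothTransition.one_of_one_le h3]
      · rw [indicator_of_notMem (by exact hx)]
        refine tendsto_const_nhds.congr fun k => ?_
        have h3 : ((k : ℝ) + 1) * f x ≤ 0 :=
          mul_nonpos_of_nonneg_of_nonpos (by positivity) (not_lt.1 hx)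
        simp [s, Real.smoothTransition.zero_of_nonpos h3])
  rw [← integral_indicator hmeas]
  exact le_of_tendsto' h2 h1

/-- If `A` agrees with `{f > 0}` in a bounded open set `U`, then the normal points into the
half-space of inward directions. -/
theorem IsIndicatorGradient.ae_inner_nonneg {A D : Set (E N)} {μ : Measure (E N)} {n : E N → E N}
    (h : IsIndicatorGradient A μ n) (hAD : A =ᵐ[volume] D) {f : E N → ℝ} (hf : ContDiff ℝ 1 f)
    {U : Set (E N)} (hU : IsOpen U) (hUb : Bornology.IsBounded U) (hD : ∀ x ∈ U, x ∈ D ↔ 0 < f x)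
    {w : E N → E N} (hw : ContDiff ℝ 1 w) (hfw : ∀ x, 0 ≤ fderiv ℝ f x (w x)) :
    ∀ᵐ x ∂μ, x ∈ U → 0 ≤ ⟪w x, n x⟫_ℝ := by
  have hfin := h.finite
  obtain ⟨C, hC⟩ := hUb.isCompact_closure.exists_bound_of_continuousOn hw.continuous.continuousOn
  have hwm : Measurable (U.indicator w) := hw.continuous.measurable.indicator hU.measurableSet
  have hi : Integrable (fun x => ⟪U.indicator w x, n x⟫_ℝ) μ :=
    h.integrable_inner hwm (C := max C 0) fun x => by
      by_cases hx : x ∈ U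
      · rw [indicator_of_mem hx]
        exact (hC x (subset_closure hx)).trans (le_max_left _ _)
      · simp [indicator_of_notMem hx]
  have key := ae_nonneg_of_integral_smooth_nonneg hU hi (hwm.inner h.measurable_normal) ?_
  · filter_upwards [key] with x hx hxU
    simpa [indicator_of_mem hxU] using hx hxU
  intro g hg hgc hgU hg0
  have hg1 : ContDiff ℝ 1 g := hg.of_le (by exact_mod_cast le_top)
  have hφ : ContDiff ℝ 1 fun x => g x • w x := hg1.smul hw
  have hφc : HasCompactSupport fun x => g x • w x := hgc.mono fun x hx h => hx (by simp [h])
  have e1 : ∫ x, g x * ⟪U.indicator w x, n x⟫_ℝ ∂μ = ∫ x, ⟪g x • w x, n x⟫_ℝ ∂μ := by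
    congr 1
    ext x
    rw [real_inner_smul_left]
    by_cases hx : x ∈ U
    · rw [indicator_of_mem hx]
    · rw [image_eq_zero_of_notMem_tsupport fun hx' => hx (hgU hx'), zero_mul, zero_mul]
  have hvz : ∀ x ∉ U, vdiv (fun x => g x • w x) x = 0 := by
    intro x hx
    have h1 : x ∉ tsupport fun x => g x • w x := fun hx' =>
      hx (hgU (tsupport_smul_subset_left g w hx'))
    have h2 : fderiv ℝ (fun x => g x • w x) x = 0 :=
      image_eq_zero_of_notMem_tsupport fun hx' => h1 (tsupport_fderiv_subset ℝ hx')
    simp [vdiv, h2]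
  have e2 : ∫ x in A, vdiv (fun x => g x • w x) x =
      ∫ x in {x | 0 < f x}, vdiv (fun x => g x • w x) x := by
    rw [setIntegral_congr_set hAD]
    have hDU : ∀ Q : Set (E N), ∫ x in Q, vdiv (fun x => g x • w x) x =
        ∫ x in U ∩ Q, vdiv (fun x => g x • w x) x := by
      intro Q
      rw [← Measure.restrict_restrict hU.measurableSet, setIntegral_eq_integral_of_forall_compl_eq_zero hvz]
    rw [hDU, hDU {x | 0 < f x}]
    congr 2
    ext x
    exact and_congr_right fun hx => hD x hx
  have h3 := setIntegral_pos_vdiv_nonpos hf hφ hφc fun x => by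
    rw [map_smul, smul_eq_mul]
    exact mul_nonneg (hg0 x) (hfw x)
  rw [e1, ← neg_nonpos, ← h.integral_div _ hφ hφc, e2]
  exact h3

/-- If the unit normals `a` and `b` differ, then `a·(a - b) > 0 > b·(a - b)`. A short move in the
direction `a - b` would enter `D` according to one defining function and leave it according to the
other. -/
theorem IsInnerUnitNormal.unique {D : Set (E N)} {x ν₁ ν₂ : E N} (h₁ : IsInnerUnitNormal D x ν₁)
    (h₂ : IsInnerUnitNormal D x ν₂) : ν₁ = ν₂ := by
  have hn₁ := h₁.norm_eq_one
  have hn₂ := h₂.norm_eq_one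
  obtain ⟨f, hf, hf0, hfg, hfD, rfl⟩ := h₁
  obtain ⟨g, hg, hg0, hgg, hgD, rfl⟩ := h₂
  by_contra hne
  set a := ‖gradient f x‖⁻¹ • gradient f x with ha
  set b := ‖gradient g x‖⁻¹ • gradient g x with hb
  have hlt : ⟪a, b⟫_ℝ < 1 := (inner_lt_one_iff_real_of_norm_eq_one hn₁ hn₂).2 hne
  have key : ∀ u : E N → ℝ, ContDiff ℝ ∞ u → u x = 0 →
      HasDerivAt (fun s : ℝ => u (x + s • (a - b))) ⟪gradient u x, a - b⟫_ℝ 0 := by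
    intro u hu hu0
    have h1 : HasFDerivAt u (fderiv ℝ u x) (x + (0 : ℝ) • (a - b)) := by
      rw [zero_smul, add_zero]
      exact (hu.differentiable (by simp) x).hasFDerivAt
    have h2 : HasDerivAt (fun s : ℝ => x + s • (a - b)) (a - b) 0 := by
      simpa using! ((hasDerivAt_id (0 : ℝ)).smul_const (a - b)).const_add x
    have h3 := h1.comp_hasDerivAt 0 h2
    rwa [← inner_gradient_left] at h3
  have hcont : Tendsto (fun s : ℝ => x + s • (a - b)) (𝓝[>] 0) (𝓝 x) := by
    have : Continuous fun s : ℝ => x + s • (a - b) := by fun_prop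
    simpa using (this.tendsto 0).mono_left nhdsWithin_le_nhds
  have hposf : 0 < ⟪gradient f x, a - b⟫_ℝ := by
    have h1 : gradient f x = ‖gradient f x‖ • a := by
      rw [ha, smul_smul, mul_inv_cancel₀ (norm_ne_zero_iff.2 hfg), one_smul]
    rw [h1, real_inner_smul_left, inner_sub_right, real_inner_self_eq_norm_sq, hn₁]
    exact mul_pos (norm_pos_iff.2 hfg) (by linarith)
  have hnegg : ⟪gradient g x, a - b⟫_ℝ < 0 := by
    have h1 : gradient g x = ‖gradient g x‖ • b := by
      rw [hb, smul_smul, mul_inv_cancel₀ (norm_ne_zero_iff.2 hgg), one_smul]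
    rw [h1, real_inner_smul_left, inner_sub_right, real_inner_self_eq_norm_sq, hn₂,
      real_inner_comm]
    exact mul_neg_of_pos_of_neg (norm_pos_iff.2 hgg) (by linarith)
  have ef : ∀ᶠ s in 𝓝[>] (0 : ℝ), 0 < f (x + s • (a - b)) := by
    have := ((key f hf hf0).tendsto_slope.mono_left
      (nhdsWithin_mono _ fun s (hs : 0 < s) => hs.ne')).eventually_const_lt hposf
    filter_upwards [this, self_mem_nhdsWithin] with s hs (hs0 : 0 < s)
    rw [slope_def_field, zero_smul, add_zero, hf0, sub_zero, sub_zero] at hs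
    exact (div_pos_iff_of_pos_right hs0).1 hs
  have eg : ∀ᶠ s in 𝓝[>] (0 : ℝ), g (x + s • (a - b)) < 0 := by
    have := ((key g hg hg0).tendsto_slope.mono_left
      (nhdsWithin_mono _ fun s (hs : 0 < s) => hs.ne')).eventually_lt_const hnegg
    filter_upwards [this, self_mem_nhdsWithin] with s hs (hs0 : 0 < s)
    rw [slope_def_field, zero_smul, add_zero, hg0, sub_zero, sub_zero] at hs
    exact (div_lt_iff₀ hs0).1 hs |>.trans_eq (zero_mul s)
  obtain ⟨s, h1, h2, h3, h4⟩ := (ef.and (eg.and ((hcont.eventually hfD).and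
    (hcont.eventually hgD)))).exists
  exact (h4.1 (h3.2 h1)).not_gt h2

/-- On its zero set `f` agrees with a constant, so its derivative vanishes at almost every point of
that set. The multiplication by a fixed nonzero vector turns `f` into a self-map of the space, for
which approximation by the zero linear map controls the derivative. -/
theorem volume_zeros_inter_fderiv_ne_zero {f : E N → ℝ} (hf : ContDiff ℝ 1 f) :
    volume {x | f x = 0 ∧ fderiv ℝ f x ≠ 0} = 0 := by
  rcases subsingleton_or_nontrivial (E N) with hs | hs
  · have : {x | f x = 0 ∧ fderiv ℝ f x ≠ 0} = ∅ :=
      eq_empty_of_forall_notMem fun x hx => hx.2 (Subsingleton.elim _ _)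
    rw [this, measure_empty]
  obtain ⟨e, he⟩ := exists_ne (0 : E N)
  have hmeas : MeasurableSet {x | f x = 0} :=
    measurableSet_eq_fun hf.continuous.measurable measurable_const
  have happ : ApproximatesLinearOn (fun x => f x • e) (0 : E N →L[ℝ] E N) {x | f x = 0} 0 := by
    intro x hx y hy
    have hx0 : f x = 0 := hx
    have hy0 : f y = 0 := hy
    simp [hx0, hy0]
  have h1 := happ.norm_fderiv_sub_le volume hmeas (fun x => (fderiv ℝ f x).smulRight e) fun x _ =>
    ((hf.differentiable one_ne_zero x).hasFDerivAt.smul_const e).hasFDerivWithinAt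
  rw [ae_restrict_iff' hmeas] at h1
  refine measure_mono_null (fun x hx => ?_) h1
  intro h2
  have h3 := h2 hx.1
  rw [sub_zero, nonpos_iff_eq_zero, nnnorm_eq_zero] at h3
  apply hx.2
  ext v
  have h4 := congrArg (fun L : E N →L[ℝ] E N => L v) h3
  simpa [he] using h4

theorem eq_zero_of_mem_frontier {D : Set (E N)} (hD : IsOpen D) {f : E N → ℝ} (hf : Continuous f)
    {y : E N} (hfD : ∀ᶠ z in 𝓝 y, z ∈ D ↔ 0 < f z) (hy : y ∈ frontier D) : f y = 0 := by
  refine le_antisymm ?_ ?_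
  · have : y ∉ D := by rw [hD.frontier_eq] at hy; exact hy.2
    exact not_lt.1 fun h0 => this (hfD.self_of_nhds.2 h0)
  · by_contra! hlt
    have h1 : ∀ᶠ z in 𝓝 y, z ∉ D := by
      filter_upwards [hfD, hf.continuousAt.eventually_lt_const hlt] with z hz hz0 hzD
      exact (hz.1 hzD).not_gt hz0
    exact (mem_closure_iff_frequently.1 (frontier_subset_closure hy)) h1

theorem HasSmoothBoundary.volume_frontier {D : Set (E N)} (h : HasSmoothBoundary D)
    (hD : IsOpen D) : volume (frontier D) = 0 := by
  refine measure_null_of_locally_null _ fun x hx => ?_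
  obtain ⟨ν, f, hf, hf0, hfg, hfD, -⟩ := h x hx
  have hf1 : ContDiff ℝ 1 f := hf.of_le (by exact_mod_cast le_top)
  have hd : ∀ᶠ y in 𝓝 x, fderiv ℝ f y ≠ 0 := by
    refine (hf1.continuous_fderiv one_ne_zero).continuousAt.eventually_ne fun h0 => hfg ?_
    simp [gradient, h0]
  refine ⟨{y | y ∈ frontier D → f y = 0 ∧ fderiv ℝ f y ≠ 0} ∩ frontier D, ?_,
    measure_mono_null (fun y hy => hy.1 hy.2) (volume_zeros_inter_fderiv_ne_zero hf1)⟩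
  refine inter_mem (mem_nhdsWithin_of_mem_nhds ?_) self_mem_nhdsWithin
  filter_upwards [hd, hfD.eventually_nhds] with y hy hyD hyf
  exact ⟨eq_zero_of_mem_frontier hD hf.continuous hyD hyf, hy⟩

/-- The normal is identified through signs of fluxes alone. Off the boundary every constant field
has flux of both signs, which forces `n = 0` and hence zero measure. Near a boundary point the
gradient of the defining function has nonnegative flux density and all tangential fields have zero
flux density, so `n` is the normalized gradient. -/
theorem IsIndicatorGradient.ae_eq_normal {A D : Set (E N)} {μ : Measure (E N)} {n : E N → E N}
    (h : IsIndicatorGradient A μ n) (hAD : A =ᵐ[volume] D) (hD : IsOpen D)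
    (hs : HasSmoothBoundary D) {ξ : E N → E N}
    (hξ : ∀ x ∈ frontier D, IsInnerUnitNormal D x (ξ x)) : ∀ᵐ x ∂μ, n x = ξ x := by
  -- A constant defining function covers both cases off the boundary: the value `1` inside `D`, the
  -- value `0` outside its closure.
  have hcst : ∀ (f : ℝ) (U : Set (E N)), IsOpen U → Bornology.IsBounded U →
      (∀ x ∈ U, x ∈ D ↔ 0 < f) → μ U = 0 := by
    intro f U hU hUb hUD
    have h1 : ∀ w : E N, ∀ᵐ x ∂μ, x ∈ U → 0 ≤ ⟪w, n x⟫_ℝ := fun w =>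
      h.ae_inner_nonneg hAD (f := fun _ => f) contDiff_const hU hUb hUD (w := fun _ => w)
        contDiff_const fun x => by simp
    have h2 : ∀ᵐ x ∂μ, ∀ i : Fin N, (x ∈ U → 0 ≤ ⟪EuclideanSpace.single i (1 : ℝ), n x⟫_ℝ) ∧
        (x ∈ U → 0 ≤ ⟪-EuclideanSpace.single i (1 : ℝ), n x⟫_ℝ) :=
      ae_all_iff.2 fun i => (h1 _).and (h1 _)
    have h3 : ∀ᵐ x ∂μ, x ∉ U := by
      filter_upwards [h2, h.norm_normal] with x hx hn hxU
      have : n x = 0 := by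
        ext i
        have h4 := (hx i).1 hxU
        have h5 := (hx i).2 hxU
        simp only [inner_neg_left, EuclideanSpace.inner_single_left, map_one, one_mul] at h4 h5
        simp only [PiLp.zero_apply]
        linarith
      rw [this, norm_zero] at hn
      exact zero_ne_one hn
    simpa [ae_iff] using h3
  have hball : ∀ (x : E N) (p : E N → Prop), (∀ᶠ y in 𝓝 x, p y) → ∃ U, IsOpen U ∧
      Bornology.IsBounded U ∧ x ∈ U ∧ ∀ y ∈ U, p y := by
    intro x p hp
    obtain ⟨ε, hε, hb⟩ := Metric.eventually_nhds_iff_ball.1 hp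
    exact ⟨Metric.ball x ε, Metric.isOpen_ball, Metric.isBounded_ball, Metric.mem_ball_self hε, hb⟩
  have hoff : ∀ᵐ x ∂μ, x ∈ frontier D := by
    refine measure_null_of_locally_null _ fun x hx => ?_
    have hx' : x ∈ D ∨ x ∈ (closure D)ᶜ := by
      by_contra! h0
      refine hx ?_
      rw [hD.frontier_eq]
      exact ⟨not_not.1 h0.2, h0.1⟩
    rcases hx' with hx' | hx'
    · obtain ⟨U, h1, h2, h3, h4⟩ := hball x _ (hD.mem_nhds hx')
      exact ⟨U, mem_nhdsWithin_of_mem_nhds (h1.mem_nhds h3),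
        hcst 1 U h1 h2 fun y hy => iff_of_true (h4 y hy) one_pos⟩
    · obtain ⟨U, h1, h2, h3, h4⟩ := hball x _ (isClosed_closure.isOpen_compl.mem_nhds hx')
      exact ⟨U, mem_nhdsWithin_of_mem_nhds (h1.mem_nhds h3),
        hcst 0 U h1 h2 fun y hy => by simpa using fun h5 => h4 y hy (subset_closure h5)⟩
  suffices hfr : μ {x | ¬(x ∈ frontier D → n x = ξ x)} = 0 by
    filter_upwards [hoff, (hfr : ∀ᵐ x ∂μ, x ∈ frontier D → n x = ξ x)] with x h1 h2
    exact h2 h1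
  refine measure_null_of_locally_null _ fun x hx => ?_
  have hxf : x ∈ frontier D := by
    by_contra h0
    exact hx fun h1 => absurd h1 h0
  obtain ⟨ν, f, hf, hf0, hfg, hfD, -⟩ := hs x hxf
  have hf1 : ContDiff ℝ 1 f := hf.of_le (by exact_mod_cast le_top)
  have hgrad : ContDiff ℝ 1 (gradient f) := by
    have h1 : ContDiff ℝ 1 (fderiv ℝ f) := (contDiff_infty_iff_fderiv.1 hf).2.of_le (by exact_mod_cast le_top)
    exact (InnerProductSpace.toDual ℝ (E N)).symm.contDiff.comp h1
  have hgi : ∀ y v, fderiv ℝ f y v = ⟪gradient f y, v⟫_ℝ := fun y v => by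
    rw [inner_gradient_left]
  obtain ⟨U, h1, h2, h3, h4⟩ := hball x _
    (hfD.eventually_nhds.and (hgrad.continuous.continuousAt.eventually_ne hfg))
  have hUD : ∀ y ∈ U, y ∈ D ↔ 0 < f y := fun y hy => (h4 y hy).1.self_of_nhds
  have k1 := h.ae_inner_nonneg hAD hf1 h1 h2 hUD hgrad fun y => by
    rw [hgi]; exact real_inner_self_nonneg
  -- This is the projection of `v` onto the tangent space, multiplied by `|∇f|²` to keep it `C¹`
  -- where the gradient vanishes. The choices `±eᵢ` force `n` to be parallel to the gradient.
  let w : E N → E N → E N := fun v y =>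
    ‖gradient f y‖ ^ 2 • v - ⟪v, gradient f y⟫_ℝ • gradient f y
  have hw : ∀ v, ContDiff ℝ 1 (w v) := fun v =>
    ((hgrad.norm_sq ℝ).smul contDiff_const).sub ((contDiff_const.inner ℝ hgrad).smul hgrad)
  have k2 : ∀ v, ∀ᵐ y ∂μ, y ∈ U → 0 ≤ ⟪w v y, n y⟫_ℝ := fun v =>
    h.ae_inner_nonneg hAD hf1 h1 h2 hUD (hw v) fun y => by
      rw [hgi, inner_sub_right, real_inner_smul_right, real_inner_smul_right,
        real_inner_self_eq_norm_sq, real_inner_comm]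
      apply le_of_eq
      ring
  have k3 : ∀ᵐ y ∂μ, ∀ i : Fin N, (y ∈ U → 0 ≤ ⟪w (EuclideanSpace.single i 1) y, n y⟫_ℝ) ∧
      (y ∈ U → 0 ≤ ⟪w (-EuclideanSpace.single i 1) y, n y⟫_ℝ) :=
    ae_all_iff.2 fun i => (k2 _).and (k2 _)
  have k4 : ∀ᵐ y ∂μ, y ∉ U ∩ {x | ¬(x ∈ frontier D → n x = ξ x)} := by
    filter_upwards [k1, k3, h.norm_normal] with y hy1 hy3 hn hyU
    obtain ⟨hyU, hy⟩ := hyU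
    refine hy fun hyf => ?_
    set G := gradient f y with hG
    have hG0 : G ≠ 0 := (h4 y hyU).2
    have hpar : ‖G‖ ^ 2 • n y = ⟪G, n y⟫_ℝ • G := by
      ext i
      have q1 := (hy3 i).1 hyU
      have q2 := (hy3 i).2 hyU
      simp only [w, ← hG, inner_sub_left, real_inner_smul_left, inner_neg_left, smul_neg,
        EuclideanSpace.inner_single_left, map_one, one_mul] at q1 q2
      simp only [PiLp.smul_apply, smul_eq_mul]
      linarith
    have hGn : ⟪G, n y⟫_ℝ = ‖G‖ := by
      have q3 := congrArg norm hpar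
      rw [norm_smul, norm_smul, hn, mul_one, Real.norm_of_nonneg (sq_nonneg _),
        Real.norm_of_nonneg (hy1 hyU), sq] at q3
      exact (mul_right_cancel₀ (norm_ne_zero_iff.2 hG0) q3).symm
    have hny : n y = ‖G‖⁻¹ • G := by
      have hn0 := norm_ne_zero_iff.2 hG0
      have q4 := congrArg (fun v => (‖G‖ ^ 2)⁻¹ • v) hpar
      simp only [smul_smul, hGn] at q4
      rw [inv_mul_cancel₀ (pow_ne_zero 2 hn0), one_smul] at q4
      rw [q4]
      congr 1
      field_simp
    have hfy : f y = 0 := eq_zero_of_mem_frontier hD hf.continuous (h4 y hyU).1 hyf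
    have hν : IsInnerUnitNormal D y (n y) := ⟨f, hf, hfy, hG0, (h4 y hyU).1, hny⟩
    exact hν.unique (hξ y hyf)
  refine ⟨U ∩ {x | ¬(x ∈ frontier D → n x = ξ x)},
    inter_mem (mem_nhdsWithin_of_mem_nhds (h1.mem_nhds h3)) self_mem_nhdsWithin, ?_⟩
  rw [ae_iff] at k4
  simp only [not_not] at k4
  exact k4


/-! ### Gronwall's inequality and uniqueness -/

/-- Gronwall's inequality for bounded, not necessarily measurable functions. -/
theorem ae_eq_zero_of_le_lintegral {u : ℝ → ℝ≥0∞} {T C : ℝ} {M : ℝ≥0∞} (hC : 0 ≤ C) (hM : M ≠ ⊤)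
    (hb : ∀ᵐ s ∂(volume.restrict (Ioo 0 T)), u s ≤ M)
    (h : ∀ᵐ s ∂(volume.restrict (Ioo 0 T)), u s ≤ ENNReal.ofReal C * ∫⁻ t in Ioo 0 s, u t) :
    ∀ᵐ s ∂(volume.restrict (Ioo 0 T)), u s = 0 := by
  -- Iterating the inequality from the a priori bound `M` produces the terms of the exponential
  -- series, which tend to zero. Only monotonicity of the lower integral is applied to `u`.
  have key : ∀ n : ℕ, ∀ᵐ s ∂(volume.restrict (Ioo 0 T)),
      u s ≤ M * ENNReal.ofReal ((C * s) ^ n / n.factorial) := by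
    intro n
    induction n with
    | zero => simpa using hb
    | succ n ih =>
      filter_upwards [h, ae_restrict_mem measurableSet_Ioo] with s hs hsT
      refine hs.trans ?_
      have h1 : ∫⁻ t in Ioo 0 s, u t ≤
          ∫⁻ t in Ioo 0 s, M * ENNReal.ofReal ((C * t) ^ n / n.factorial) :=
        lintegral_mono_ae (ae_restrict_of_ae_restrict_of_subset
          (Ioo_subset_Ioo_right hsT.2.le) ih)
      have hi : IntegrableOn (fun t => (C * t) ^ n / n.factorial) (Ioo 0 s) :=
        (Continuous.integrableOn_Icc (by fun_prop)).mono_set Ioo_subset_Icc_self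
      have h2 : ∫⁻ t in Ioo 0 s, ENNReal.ofReal ((C * t) ^ n / n.factorial) =
          ENNReal.ofReal (C ^ n * s ^ (n + 1) / (n + 1).factorial) := by
        rw [← ofReal_integral_eq_lintegral_ofReal hi]
        · congr 1
          rw [← integral_Ioc_eq_integral_Ioo, ← intervalIntegral.integral_of_le hsT.1.le,
            intervalIntegral.integral_div]
          simp_rw [mul_pow]
          rw [intervalIntegral.integral_const_mul, integral_pow, Nat.factorial_succ]
          push_cast
          field_simp
          simp
        · filter_upwards [ae_restrict_mem measurableSet_Ioo] with t ht
          have := ht.1.le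
          positivity
      rw [lintegral_const_mul' _ _ hM, h2] at h1
      refine (mul_le_mul_right h1 _).trans (le_of_eq ?_)
      rw [mul_left_comm, ← ENNReal.ofReal_mul hC]
      congr 2
      ring
  filter_upwards [ae_all_iff.2 key] with s hs
  have h1 : Tendsto (fun n : ℕ => M * ENNReal.ofReal ((C * s) ^ n / n.factorial)) atTop
      (𝓝 (M * ENNReal.ofReal 0)) :=
    ENNReal.Tendsto.const_mul ((ENNReal.continuous_ofReal.tendsto _).comp
      (FloorSemiring.tendsto_pow_div_factorial_atTop (C * s))) (Or.inr hM)
  rw [ENNReal.ofReal_zero, mul_zero] at h1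
  exact nonpos_iff_eq_zero.1 (ge_of_tendsto' h1 hs)

/-! ### Vanishing errors, a priori bounds and coincidence with the calibrated flow. -/

section

variable {σ : E N → ℝ} {T : ℝ} {𝒜 : ℝ → Set (E N)} {ξ B : ℝ → E N → E N} {ϑ : ℝ → E N → ℝ} {δ K : ℝ}

theorem CalibrationBounds.congr {𝒜' : ℝ → Set (E N)} (hb : CalibrationBounds σ T 𝒜 ξ B ϑ δ K)
    (h : ∀ t ∈ Icc 0 T, 𝒜 t = 𝒜' t) : CalibrationBounds σ T 𝒜' ξ B ϑ δ K where
  pos := hb.pos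
  one_le := hb.one_le
  σ_ge := hb.σ_ge
  σ_le := hb.σ_le
  dσ_le := hb.dσ_le
  ξ_le := hb.ξ_le
  dist_sq_le t ht := h t ht ▸ hb.dist_sq_le t ht
  dξ_le := hb.dξ_le
  B_le := hb.B_le
  dB_le := hb.dB_le
  dist_le t ht := h t ht ▸ hb.dist_le t ht
  ϑ_le t ht := h t ht ▸ hb.ϑ_le t ht
  evolution_ξ t ht := h t ht ▸ hb.evolution_ξ t ht
  evolution_ξ_sq t ht := h t ht ▸ hb.evolution_ξ_sq t ht
  evolution_ϑ t ht := h t ht ▸ hb.evolution_ϑ t ht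
  geometric t ht := h t ht ▸ hb.geometric t ht

theorem IsCalibration.relativeEnergy_eq_zero (h : IsCalibration σ T 𝒜 ξ B ϑ) {t : ℝ}
    (ht : t ∈ Icc 0 T) {A : Set (E N)} (hA : HasFinitePerimeter A) (hAD : A =ᵐ[volume] 𝒜 t) :
    relativeEnergy σ (ξ t) A = 0 := by
  have hg := hA.isIndicatorGradient
  rw [relativeEnergy]
  refine (lintegral_congr_ae ?_).trans lintegral_zero
  filter_upwards [hg.norm_normal,
    hg.ae_eq_normal hAD (h.isOpen t ht) (h.smoothBoundary t ht) (h.ξ_eq_normal t ht)] with x h1 h2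
  rw [← h2, real_inner_self_eq_norm_sq, h1]
  simp

theorem bulkError_eq_zero {θ : E N → ℝ} {D A : Set (E N)} (hAD : A =ᵐ[volume] D) :
    bulkError σ θ D A = 0 := by
  rw [bulkError]
  refine (lintegral_congr_ae ?_).trans lintegral_zero
  filter_upwards [indicator_ae_eq_of_ae_eq_set (f := fun _ => (1 : ℝ)) hAD] with x hx
  rw [hx]
  simp

/-- The nonnegative integrand vanishes almost everywhere, so the indicators agree wherever `ϑ ≠ 0`.
By coercivity the zeros of `ϑ` lie on the smooth boundary, a null set. -/
theorem IsCalibration.ae_eq_of_bulkError_eq_zero (h : IsCalibration σ T 𝒜 ξ B ϑ)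
    (hσ : IsSurfaceTension σ) (hσ0 : ∀ x, 0 < σ x) {t : ℝ} (ht : t ∈ Icc 0 T) {A : Set (E N)}
    (hA : NullMeasurableSet A volume) (h0 : bulkError σ (ϑ t) (𝒜 t) A = 0) :
    A =ᵐ[volume] 𝒜 t := by
  have hi := (h.bulkError_eq hσ (fun x => (hσ0 x).le) ht hA (by rw [h0]; exact ENNReal.zero_ne_top)).1
  rw [bulkError, lintegral_eq_zero_iff' hi.aemeasurable.ennreal_ofReal] at h0
  have hfr : ∀ᵐ x, x ∉ frontier (𝒜 t) := by
    have := (h.smoothBoundary t ht).volume_frontier (h.isOpen t ht)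
    simpa [ae_iff] using this
  filter_upwards [h0, hfr] with x h1 h2
  have h3 : ϑ t x ≠ 0 := fun h4 => h2 (h.mem_frontier_of_eq_zero ht h4)
  have h4 := le_antisymm (ENNReal.ofReal_eq_zero.1 h1)
    (h.bulk_integrand_nonneg (fun x => (hσ0 x).le) ht A x)
  rw [mul_eq_zero, mul_eq_zero, or_iff_left h3, or_iff_right (hσ0 x).ne'] at h4
  change (x ∈ A) = (x ∈ 𝒜 t)
  by_cases h5 : x ∈ 𝒜 t <;> by_cases h6 : x ∈ A <;> simp [h5, h6] at h4 ⊢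

/-- The calibrated flow moves in a bounded region only. -/
theorem IsCalibration.exists_subset_union_ball (h : IsCalibration σ T 𝒜 ξ B ϑ) :
    ∃ R : ℝ, ∀ t ∈ Icc 0 T, 𝒜 t ⊆ 𝒜 0 ∪ Metric.closedBall 0 R := by
  obtain ⟨R, hR⟩ := h.exists_frontier_bound
  refine ⟨R, fun t ht x hx => ?_⟩
  by_contra hx0
  rw [mem_union, not_or] at hx0
  have h0T : (0 : ℝ) ∈ Icc 0 T := ⟨le_rfl, ht.1.trans ht.2⟩
  have hneg : ϑ 0 x ≤ 0 := by
    have := hx0.1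
    rw [h.eq_setOf_pos h0T] at this
    exact not_lt.1 this
  -- A point that enters the calibrated set after time `0` sees `ϑ` change sign, hence lies on the
  -- boundary at some intermediate time, and all boundaries lie in one ball.
  have hc : ContinuousOn (fun r => ϑ r x) (Icc 0 t) := fun r hr =>
    (h.hasDerivWithinAt_theta ⟨hr.1, hr.2.trans ht.2⟩ x).continuousWithinAt.mono
      (Icc_subset_Icc_right ht.2)
  obtain ⟨r, hr, hr0⟩ := intermediate_value_Icc ht.1 hc ⟨hneg, (h.ϑ_pos t ht x hx).le⟩
  have hrT : r ∈ Icc 0 T := ⟨hr.1, hr.2.trans ht.2⟩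
  exact hx0.2 (hR r hrT (h.mem_frontier_of_eq_zero hrT hr0))

variable {S : ℝ} {A : ℝ → Set (E N)} {V : ℝ → E N → ℝ} {κ : Kernel ℝ (E N)}

theorem IsBVFlow.exists_relativeEnergy_bound (hb : CalibrationBounds σ T 𝒜 ξ B ϑ δ K)
    (hσ : IsSurfaceTension σ) (hT : 0 < T) (hTS : T ≤ S) (h : IsBVFlow σ S A V κ) :
    ∃ M : ℝ≥0∞, M ≠ ⊤ ∧ ∀ᵐ s ∂(volume.restrict (Ioo 0 T)),
      relativeEnergy σ (ξ s) (A s) ≤ M := by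
  have hS : 0 < S := hT.trans_le hTS
  have hA0 := h.finitePerimeter 0 ⟨le_rfl, hS.le⟩
  refine ⟨ENNReal.ofReal 2 * weightedPerimeter σ (A 0), ?_, ?_⟩
  · rw [hb.weightedPerimeter_eq hσ hA0]
    exact ENNReal.mul_ne_top ENNReal.ofReal_ne_top ENNReal.ofReal_ne_top
  filter_upwards [ae_restrict_of_ae_restrict_of_subset (Ioo_subset_Ioo_right hTS) h.dissipation,
    ae_restrict_mem measurableSet_Ioo] with s hs hsT
  have hsI : s ∈ Icc 0 T := ⟨hsT.1.le, hsT.2.le⟩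
  have hAs := (h.finitePerimeter s ⟨hsI.1, hsI.2.trans hTS⟩).isIndicatorGradient
  refine le_trans ?_ (mul_le_mul_right (le_self_add.trans hs) _)
  rw [weightedPerimeter, ← lintegral_const_mul' _ _ ENNReal.ofReal_ne_top]
  refine lintegral_mono_ae ?_
  filter_upwards [hAs.norm_normal] with x hx
  rw [← ENNReal.ofReal_mul zero_le_two, mul_comm (2 : ℝ)]
  refine ENNReal.ofReal_le_ofReal
    (mul_le_mul_of_nonneg_left ?_ (hb.pos.le.trans (hb.σ_ge x)))
  have h1 := abs_real_inner_le_norm (measureNormal (A s) x) (ξ s x)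
  rw [hx, one_mul] at h1
  linarith [neg_le_of_abs_le h1, hb.ξ_le s hsI x]

variable [IsFiniteKernel κ]

/-- Gronwall's inequality needs a finite a priori bound. Transport tested with the constant `1`
bounds the volume of `A(s)`. The calibrated set is contained in its initial set, whose volume equals
that of `A(0)`, together with a fixed ball. -/
theorem IsBVFlow.exists_bulkError_bound (hb : CalibrationBounds σ T 𝒜 ξ B ϑ δ K)
    (hσ : IsSurfaceTension σ) (hT : 0 < T) (hcal : IsCalibration σ T 𝒜 ξ B ϑ) (hTS : T ≤ S)
    (h : IsBVFlow σ S A V κ) (h0 : A 0 =ᵐ[volume] 𝒜 0) :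
    ∃ M : ℝ≥0∞, M ≠ ⊤ ∧ ∀ᵐ s ∂(volume.restrict (Ioo 0 T)),
      bulkError σ (ϑ s) (𝒜 s) (A s) ≤ M := by
  have hS : 0 < S := hT.trans_le hTS
  have hK : 0 ≤ K := zero_le_one.trans hb.one_le
  have hVi := h.integrable_velocity hb hσ
  have htr := h.velocity.ae_transportsTo h.finitePerimeter hS h.kernel hVi
  obtain ⟨R, hR⟩ := hcal.exists_subset_union_ball
  have hA0 := h.finitePerimeter 0 ⟨le_rfl, hS.le⟩
  set W := volume.real (A 0) + ∫ p, ‖V p.1 p.2‖ ∂(spaceTime S κ)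
  refine ⟨ENNReal.ofReal (K * K) *
    (volume (A 0) + volume (Metric.closedBall (0 : E N) R) + ENNReal.ofReal W), ?_, ?_⟩
  · exact ENNReal.mul_ne_top ENNReal.ofReal_ne_top (ENNReal.add_ne_top.2 ⟨ENNReal.add_ne_top.2
      ⟨hA0.volume_lt_top.ne, measure_closedBall_lt_top.ne⟩, ENNReal.ofReal_ne_top⟩)
  filter_upwards [ae_restrict_of_ae_restrict_of_subset (Ioo_subset_Ioo_right hTS) htr,
    ae_restrict_mem measurableSet_Ioo] with s hs hsT
  have hsI : s ∈ Icc 0 T := ⟨hsT.1.le, hsT.2.le⟩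
  have hAs := h.finitePerimeter s ⟨hsI.1, hsI.2.trans hTS⟩
  have hvA : volume (A s) ≤ ENNReal.ofReal W := by
    have h1 := hs (fun _ => 1) measurable_const ⟨1, fun _ => by simp⟩
    simp only [mul_one, setIntegral_const, smul_eq_mul] at h1
    have h2 : -∫ p in Iio s ×ˢ univ, V p.1 p.2 ∂(spaceTime S κ) ≤
        ∫ p, ‖V p.1 p.2‖ ∂(spaceTime S κ) := by
      refine (neg_le_abs _).trans ?_
      rw [← Real.norm_eq_abs]
      refine (norm_integral_le_integral_norm _).trans ?_
      exact setIntegral_le_integral hVi.norm (ae_of_all _ fun p => norm_nonneg _)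
    rw [← ENNReal.ofReal_toReal hAs.volume_lt_top.ne]
    refine ENNReal.ofReal_le_ofReal ?_
    change volume.real (A s) ≤ W
    linarith
  have hv𝒜 : volume (𝒜 s) ≤ volume (A 0) + volume (Metric.closedBall (0 : E N) R) := by
    refine (measure_mono (hR s hsI)).trans ((measure_union_le _ _).trans ?_)
    rw [measure_congr h0]
  calc bulkError σ (ϑ s) (𝒜 s) (A s)
      ≤ ∫⁻ x, (indicator (𝒜 s) (fun _ => ENNReal.ofReal (K * K)) x +
          indicator (A s) (fun _ => ENNReal.ofReal (K * K)) x) := by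
        refine lintegral_mono fun x => ?_
        have h1 : |ϑ s x| ≤ K :=
          (hb.ϑ_le s hsI x).trans (mul_le_of_le_one_right hK (cutDist_le_one _ _))
        have h2 : ∀ c : ℝ, |c| ≤ 1 → σ x * c * ϑ s x ≤ K * K := fun c hc => by
          refine (le_abs_self _).trans ?_
          rw [abs_mul, abs_mul]
          refine mul_le_mul ?_ h1 (abs_nonneg _) hK
          exact (mul_le_of_le_one_right (abs_nonneg _) hc).trans (hb.abs_σ_le x)
        by_cases h3 : x ∈ 𝒜 s <;> by_cases h4 : x ∈ A s
        · simp [h3, h4]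
        · simpa [h3, h4] using ENNReal.ofReal_le_ofReal (h2 1 (by simp))
        · simpa [h3, h4] using ENNReal.ofReal_le_ofReal (h2 (-1) (by simp))
        · simp [h3, h4]
    _ = ENNReal.ofReal (K * K) * (volume (𝒜 s) + volume (A s)) := by
        rw [lintegral_add_left (measurable_const.indicator (hcal.isOpen s hsI).measurableSet),
          lintegral_indicator_const (hcal.isOpen s hsI).measurableSet,
          lintegral_indicator_const₀ hAs.nullMeasurable, mul_add]
    _ ≤ _ := by gcongr

/-- The relative energy inequality is closed by itself, so Gronwall first removes the relative
energy; this leaves a closed inequality for the bulk error, to which Gronwall applies again. -/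
theorem IsBVFlow.ae_eq_calibrated (hb : CalibrationBounds σ T 𝒜 ξ B ϑ δ K)
    (hσ : IsSurfaceTension σ) (hT : 0 < T) (hcal : IsCalibration σ T 𝒜 ξ B ϑ) (hTS : T ≤ S)
    (h : IsBVFlow σ S A V κ) {C : ℝ} (hC : 0 ≤ C)
    (h1 : ∀ᵐ s ∂(volume.restrict (Ioo 0 T)), relativeEnergy σ (ξ s) (A s) ≤
      relativeEnergy σ (ξ 0) (A 0) +
        ENNReal.ofReal C * ∫⁻ t in Ioo 0 s, relativeEnergy σ (ξ t) (A t))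
    (h2 : ∀ᵐ s ∂(volume.restrict (Ioo 0 T)), bulkError σ (ϑ s) (𝒜 s) (A s) ≤
      relativeEnergy σ (ξ 0) (A 0) + bulkError σ (ϑ 0) (𝒜 0) (A 0) +
        ENNReal.ofReal C * ∫⁻ t in Ioo 0 s,
          (relativeEnergy σ (ξ t) (A t) + bulkError σ (ϑ t) (𝒜 t) (A t)))
    (h0 : A 0 =ᵐ[volume] 𝒜 0) :
    ∀ᵐ s ∂(volume.restrict (Ioo 0 T)), A s =ᵐ[volume] 𝒜 s := by
  have h0T : (0 : ℝ) ∈ Icc 0 T := ⟨le_rfl, hT.le⟩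
  have hfp : ∀ t ∈ Icc 0 T, HasFinitePerimeter (A t) := fun t ht =>
    h.finitePerimeter t ⟨ht.1, ht.2.trans hTS⟩
  rw [hcal.relativeEnergy_eq_zero h0T (hfp 0 h0T) h0] at h1 h2
  rw [bulkError_eq_zero h0] at h2
  simp only [zero_add] at h1 h2
  obtain ⟨M, hM, hMb⟩ := h.exists_relativeEnergy_bound (ξ := ξ) hb hσ hT hTS
  obtain ⟨M', hM', hMb'⟩ := h.exists_bulkError_bound hb hσ hT hcal hTS h0
  have e1 := ae_eq_zero_of_le_lintegral hC hM hMb h1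
  have h3 : ∀ᵐ s ∂(volume.restrict (Ioo 0 T)), bulkError σ (ϑ s) (𝒜 s) (A s) ≤
      ENNReal.ofReal C * ∫⁻ t in Ioo 0 s, bulkError σ (ϑ t) (𝒜 t) (A t) := by
    filter_upwards [h2, ae_restrict_mem measurableSet_Ioo] with s hs hsT
    refine hs.trans (mul_le_mul_right (lintegral_mono_ae ?_) _)
    filter_upwards [ae_restrict_of_ae_restrict_of_subset (Ioo_subset_Ioo_right hsT.2.le) e1]
      with t ht
    rw [ht, zero_add]
  filter_upwards [ae_eq_zero_of_le_lintegral hC hM' hMb' h3, ae_restrict_mem measurableSet_Ioo]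
    with s hs hsT
  have hsI : s ∈ Icc 0 T := ⟨hsT.1.le, hsT.2.le⟩
  exact hcal.ae_eq_of_bulkError_eq_zero hσ (fun x => hb.pos.trans_le (hb.σ_ge x)) hsI
    (hfp s hsI).nullMeasurable hs

end

end WeightedMCF

end

/-! ### Choice of the constant and conclusion. -/

open WeightedMCF in
theorem theorem5p2 (N : ℕ) (hN : 2 ≤ N) (T : ℝ) (hT : 0 < T)
    (σ : E N → ℝ) (hσ : IsSurfaceTension σ)
    (ξ B : ℝ → E N → E N) (ϑ : ℝ → E N → ℝ) :
    ∃ C : ℝ, 0 < C ∧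
      ∀ 𝒜 : ℝ → Set (E N), IsCalibration σ T 𝒜 ξ B ϑ →
      ∀ (Tstar : ℝ) (A : ℝ → Set (E N)), T ≤ Tstar → IsBVSolution σ Tstar A →
        (∀ᵐ T' ∂(volume.restrict (Ioo 0 T)),
          relativeEnergy σ (ξ T') (A T') ≤ relativeEnergy σ (ξ 0) (A 0) +
            ENNReal.ofReal C * ∫⁻ t in Ioo 0 T', relativeEnergy σ (ξ t) (A t)) ∧
        (∀ᵐ T' ∂(volume.restrict (Ioo 0 T)),
          bulkError σ (ϑ T') (𝒜 T') (A T') ≤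
            relativeEnergy σ (ξ 0) (A 0) + bulkError σ (ϑ 0) (𝒜 0) (A 0) +
              ENNReal.ofReal C * ∫⁻ t in Ioo 0 T',
                (relativeEnergy σ (ξ t) (A t) + bulkError σ (ϑ t) (𝒜 t) (A t))) ∧
        (A 0 =ᵐ[volume] 𝒜 0 →
          ∀ᵐ t ∂(volume.restrict (Ioo 0 T)), A t =ᵐ[volume] 𝒜 t) := by
  -- The constant must be fixed before the evolving set, so it is read off from an arbitrary flow
  -- calibrated by the same fields; if there is none, the claim is vacuous.
  by_cases hex : ∃ 𝒜₀ : ℝ → Set (E N), IsCalibration σ T 𝒜₀ ξ B ϑ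
  · obtain ⟨𝒜₀, hcal₀⟩ := hex
    obtain ⟨δ, K, hb₀⟩ := hcal₀.exists_bounds hT hσ
    obtain ⟨η, L, hη, hηc, hη01, hηL, hηt⟩ := exists_cutoff_sequence N
    have hL : 0 ≤ L := (norm_nonneg _).trans (hηL 0 0)
    have hE := hb₀.energyConst_nonneg
    have hB := hb₀.bulkConst_nonneg hL
    set C := energyConst N δ K + bulkConst N δ K L + 1 with hCdef
    have hC : 0 < C := by linarith
    refine ⟨C, hC, fun 𝒜 hcal Tstar A hTS hA => ?_⟩
    -- Two flows with the same calibration coincide on `[0,T]`, both being `{ϑ > 0}`, so the bounds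
    -- carry over.
    have hb : CalibrationBounds σ T 𝒜 ξ B ϑ δ K := hb₀.congr fun t ht => by
      rw [hcal₀.eq_setOf_pos ht, hcal.eq_setOf_pos ht]
    obtain ⟨V, κ, hκ, hflow⟩ := hA.exists_isBVFlow hb.pos hb.σ_ge hb.σ_le (hT.trans_le hTS)
    have h1 := hflow.ae_relativeEnergy_le hb hσ hT hcal hTS (C := C) (by linarith)
    have h2 := hflow.ae_bulkError_le hb hσ hT hcal hTS hη hηc hη01 hηL hηt (C := C)
      (by linarith) hC
    exact ⟨h1, h2, hflow.ae_eq_calibrated hb hσ hT hcal hTS hC.le h1 h2⟩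
  · exact ⟨1, one_pos, fun 𝒜 hcal => absurd ⟨𝒜, hcal⟩ hex⟩
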